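/- Let $d\ge 0$ be an integer and $T>0$. Let $\Gamma$ be the set of $\gamma\in L^2((-1,T);\mathbb R^d)$ that are affine on $(-1,0)$, with the $L^2$ distance and its Borel $\sigma$-algebra, and let $W_0(\gamma)=\gamma(0)-\gamma(-1)$ be the velocity of $\gamma$ on $(-1,0)$. For a Borel probability measure $\eta$ on $\Gamma$ and $t\in(-1,T)$ let $\omega^t_{T_t(\gamma)}$ be the disintegration of $\eta$ along the restriction map $T_t:\gamma\mapsto\gamma|_{(t,T)}$, and put $V_t(\gamma)=\int W_0(\gamma')\,\omega^t_{T_t(\gamma)}(d\gamma')$ (so $V_t=W_0$ $\eta$-a.e. for $t<0$). We say that $\eta$ is a dissipative solution if $\int|\gamma(0)|^2\,\eta(d\gamma)\le1$, $\int\|\dot\gamma\|^2_{L^2(-1,T)}\,\eta(d\gamma)\le 1$ (with $\|\dot\gamma\|_{L^2}=\infty$ if $\gamma\notin W^{1,2}$) and $\dot\gamma(t)=V_t(\gamma)$ for a.e. $t\in[0,T]$ and $\eta$-a.e. $\gamma$. **Proposition.** Let $\eta$ be a dissipative solution, and let $\varpi_t=(\gamma(t),V_t(\gamma))_\#\eta$,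 $t\in(-1,T)$. Then $\varpi_t$ is a probability measure on $\mathbb R^d\times\mathbb R^d$, $t\mapsto\int F(t,x,v)\,\varpi_t(dx\,dv)$ is integrable on $(-1,T)$ for every bounded continuous $F$, and there is an $\mathbb R^d$-valued distribution $\pi$ of order at most $1$ on $\Omega=(-1,T)\times\mathbb R^d\times\mathbb R^d$ such that: 1. $\partial_t\varpi_t+v\cdot\nabla_x\varpi_t+\operatorname{div}_v\pi=0$ in the sense of distributions on $\Omega$, that is, for all $\varphi\in C^2_c(\Omega)$, $$-\int_{-1}^T\!\!\int(\partial_t\varphi+v\cdot\nabla_x\varphi)\,d\varpi_t\,dt+\langle\varphi,\operatorname{div}_v\pi\rangle=0,\qquad \langle\varphi,\operatorname{div}_v\pi\rangle=-\sum_{i=1}^d\langle\partial_{v_i}\varphi,\pi_i\rangle .$$ 2. $|\langle\varphi,\pi\rangle|\le\|\nabla_v\varphi\|_{C^0}$ for all $\varphi\in C^1_c(\Omega)$. 3. $\langle\Psi,\operatorname{div}_v\pi\rangle\ge0$ for every continuous $\Psi(t,x,v)$ that has continuous derivatives $\partial_t\Psi,\nabla_x\Psi$, is convex in $v$, and satisfies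 $\Psi(t,x,v)\le C\psi(t,x)(1+|v|^2)$ for some $C>0$ and $\psi\in C^1_c((-1,T)\times\mathbb R^d)$, with $\Psi(t,x,\cdot)=0$ for $(t,x)\notin\operatorname{supp}\psi$. Here $\langle\Psi,\operatorname{div}_v\pi\rangle$ is the limit as $n\to\infty$ of $\langle\Psi_n,\operatorname{div}_v\pi\rangle$, where $\Psi_n(t,x,v)=\chi(v/n)\Psi(t,x,v)$ with $\chi\in C^2_c(\mathbb R^d)$, $0\le\chi\le1$, $\chi=1$ near $0$; if $\Psi$ is not of class $C^2$, $\langle\Psi_n,\operatorname{div}_v\pi\rangle$ is read through the equation in 1 as $\int_{-1}^T\int(\partial_t\Psi_n+v\cdot\nabla_x\Psi_n)\,d\varpi_t\,dt$. The limit exists in $[0,+\infty]$ and does not depend on $\chi$. Moreover, write $\varpi_t(dx\,dv)=\varpi_{t,x}(dv)\,\rho_t(dx)$ with $\rho_t$ the first marginal of $\varpi_t$, and let $u_t(x)=\int v\,\varpi_{t,x}(dv)$, $w_t(x)=\int v\otimes v\,\varpi_{t,x}(dv)$. Then, in the sense of distributions on $(-1,T)\times\mathbb R^d$ (with $C^1_c$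 test functions), $$\partial_t\rho_t+\operatorname{div}_x(\rho_tu_t)=0,\qquad \partial_t(\rho_tu_t)+\operatorname{div}_x(\rho_tw_t)=0 .$$ -/

import Mathlib

open MeasureTheory ProbabilityTheory Filter Topology Set TopologicalSpace
open scoped Distributions ENNReal

noncomputable section

namespace PressurelessEuler

/-- The Euclidean space `ℝ^d`. -/
abbrev E (d : ℕ) : Type := EuclideanSpace ℝ (Fin d)

/-! ### Curves -/

/-- The space `L²((-1,T), ℝ^d)`. -/
abbrev L2 (T : ℝ) (d : ℕ) : Type := Lp (E d) 2 (volume.restrict (Ioo (-1) T))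

/-- `γ` coincides (a.e.) on `(-1,0)` with the affine map `A`. -/
def AffineBefore {T : ℝ} {d : ℕ} (γ : L2 T d) (A : ℝ →ᵃ[ℝ] E d) : Prop :=
  ∀ᵐ t ∂((volume.restrict (Ioo (-1) T)).restrict (Ioo (-1) 0)), γ t = A t

/-- The space `Γ` of curves in `L²((-1,T), ℝ^d)` that are affine on `(-1,0)`,
with the `L²` distance. -/
def Curve (T : ℝ) (d : ℕ) : Type := {γ : L2 T d // ∃ A, AffineBefore γ A}

instance (T : ℝ) (d : ℕ) : TopologicalSpace (Curve T d) :=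
  inferInstanceAs (TopologicalSpace {γ : L2 T d // ∃ A, AffineBefore γ A})

/-- `Γ` carries its Borel `σ`-algebra. -/
instance (T : ℝ) (d : ℕ) : MeasurableSpace (Curve T d) := borel _

instance (T : ℝ) (d : ℕ) : BorelSpace (Curve T d) := ⟨rfl⟩

theorem isClosed_affineBefore (T : ℝ) (d : ℕ) :
    IsClosed {γ : L2 T d | ∃ A, AffineBefore γ A} := by
  set μ : Measure ℝ := volume.restrict (Ioo (-1) T) with hμ
  have hmem : ∀ p : E d × E d,
      MemLp (fun t : ℝ => p.1 + t • p.2) 2 (μ.restrict (Ioo (-1) 0)) := by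
    intro p
    have hb : MemLp (fun t : ℝ => p.1 + t • p.2) ⊤ (μ.restrict (Ioo (-1) 0)) := by
      refine memLp_top_of_bound (by fun_prop) (‖p.1‖ + ‖p.2‖) ?_
      filter_upwards [ae_restrict_mem measurableSet_Ioo] with t ht
      refine (norm_add_le _ _).trans ?_
      have h1 : ‖t‖ ≤ 1 := by
        rw [Real.norm_eq_abs, abs_le]; constructor <;> linarith [ht.1, ht.2]
      rw [norm_smul]
      nlinarith [norm_nonneg p.2]
    exact hb.mono_exponent le_top
  let F : (E d × E d) →ₗ[ℝ] Lp (E d) 2 (μ.restrict (Ioo (-1) 0)) :=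
    { toFun := fun p => (hmem p).toLp
      map_add' := by
        intro p q
        rw [← MemLp.toLp_add]
        refine MemLp.toLp_congr _ _ (Eventually.of_forall fun t => ?_)
        simp only [Pi.add_apply, Prod.fst_add, Prod.snd_add, smul_add]
        abel
      map_smul' := by
        intro c p
        rw [RingHom.id_apply, ← MemLp.toLp_const_smul]
        refine MemLp.toLp_congr _ _ (Eventually.of_forall fun t => ?_)
        simp only [Pi.smul_apply, Prod.smul_fst, Prod.smul_snd, smul_add]
        rw [smul_comm] }
  have hcl : IsClosed ((LinearMap.range F : Submodule ℝ _) :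
      Set (Lp (E d) 2 (μ.restrict (Ioo (-1) 0)))) :=
    Submodule.closed_of_finiteDimensional (LinearMap.range F)
  have hpre := hcl.preimage (LpToLpRestrictCLM ℝ (E d) ℝ μ 2 (Ioo (-1) 0)).continuous
  convert hpre using 1
  ext γ
  simp only [Set.mem_ofPred_eq, mem_preimage, SetLike.mem_coe, LinearMap.mem_range]
  have hres := LpToLpRestrictCLM_coeFn (F := E d) ℝ (μ := μ) (p := 2) (Ioo (-1) 0) γ
  constructor
  · rintro ⟨A, hA⟩
    refine ⟨(A 0, A.linear 1), Lp.ext ?_⟩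
    filter_upwards [hA, hres, (hmem (A 0, A.linear 1)).coeFn_toLp] with t h1 h2 h3
    refine h3.trans ?_
    rw [h2, h1]
    have := A.map_vadd 0 t
    simp only [vadd_eq_add, add_zero] at this
    rw [this, ← A.linear.map_smul, smul_eq_mul, mul_one, add_comm]
  · rintro ⟨p, hp⟩
    refine ⟨(LinearMap.toSpanSingleton ℝ (E d) p.2).toAffineMap +
      AffineMap.const ℝ ℝ p.1, ?_⟩
    have h3 := (hmem p).coeFn_toLp
    have h4 : ⇑(F p) =ᵐ[μ.restrict (Ioo (-1) 0)] fun t : ℝ => p.1 + t • p.2 := h3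
    rw [hp] at h4
    filter_upwards [hres, h4] with t h1 h2
    rw [← h1, h2]
    simp [add_comm]

instance (T : ℝ) (d : ℕ) : StandardBorelSpace (Curve T d) := by
  have h2 : Fact ((2 : ℝ≥0∞) ≠ ⊤) := ⟨by norm_num⟩
  have hsc : SecondCountableTopology (L2 T d) := Lp.SecondCountableTopology
  have hp : PolishSpace (L2 T d) := inferInstance
  have : PolishSpace (Curve T d) := (isClosed_affineBefore T d).polishSpace
  infer_instance

/-- The initial velocity `W₀(γ) = γ(0) - γ(-1)`, the values at `0` and `-1` being those of the
affine map that `γ` is on `(-1,0)`. -/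
def W0 {T : ℝ} {d : ℕ} (γ : Curve T d) : E d :=
  γ.2.choose 0 - γ.2.choose (-1)

/-- `γ ∈ W^{1,2}((-1,T), ℝ^d)` with weak derivative `g ∈ L²` and `γ(0) = c`: almost everywhere,
`γ(t) = c + ∫_0^t g`. -/
def IsPrimitive {T : ℝ} {d : ℕ} (γ : L2 T d) (c : E d) (g : L2 T d) : Prop :=
  ∀ᵐ t ∂(volume.restrict (Ioo (-1) T)), γ t = c + ∫ s in (0 : ℝ)..t, g s

/-- `‖γ'‖²_{L²(-1,T)}`, which is `∞` if `γ` is not in `W^{1,2}((-1,T), ℝ^d)`. -/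
def energy {T : ℝ} {d : ℕ} (γ : Curve T d) : ℝ≥0∞ :=
  ⨅ (c : E d) (g : L2 T d) (_ : IsPrimitive γ.1 c g), ‖g‖ₑ ^ 2

open Classical in
/-- The position `γ(t)`, for `t ∈ (-1,T)`: the value at `t` of the continuous representative of
a curve `γ ∈ W^{1,2}((-1,T), ℝ^d)` (and `0` for other curves). -/
def pos {T : ℝ} {d : ℕ} (γ : Curve T d) (t : ℝ) : E d :=
  if h : ∃ p : E d × L2 T d, IsPrimitive γ.1 p.1 p.2 then
    h.choose.1 + ∫ s in (0 : ℝ)..t, h.choose.2 s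
  else 0

/-- The velocity `γ'(t)`, which for `γ ∈ W^{1,2}` exists for a.e. `t ∈ (-1,T)`. -/
def vel {T : ℝ} {d : ℕ} (γ : Curve T d) (t : ℝ) : E d := deriv (pos γ) t

/-! ### Dissipative solutions -/

/-- A probability measure `η` on `Γ` belongs to `𝓜(Γ)`. -/
structure MemM {T : ℝ} {d : ℕ} (η : Measure (Curve T d)) [IsProbabilityMeasure η] : Prop where
  energy_le : ∫⁻ γ, energy γ ∂η ≤ 1
  pos_le : ∫⁻ γ, ‖pos γ 0‖ₑ ^ 2 ∂η ≤ 1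

/-- The restriction map `T_t : γ ↦ γ|_{(t,T)} ∈ L²((t,T), ℝ^d)`, for `t ∈ (-1,T)`. -/
def restrictMap {T : ℝ} {d : ℕ} (t : ℝ) (γ : Curve T d) :
    Lp (E d) 2 ((volume.restrict (Ioo (-1) T)).restrict (Ioo t T)) :=
  LpToLpRestrictCLM ℝ (E d) ℝ (volume.restrict (Ioo (-1) T)) 2 (Ioo t T) γ.1

/-- The `σ`-algebra on `Γ` generated by `T_t`. -/
@[reducible]
def futureSigma (T : ℝ) (d : ℕ) (t : ℝ) : MeasurableSpace (Curve T d) :=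
  (borel _).comap (restrictMap t)

/-- The disintegration `γ ↦ ω^t_{T_t(γ)}` of `η` along `T_t`. -/
def omega {T : ℝ} {d : ℕ} (η : Measure (Curve T d)) [IsProbabilityMeasure η] (t : ℝ)
    (γ : Curve T d) : Measure (Curve T d) :=
  condExpKernel η (futureSigma T d t) γ

/-- `V_t(γ) = ∫ W₀(γ') ω^t_{T_t(γ)}(dγ')`. -/
def V {T : ℝ} {d : ℕ} (η : Measure (Curve T d)) [IsProbabilityMeasure η] (t : ℝ)
    (γ : Curve T d) : E d :=
  ∫ γ', W0 γ' ∂(omega η t γ)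

/-- `η ∈ 𝓜(Γ)` is a dissipative solution: `γ'(t) = V_t(γ)` for a.e. `t ∈ [0,T]` and
`η`-a.e. `γ`. -/
structure IsDissipative {T : ℝ} {d : ℕ} (η : Measure (Curve T d)) [IsProbabilityMeasure η] :
    Prop where
  memM : MemM η
  vel_eq : ∀ᵐ t ∂(volume.restrict (Ioo 0 T)), ∀ᵐ γ ∂η, vel γ t = V η t γ

/-! ### The kinetic measure and its Eulerian moments -/

/-- The kinetic measure `ϖ_t = (γ(t), V_t(γ))_# η` on `ℝ^d × ℝ^d`. -/
def kinetic {T : ℝ} {d : ℕ} (η : Measure (Curve T d)) [IsProbabilityMeasure η] (t : ℝ) :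
    Measure (E d × E d) :=
  η.map (fun γ => (pos γ t, V η t γ))

instance {T : ℝ} {d : ℕ} (η : Measure (Curve T d)) [IsProbabilityMeasure η] (t : ℝ) :
    IsFiniteMeasure (kinetic η t) := by
  unfold kinetic; infer_instance

/-- `ρ_t`, the first marginal of `ϖ_t`. -/
def density {T : ℝ} {d : ℕ} (η : Measure (Curve T d)) [IsProbabilityMeasure η] (t : ℝ) :
    Measure (E d) :=
  (kinetic η t).fst

/-- `u_t(x) = ∫ v ϖ_{t,x}(dv)`, where `ϖ_t(dx dv) = ∫ ϖ_{t,x}(dv) ρ_t(dx)`. -/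
def meanVelocity {T : ℝ} {d : ℕ} (η : Measure (Curve T d)) [IsProbabilityMeasure η] (t : ℝ)
    (x : E d) : E d :=
  ∫ v, v ∂((kinetic η t).condKernel x)

/-- `w_t(x) = ∫ v ⊗ v ϖ_{t,x}(dv)`, as a linear map of `ℝ^d` (`v ⊗ v` maps `ξ` to `⟨v, ξ⟩ v`). -/
def momentumFlux {T : ℝ} {d : ℕ} (η : Measure (Curve T d)) [IsProbabilityMeasure η] (t : ℝ)
    (x : E d) : E d →L[ℝ] E d :=
  ∫ v, (innerSL ℝ v).smulRight v ∂((kinetic η t).condKernel x)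

/-! ### Test functions and the kinetic equation -/

/-- The variables `(t, x, v)`. -/
abbrev Phase (d : ℕ) : Type := ℝ × E d × E d

/-- The open set `(-1,T) × ℝ^d × ℝ^d`. -/
def phaseOpen (T : ℝ) (d : ℕ) : Opens (Phase d) :=
  ⟨Ioo (-1) T ×ˢ univ, isOpen_Ioo.prod isOpen_univ⟩

/-- The open set `(-1,T) × ℝ^d`. -/
def spaceTimeOpen (T : ℝ) (d : ℕ) : Opens (ℝ × E d) :=
  ⟨Ioo (-1) T ×ˢ univ, isOpen_Ioo.prod isOpen_univ⟩

/-- `∇_v φ (t, x, v)`. -/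
def gradV {d : ℕ} (φ : Phase d → ℝ) (z : Phase d) : E d :=
  gradient (fun v => φ (z.1, z.2.1, v)) z.2.2

/-- `(∂_t φ + v · ∇_x φ)(t, x, v)`. -/
def transport {d : ℕ} (φ : Phase d → ℝ) (z : Phase d) : ℝ :=
  fderiv ℝ (fun p : ℝ × E d => φ (p.1, p.2, z.2.2)) (z.1, z.2.1) (1, z.2.2)

/-- `∫ ∫ (∂_t φ + v · ∇_x φ) ϖ_t(dx dv) dt = - ⟨φ, ∂_t ϖ + v · ∇_x ϖ⟩`. -/
def kineticAction {T : ℝ} {d : ℕ} (η : Measure (Curve T d)) [IsProbabilityMeasure η]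
    (φ : Phase d → ℝ) : ℝ :=
  ∫ t in Ioo (-1) T, ∫ z, transport φ (t, z) ∂(kinetic η t)

/-- The distribution `div_v π = ∑ᵢ ∂_{vᵢ} πᵢ`, of order at most `2`, for an `ℝ^d`-valued
distribution `π` of order at most `1`. -/
def divV {T : ℝ} {d : ℕ} (π : 𝓓'^{1}(phaseOpen T d, E d)) : 𝓓'^{2}(phaseOpen T d, ℝ) :=
  ∑ i : Fin d, Distribution.lineDerivCLM ((0, 0, EuclideanSpace.single i 1) : Phase d)
    (Distribution.mapCLM (EuclideanSpace.proj i : E d →L[ℝ] ℝ) π : 𝓓'^{1}(phaseOpen T d, ℝ))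

/-! ### Convex test functions with quadratic growth -/

/-- `Ψ(t,x,v)` is continuous, of class `C¹` in `(t,x)`, convex in `v`, and for some `C > 0` and
`ψ ∈ C¹_c((-1,T) × ℝ^d)` one has `Ψ(t,x,v) ≤ C ψ(t,x) (1 + |v|²)`, with `Ψ(t,x,·) = 0` for `(t,x)`
outside the support of `ψ`. -/
structure IsConvexTest (T : ℝ) {d : ℕ} (Ψ : Phase d → ℝ) : Prop where
  continuous : Continuous Ψ
  differentiable : ∀ v : E d, Differentiable ℝ (fun p : ℝ × E d => Ψ (p.1, p.2, v))
  continuous_fderiv : Continuous fun z : Phase d =>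
    fderiv ℝ (fun p : ℝ × E d => Ψ (p.1, p.2, z.2.2)) (z.1, z.2.1)
  convex : ∀ (t : ℝ) (x : E d), ConvexOn ℝ univ (fun v => Ψ (t, x, v))
  growth : ∃ C : ℝ, 0 < C ∧ ∃ ψ : 𝓓^{1}(spaceTimeOpen T d, ℝ),
    (∀ t x v, Ψ (t, x, v) ≤ C * ψ (t, x) * (1 + ‖v‖ ^ 2)) ∧
    ∀ t x v, (t, x) ∉ tsupport ψ → Ψ (t, x, v) = 0

/-- `χ ∈ C²_c(ℝ^d)` with `0 ≤ χ ≤ 1` and `χ = 1` near the origin. -/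
structure IsCutoff {d : ℕ} (χ : 𝓓^{2}((⊤ : Opens (E d)), ℝ)) : Prop where
  nonneg : ∀ v, 0 ≤ χ v
  le_one : ∀ v, χ v ≤ 1
  eq_one : ∀ᶠ v in 𝓝 0, χ v = 1

/-- The truncation `χ(v / (n+1)) Ψ(t,x,v)`. -/
def truncate {d : ℕ} (χ : 𝓓^{2}((⊤ : Opens (E d)), ℝ)) (n : ℕ) (Ψ : Phase d → ℝ)
    (z : Phase d) : ℝ :=
  χ (((n : ℝ) + 1)⁻¹ • z.2.2) * Ψ z

/-- The truncation of a convex test function of class `C²` is a test function of class `C²`. -/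
def truncTest {T : ℝ} {d : ℕ} (χ : 𝓓^{2}((⊤ : Opens (E d)), ℝ)) (n : ℕ) {Ψ : Phase d → ℝ}
    (hΨ : IsConvexTest T Ψ) (h2 : ContDiff ℝ 2 Ψ) : 𝓓^{2}(phaseOpen T d, ℝ) :=
  have hsub : ∃ K : Set (Phase d), IsCompact K ∧ K ⊆ phaseOpen T d ∧
      tsupport (truncate χ n Ψ) ⊆ K := by
    obtain ⟨C, -, ψ, -, hψ⟩ := hΨ.growth
    have hn : ((n : ℝ) + 1)⁻¹ ≠ 0 := by positivity
    let e : E d ≃ₜ E d := Homeomorph.smulOfNeZero (((n : ℝ) + 1)⁻¹) hn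
    have hc1 : IsCompact (tsupport ψ) := ψ.hasCompactSupport
    have hc2 : IsCompact (e ⁻¹' tsupport χ) :=
      e.isCompact_preimage.2 χ.hasCompactSupport
    let f : Phase d ≃ₜ (ℝ × E d) × E d := (Homeomorph.prodAssoc ℝ (E d) (E d)).symm
    have hK : IsCompact (f ⁻¹' (tsupport ψ ×ˢ (e ⁻¹' tsupport χ))) :=
      f.isCompact_preimage.2 (hc1.prod hc2)
    refine ⟨_, hK, ?_, closure_minimal ?_ hK.isClosed⟩
    · rintro ⟨t, x, v⟩ hz
      have h1 : (t, x) ∈ tsupport ψ := hz.1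
      exact ⟨(ψ.tsupport_subset h1).1, mem_univ _⟩
    · rintro ⟨t, x, v⟩ hz
      rw [Function.mem_support, truncate] at hz
      refine ⟨?_, ?_⟩
      · by_contra hcon
        exact hz (by rw [hψ t x v hcon, mul_zero])
      · exact subset_tsupport _ (left_ne_zero_of_mul hz)
  { toFun := truncate χ n Ψ
    contDiff' := by
      have hχ : ContDiff ℝ 2 χ := χ.contDiff
      have h : ContDiff ℝ 2 (fun z : Phase d => χ (((n : ℝ) + 1)⁻¹ • z.2.2)) :=
        hχ.comp (contDiff_snd.snd.const_smul _)
      exact h.mul h2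
    hasCompactSupport' := by
      obtain ⟨K, hK, -, h⟩ := hsub
      exact hK.of_isClosed_subset (isClosed_tsupport _) h
    tsupport_subset' := by
      obtain ⟨K, -, hK, h⟩ := hsub
      exact h.trans hK }

end PressurelessEuler

end

open PressurelessEuler

/-! The velocity `V_t` is the conditional expectation of `W0` given the future of the curve after
`t`. The σ-algebras of the future decrease in `t`, so `V` is a reverse martingale closed by `W0`.
For `t < 0` the future determines `W0`, hence `V_t = W0` is the derivative of the curve there too.
The energy bound puts `W0` in the unit ball of L². What is needed is collected in `MartingaleFlow`:
positions `X t`, measurable for the future, that move with the martingale velocity. By Pythagoras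
the squared L² distance of `V_s` and `V_t` is the loss of kinetic energy between the two times. This
energy is monotone, so `V` is L²-continuous outside a countable set of times.

For a test function `Φ`, the integral of `∂_t Φ + v · ∇_x Φ` is the limit of the difference
quotients of `Φ(t, X t, V t)` with the velocity frozen at `V t`. A translation in time turns these
quotients into `δ⁻¹ ∫ E[Φ(t+δ, X(t+δ), V t) - Φ(t+δ, X(t+δ), V(t+δ))] dt`, where only the velocity
changes (`tendsto_transport`). If `Φ` does not depend on `v` this vanishes, which is conservation of
mass. With an additional factor `V` it vanishes by the martingale property, which is conservation of
momentum.

In general, the fundamental theorem of calculus on the segment from `V(t+δ)` to `V t` writes the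
increment as the average of `∇_v Φ` paired with `V t - V(t+δ)`. This defines an approximate defect.
The martingale property allows the value at `V(t+δ)` to be subtracted from the average, so the
defect is bounded by `‖∇_v φ‖` times the mean of `‖V t - V(t+δ)‖²`. The latter is an energy loss;
its time integral telescopes to at most `δ`. The distribution `π` is minus a limit of the defects
along an ultrafilter (`defectDistribution`).

For `Ψ` convex in `v`, the increment of `Ψ` has nonnegative mean by the conditional Jensen
inequality, but truncation destroys convexity. The increment of `χ Ψ` between `b` and `b'` splits
into `χ(b)` times the increment of `Ψ`, a term linear in `b' - b` with zero mean, and a second order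
remainder that vanishes when both velocities lie where `χ = 1`. This remainder is bounded by the
Bregman divergence of the weight `‖v‖⁴ / (A + ‖v‖²)`, with `A` of the order of the squared
truncation radius. Its total contribution is at most a constant times `E[weight A (‖W0‖²)]`, which
tends to `0` by dominated convergence. The truncated actions are therefore nonnegative, monotone and
independent of the cutoff up to vanishing errors, and they have a common limit in `[0, ∞]`. -/

noncomputable section

namespace PressurelessEuler

/-! ### `L²` norms -/

section LpNorm

variable {Ω : Type*} {mΩ : MeasurableSpace Ω} {μ : Measure Ω}
  {F G : Type*} [NormedAddCommGroup F] [NormedAddCommGroup G]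

lemma lpNorm_two_sq {f : Ω → F} (hf : AEStronglyMeasurable f μ) :
    lpNorm f 2 μ ^ 2 = ∫ ω, ‖f ω‖ ^ 2 ∂μ := by
  rw [lpNorm_eq_integral_norm_rpow_toReal (by norm_num) (by norm_num) hf]
  simp only [ENNReal.toReal_ofNat, Real.rpow_two]
  rw [← Real.rpow_natCast, ← Real.rpow_mul (integral_nonneg fun _ => by positivity)]
  norm_num

lemma integral_norm_mul_norm_le {f : Ω → F} {g : Ω → G} (hf : MemLp f 2 μ) (hg : MemLp g 2 μ) :
    ∫ ω, ‖f ω‖ * ‖g ω‖ ∂μ ≤ lpNorm f 2 μ * lpNorm g 2 μ := by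
  have h := integral_mul_norm_le_Lp_mul_Lq (f := fun ω => ‖f ω‖) (g := fun ω => ‖g ω‖) (μ := μ)
    Real.HolderConjugate.two_two (by simpa using hf.norm) (by simpa using hg.norm)
  simp only [norm_norm] at h
  refine h.trans_eq ?_
  rw [lpNorm_eq_integral_norm_rpow_toReal (by norm_num) (by norm_num) hf.1,
    lpNorm_eq_integral_norm_rpow_toReal (by norm_num) (by norm_num) hg.1]
  simp

lemma integrable_norm_mul_norm {f : Ω → F} {g : Ω → G} (hf : MemLp f 2 μ) (hg : MemLp g 2 μ) :
    Integrable (fun ω => ‖f ω‖ * ‖g ω‖) μ :=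
  hf.norm.integrable_mul hg.norm

lemma integral_norm_le_lpNorm_two [IsProbabilityMeasure μ] {f : Ω → F} (hf : MemLp f 2 μ) :
    ∫ ω, ‖f ω‖ ∂μ ≤ lpNorm f 2 μ := by
  have h := integral_norm_mul_norm_le hf (memLp_const (1 : ℝ) (μ := μ) (p := 2))
  simpa [lpNorm_const' (E := ℝ) (μ := μ) (p := 2) (by norm_num) (by norm_num) 1] using h

lemma tendstoInMeasure_of_tendsto_lpNorm {ι : Type*} {l : Filter ι} {f : ι → Ω → F} {g : Ω → F}
    (hf : ∀ᶠ i in l, MemLp (fun ω => f i ω - g ω) 2 μ)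
    (h : Tendsto (fun i => lpNorm (fun ω => f i ω - g ω) 2 μ) l (𝓝 0)) :
    TendstoInMeasure μ f l g := by
  classical
  -- The hypothesis `hf` holds only eventually; the other indices are filled with `0`.
  have h0 : TendstoInMeasure μ
      (fun i => if MemLp (fun ω => f i ω - g ω) 2 μ then fun ω => f i ω - g ω else 0) l
      (fun _ => 0) := by
    refine tendstoInMeasure_of_tendsto_eLpNorm (p := 2) (by norm_num) (fun i => ?_)
      aestronglyMeasurable_const ?_
    · split_ifs with hi
      · exact hi.1
      · exact aestronglyMeasurable_const
    · have := ENNReal.tendsto_ofReal h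
      rw [ENNReal.ofReal_zero] at this
      refine this.congr' ?_
      filter_upwards [hf] with i hi
      rw [if_pos hi, ofReal_lpNorm hi]
      congr 1
      ext ω; simp
  intro ε hε
  refine (h0 ε hε).congr' ?_
  filter_upwards [hf] with i hi
  rw [if_pos hi]
  simp [edist_eq_enorm_sub]

lemma tendstoInMeasure_prodMk {ι : Type*} {l : Filter ι} {f : ι → Ω → F} {g : Ω → F}
    {f' : ι → Ω → G} {g' : Ω → G} (h : TendstoInMeasure μ f l g) (h' : TendstoInMeasure μ f' l g') :
    TendstoInMeasure μ (fun i ω => (f i ω, f' i ω)) l (fun ω => (g ω, g' ω)) := by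
  intro ε hε
  have := (h ε hε).add (h' ε hε)
  rw [add_zero] at this
  refine tendsto_of_tendsto_of_tendsto_of_le_of_le tendsto_const_nhds this (fun _ => zero_le)
    fun i => (measure_mono ?_).trans (measure_union_le _ _)
  intro ω hω
  simpa [Prod.edist_eq, le_max_iff] using hω

lemma tendstoInMeasure_const {ι : Type*} {l : Filter ι} {f : ι → F} {c : F}
    (h : Tendsto f l (𝓝 c)) : TendstoInMeasure μ (fun i _ => f i) l (fun _ => c) := by
  intro ε hε
  refine tendsto_const_nhds.congr' ?_
  filter_upwards [(EMetric.tendsto_nhds.1 h) ε hε] with i hi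
  have : {_ω : Ω | ε ≤ edist (f i) c} = ∅ := by
    ext; simp [hi]
  rw [this, measure_empty]

/-- Expectations of `G(Z) • Y` depend continuously on `Z` (in measure) and on `Y` (in `L²`), for
bounded continuous `G`. -/
lemma tendsto_integral_smul [IsProbabilityMeasure μ] {H : Type*} [NormedAddCommGroup H]
    [NormedSpace ℝ H] {ι : Type*} {l : Filter ι} [l.IsCountablyGenerated]
    {Z : ι → Ω → F} {Z₀ : Ω → F} {Y : ι → Ω → H} {Y₀ : Ω → H} {g : F → ℝ} {C : ℝ}
    (hg : Continuous g) (hC : ∀ z, ‖g z‖ ≤ C)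
    (hZ : ∀ i, AEStronglyMeasurable (Z i) μ)
    (hY : ∀ i, MemLp (Y i) 2 μ) (hY₀ : MemLp Y₀ 2 μ)
    (h : TendstoInMeasure μ Z l Z₀)
    (h' : Tendsto (fun i => lpNorm (Y i - Y₀) 2 μ) l (𝓝 0)) :
    Tendsto (fun i => ∫ ω, g (Z i ω) • Y i ω ∂μ) l (𝓝 (∫ ω, g (Z₀ ω) • Y₀ ω ∂μ)) := by
  have hbd : ∀ {z : Ω → F} {y : Ω → H}, AEStronglyMeasurable z μ → MemLp y 2 μ →
      Integrable (fun ω => g (z ω) • y ω) μ := fun hz hy =>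
    (hy.integrable (by norm_num)).bdd_smul C (hg.comp_aestronglyMeasurable hz)
      (Eventually.of_forall fun ω => hC _)
  have hC0 : 0 ≤ C := (norm_nonneg _).trans (hC 0)
  -- The variation of `Y` is controlled in L², uniformly in `Z`; that of `Z` is then treated with
  -- `Y₀` fixed.
  have h1 : Tendsto (fun i => ∫ ω, g (Z i ω) • (Y i ω - Y₀ ω) ∂μ) l (𝓝 0) := by
    refine squeeze_zero_norm (a := fun i => C * lpNorm (Y i - Y₀) 2 μ) (fun i => ?_)
      (by simpa using h'.const_mul C)
    refine (norm_integral_le_integral_norm _).trans ?_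
    have hi := ((hY i).sub hY₀)
    refine le_trans ?_ (mul_le_mul_of_nonneg_left (integral_norm_le_lpNorm_two hi) hC0)
    rw [← integral_const_mul]
    refine integral_mono_of_nonneg (Eventually.of_forall fun _ => norm_nonneg _)
      ((hi.integrable (by norm_num)).norm.const_mul C) (Eventually.of_forall fun ω => ?_)
    simp only [norm_smul, Pi.sub_apply]
    exact mul_le_mul_of_nonneg_right (hC _) (norm_nonneg _)
  have h2 : Tendsto (fun i => ∫ ω, g (Z i ω) • Y₀ ω ∂μ) l (𝓝 (∫ ω, g (Z₀ ω) • Y₀ ω ∂μ)) := by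
    -- Convergence in measure gives almost everywhere convergence along a subsequence of any
    -- subsequence, and dominated convergence applies there.
    refine tendsto_of_subseq_tendsto fun ns hns => ?_
    obtain ⟨ms, -, hms⟩ := (h.comp hns).exists_seq_tendsto_ae
    refine ⟨ms, tendsto_integral_of_dominated_convergence (fun ω => C * ‖Y₀ ω‖)
      (fun n => (hbd (hZ _) hY₀).1) ((hY₀.integrable (by norm_num)).norm.const_mul C)
      (fun n => Eventually.of_forall fun ω => ?_) ?_⟩
    · rw [norm_smul]
      exact mul_le_mul_of_nonneg_right (hC _) (norm_nonneg _)
    · filter_upwards [hms] with ω hω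
      exact ((hg.tendsto _).comp hω).smul_const _
  have h3 := h1.add h2
  rw [zero_add] at h3
  refine h3.congr fun i => ?_
  rw [← integral_add]
  · refine integral_congr_ae (Eventually.of_forall fun ω => ?_)
    simp [smul_sub]
  · exact hbd (hZ i) ((hY i).sub hY₀)
  · exact hbd (hZ i) hY₀

end LpNorm

/-! ### Reverse martingales and the flow they generate -/

/-- Positions `X t`, adapted to a decreasing family of `σ`-algebras `ℱ`, and moving on `(-1,T)`
with the velocity `η[W | ℱ t]`, a reverse martingale closed by `W` in the unit ball of `L²`. -/
structure MartingaleFlow {Ω : Type*} {mΩ : MeasurableSpace Ω} {d : ℕ} (T : ℝ) (η : Measure Ω)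
    (ℱ : ℝ → MeasurableSpace Ω) (W : Ω → E d) (X : ℝ → Ω → E d) : Prop where
  le : ∀ t, ℱ t ≤ mΩ
  anti : Antitone ℱ
  memLp : MemLp W 2 η
  norm_le : lpNorm W 2 η ≤ 1
  meas : ∀ t, StronglyMeasurable[ℱ t] (X t)
  memLp_sub : ∀ s ∈ Ioo (-1) T, ∀ t ∈ Ioo (-1) T, MemLp (X t - X s) 2 η
  increment : ∀ s ∈ Ioo (-1) T, ∀ t ∈ Ioo (-1) T, s ≤ t →
    lpNorm (X t - X s - (t - s) • η[W | ℱ s]) 2 η ≤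
      (t - s) * lpNorm (η[W | ℱ s] - η[W | ℱ t]) 2 η

namespace MartingaleFlow

variable {Ω : Type*} {mΩ : MeasurableSpace Ω} {d : ℕ} {T : ℝ} {η : Measure Ω}
  {ℱ : ℝ → MeasurableSpace Ω} {W : Ω → E d} {X : ℝ → Ω → E d}

lemma memLp_vel (h : MartingaleFlow T η ℱ W X) (t : ℝ) : MemLp (η[W | ℱ t]) 2 η :=
  h.memLp.condExp (by norm_num)

lemma lpNorm_vel_le (h : MartingaleFlow T η ℱ W X) (t : ℝ) : lpNorm (η[W | ℱ t]) 2 η ≤ 1 :=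
  (h.memLp.lpNorm_condExp_le_lpNorm (by norm_num)).trans h.norm_le

lemma aesm_pos (h : MartingaleFlow T η ℱ W X) (t : ℝ) : AEStronglyMeasurable (X t) η :=
  ((h.meas t).mono (h.le t)).aestronglyMeasurable

/-- The kinetic energy at time `t`. -/
def kineticEnergy (η : Measure Ω) (ℱ : ℝ → MeasurableSpace Ω) (W : Ω → E d) (t : ℝ) : ℝ :=
  ∫ ω, ‖(η[W | ℱ t]) ω‖ ^ 2 ∂η

lemma kineticEnergy_nonneg (t : ℝ) : 0 ≤ kineticEnergy η ℱ W t :=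
  integral_nonneg fun _ => by positivity

lemma kineticEnergy_le_one (h : MartingaleFlow T η ℱ W X) (t : ℝ) : kineticEnergy η ℱ W t ≤ 1 := by
  rw [kineticEnergy, ← lpNorm_two_sq (h.memLp_vel t).1]
  exact pow_le_one₀ lpNorm_nonneg (h.lpNorm_vel_le t)

/-- The drift contributes at most `t - s`, and the error in `increment` at most `2 (t - s)`, the
velocities being in the unit ball: hence the 3. -/
lemma lpNorm_pos_sub_le (h : MartingaleFlow T η ℱ W X) {s t : ℝ} (hs : s ∈ Ioo (-1) T)
    (ht : t ∈ Ioo (-1) T) : lpNorm (X t - X s) 2 η ≤ 3 * |t - s| := by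
  wlog hst : s ≤ t generalizing s t
  · rw [lpNorm_sub_comm, abs_sub_comm]
    exact this ht hs (not_le.1 hst).le
  have h1 := h.increment s hs t ht hst
  have h2 : lpNorm (X t - X s) 2 η ≤ lpNorm ((t - s) • η[W | ℱ s]) 2 η +
      lpNorm (X t - X s - (t - s) • η[W | ℱ s]) 2 η :=
    lpNorm_le_lpNorm_add_lpNorm_sub' ((h.memLp_vel s).const_smul _) (by norm_num)
  have h3 : lpNorm ((t - s) • η[W | ℱ s]) 2 η = (t - s) * lpNorm (η[W | ℱ s]) 2 η := by
    rw [lpNorm_const_smul]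
    simp [abs_of_nonneg (sub_nonneg.2 hst)]
  have h4 : lpNorm (η[W | ℱ s] - η[W | ℱ t]) 2 η ≤ 1 + 1 :=
    (lpNorm_sub_le (h.memLp_vel s) (by norm_num)).trans
      (add_le_add (h.lpNorm_vel_le s) (h.lpNorm_vel_le t))
  rw [abs_of_nonneg (sub_nonneg.2 hst)]
  have := h.lpNorm_vel_le s
  have h0 := sub_nonneg.2 hst
  rw [h3] at h2
  nlinarith

lemma tendstoInMeasure_pos (h : MartingaleFlow T η ℱ W X) {t : ℝ} (ht : t ∈ Ioo (-1) T) :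
    TendstoInMeasure η X (𝓝 t) (X t) := by
  have hn : ∀ᶠ s in 𝓝 t, s ∈ Ioo (-1) T := isOpen_Ioo.mem_nhds ht
  refine tendstoInMeasure_of_tendsto_lpNorm (hn.mono fun s hs => h.memLp_sub t ht s hs) ?_
  have : Tendsto (fun s : ℝ => 3 * |s - t|) (𝓝 t) (𝓝 0) := by
    have : Continuous fun s : ℝ => 3 * |s - t| := by fun_prop
    simpa using this.tendsto t
  exact squeeze_zero' (Eventually.of_forall fun _ => lpNorm_nonneg) (hn.mono fun s hs =>
    h.lpNorm_pos_sub_le ht hs) this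

variable [IsProbabilityMeasure η]

/-- The martingale property, tested against an `ℱ t`-measurable `Y`. -/
lemma integral_bilin_vel (h : MartingaleFlow T η ℱ W X) {s t : ℝ} (hst : s ≤ t)
    {F G : Type*} [NormedAddCommGroup F] [NormedSpace ℝ F] [NormedAddCommGroup G] [NormedSpace ℝ G]
    [CompleteSpace G] (B : F →L[ℝ] E d →L[ℝ] G) {Y : Ω → F} (hY : StronglyMeasurable[ℱ t] Y)
    (hi : Integrable (fun ω => B (Y ω) (η[W | ℱ s] ω)) η) :
    ∫ ω, B (Y ω) (η[W | ℱ s] ω) ∂η = ∫ ω, B (Y ω) (η[W | ℱ t] ω) ∂η := by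
  have h1 := condExp_bilin_of_stronglyMeasurable_left B hY hi (integrable_condExp)
  have h2 : η[η[W | ℱ s] | ℱ t] =ᵐ[η] η[W | ℱ t] :=
    condExp_condExp_of_le (h.anti hst) (h.le s)
  rw [← integral_condExp (h.le t)]
  refine integral_congr_ae ?_
  filter_upwards [h1, h2] with ω h1 h2
  rw [h1, h2]

/-- Pythagoras: the velocity at `t` is the orthogonal projection in L² of the velocity at `s`, so
the cross term is the kinetic energy at `t`. -/
lemma integral_norm_sub_sq (h : MartingaleFlow T η ℱ W X) {s t : ℝ} (hst : s ≤ t) :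
    ∫ ω, ‖η[W | ℱ s] ω - η[W | ℱ t] ω‖ ^ 2 ∂η = kineticEnergy η ℱ W s - kineticEnergy η ℱ W t := by
  have hs := h.memLp_vel s
  have ht := h.memLp_vel t
  have hi : Integrable (fun ω => inner ℝ (η[W | ℱ t] ω) (η[W | ℱ s] ω)) η := by
    refine (integrable_norm_mul_norm ht hs).mono' (ht.1.inner hs.1)
      (Eventually.of_forall fun ω => norm_inner_le_norm _ _)
  have h1 : ∫ ω, inner ℝ (η[W | ℱ t] ω) (η[W | ℱ s] ω) ∂η = kineticEnergy η ℱ W t := by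
    refine (h.integral_bilin_vel hst (innerSL ℝ) (stronglyMeasurable_condExp (f := W)) hi).trans ?_
    refine integral_congr_ae (Eventually.of_forall fun ω => ?_)
    exact (innerSL_apply_apply ..).trans (real_inner_self_eq_norm_sq _)
  have e : ∀ ω, ‖η[W | ℱ s] ω - η[W | ℱ t] ω‖ ^ 2 = ‖η[W | ℱ s] ω‖ ^ 2 -
      2 * inner ℝ (η[W | ℱ t] ω) (η[W | ℱ s] ω) + ‖η[W | ℱ t] ω‖ ^ 2 := fun ω => by
    rw [norm_sub_sq_real, real_inner_comm]
  simp_rw [e]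
  have hs2 := hs.integrable_norm_pow (by norm_num)
  have ht2 := ht.integrable_norm_pow (by norm_num)
  rw [integral_add (f := fun ω => ‖η[W | ℱ s] ω‖ ^ 2 - 2 * inner ℝ (η[W | ℱ t] ω) (η[W | ℱ s] ω))
    (hs2.sub (hi.const_mul 2)) ht2, integral_sub hs2 (hi.const_mul 2),
    integral_const_mul, h1]
  unfold kineticEnergy
  ring

lemma lpNorm_vel_sub_sq (h : MartingaleFlow T η ℱ W X) {s t : ℝ} (hst : s ≤ t) :
    lpNorm (η[W | ℱ s] - η[W | ℱ t]) 2 η ^ 2 = kineticEnergy η ℱ W s - kineticEnergy η ℱ W t := by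
  rw [lpNorm_two_sq ((h.memLp_vel s).sub (h.memLp_vel t)).1, ← h.integral_norm_sub_sq hst]
  rfl

lemma kineticEnergy_antitone (h : MartingaleFlow T η ℱ W X) : Antitone (kineticEnergy η ℱ W) :=
  fun s t hst => by
    have := h.lpNorm_vel_sub_sq hst
    nlinarith [sq_nonneg (lpNorm (η[W | ℱ s] - η[W | ℱ t]) 2 η)]

/-- The times at which the kinetic energy jumps. -/
def jumps (η : Measure Ω) (ℱ : ℝ → MeasurableSpace Ω) (W : Ω → E d) : Set ℝ :=
  {t | ¬ ContinuousAt (kineticEnergy η ℱ W) t}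

lemma countable_jumps (h : MartingaleFlow T η ℱ W X) : (jumps η ℱ W).Countable :=
  h.kineticEnergy_antitone.countable_not_continuousAt

/-- The L² distance of two velocities is the square root of the energy difference, so continuity of
the scalar energy is all that is needed. -/
lemma tendsto_vel (h : MartingaleFlow T η ℱ W X) {t : ℝ} (ht : t ∉ jumps η ℱ W) :
    Tendsto (fun s => lpNorm (η[W | ℱ s] - η[W | ℱ t]) 2 η) (𝓝 t) (𝓝 0) := by
  have hc : ContinuousAt (kineticEnergy η ℱ W) t := not_not.1 ht
  have h1 : Tendsto (fun s => √|kineticEnergy η ℱ W s - kineticEnergy η ℱ W t|) (𝓝 t) (𝓝 0) := by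
    have := ((hc.tendsto.sub_const (kineticEnergy η ℱ W t)).abs).sqrt
    simpa using this
  refine h1.congr fun s => ?_
  rcases le_total s t with hst | hst
  · rw [← h.lpNorm_vel_sub_sq hst, abs_of_nonneg (sq_nonneg _), Real.sqrt_sq lpNorm_nonneg]
  · rw [abs_sub_comm, ← h.lpNorm_vel_sub_sq hst, abs_of_nonneg (sq_nonneg _),
      Real.sqrt_sq lpNorm_nonneg, lpNorm_sub_comm]

lemma tendstoInMeasure_vel (h : MartingaleFlow T η ℱ W X) {t : ℝ} (ht : t ∉ jumps η ℱ W) :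
    TendstoInMeasure η (fun s => η[W | ℱ s]) (𝓝 t) (η[W | ℱ t]) :=
  tendstoInMeasure_of_tendsto_lpNorm
    (Eventually.of_forall fun s => (h.memLp_vel s).sub (h.memLp_vel t)) (h.tendsto_vel ht)

end MartingaleFlow

/-- Expectations along the flow are continuous in time only away from countably many jumps. That
suffices for measurability, a countable set being null. -/
lemma aestronglyMeasurable_of_continuousAt {F : Type*} [NormedAddCommGroup F]
    {f : ℝ → F} {D : Set ℝ} (hD : D.Countable) {a b : ℝ}
    (hf : ∀ t ∈ Ioo a b, t ∉ D → ContinuousAt f t) :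
    AEStronglyMeasurable f (volume.restrict (Ioo a b)) := by
  have hm : MeasurableSet (Ioo a b ∩ Dᶜ) := measurableSet_Ioo.inter hD.measurableSet.compl
  have h1 : AEStronglyMeasurable f (volume.restrict (Ioo a b ∩ Dᶜ)) :=
    ContinuousOn.aestronglyMeasurable (fun t ht => (hf t ht.1 ht.2).continuousWithinAt) hm
  have h2 : (Ioo a b ∩ Dᶜ : Set ℝ) =ᵐ[volume] Ioo a b := by
    filter_upwards [compl_mem_ae_iff.2 (hD.measure_zero volume)] with t ht
    exact propext ⟨fun h => h.1, fun h => ⟨h, ht⟩⟩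
  rwa [Measure.restrict_congr_set h2] at h1

/-- Bounded continuous functions of `(t,x,v)`, compactly supported in `t`, and Lipschitz and
differentiable in `(t,x)`. -/
structure IsFlowTest (T : ℝ) {d : ℕ} (Φ : Phase d → ℝ) : Prop where
  continuous : Continuous Φ
  differentiable : ∀ v : E d, Differentiable ℝ (fun p : ℝ × E d => Φ (p.1, p.2, v))
  bound : ∃ C, ∀ z, ‖Φ z‖ ≤ C
  bound_fderiv : ∃ L, ∀ v p, ‖fderiv ℝ (fun p : ℝ × E d => Φ (p.1, p.2, v)) p‖ ≤ L
  support : ∃ a b, -1 < a ∧ b < T ∧ ∀ t ∉ Icc a b, ∀ x v, Φ (t, x, v) = 0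

namespace IsFlowTest

variable {T : ℝ} {d : ℕ} {Φ : Phase d → ℝ}

lemma lipschitz (hΦ : IsFlowTest T Φ) : ∃ L, 0 ≤ L ∧ ∀ t t' x x' v,
    ‖Φ (t', x', v) - Φ (t, x, v)‖ ≤ L * (|t' - t| + ‖x' - x‖) := by
  obtain ⟨L, hL⟩ := hΦ.bound_fderiv
  have hL0 : 0 ≤ L := (norm_nonneg _).trans (hL 0 0)
  refine ⟨L, hL0, fun t t' x x' v => ?_⟩
  refine (convex_univ.norm_image_sub_le_of_norm_fderiv_le (𝕜 := ℝ)
    (f := fun p : ℝ × E d => Φ (p.1, p.2, v)) (x := (t, x)) (y := (t', x'))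
    (fun p _ => hΦ.differentiable v p) (fun p _ => hL v p) (mem_univ _) (mem_univ _)).trans ?_
  refine mul_le_mul_of_nonneg_left ?_ hL0
  rw [Prod.mk_sub_mk, Prod.norm_mk]
  exact max_le_add_of_nonneg (norm_nonneg _) (norm_nonneg _)

lemma norm_transport_le (hΦ : IsFlowTest T Φ) : ∃ L, ∀ z, ‖transport Φ z‖ ≤ L * (1 + ‖z.2.2‖) := by
  obtain ⟨L, hL⟩ := hΦ.bound_fderiv
  have hL0 : 0 ≤ L := (norm_nonneg _).trans (hL 0 0)
  refine ⟨L, fun z => (ContinuousLinearMap.le_of_opNorm_le _ (hL _ _) _).trans ?_⟩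
  refine mul_le_mul_of_nonneg_left ?_ hL0
  rw [Prod.norm_mk, norm_one]
  exact max_le_add_of_nonneg zero_le_one (norm_nonneg _)

lemma tendsto_slope (hΦ : IsFlowTest T Φ) (t : ℝ) (x v : E d) :
    Tendsto (fun h : ℝ => h⁻¹ * (Φ (t + h, x + h • v, v) - Φ (t, x, v))) (𝓝[>] 0)
      (𝓝 (transport Φ (t, x, v))) := by
  have h1 : HasDerivAt (fun h : ℝ => ((t + h, x + h • v) : ℝ × E d)) (1, v) 0 := by
    refine ((hasDerivAt_id _).const_add t).prodMk ?_
    simpa using ((hasDerivAt_id (0 : ℝ)).smul_const v).const_add x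
  have h2 := (hΦ.differentiable v (t + 0, x + (0 : ℝ) • v)).hasFDerivAt
  have h3 := h2.comp_hasDerivAt (0 : ℝ) h1
  have h4 := h3.tendsto_slope_zero_right
  simpa [Function.comp_def, transport] using h4

end IsFlowTest

/-! ### Expectations along the flow: regularity in time and difference quotients -/

namespace MartingaleFlow

variable {Ω : Type*} {mΩ : MeasurableSpace Ω} {d : ℕ} {T : ℝ} {η : Measure Ω}
  {ℱ : ℝ → MeasurableSpace Ω} {W : Ω → E d} {X : ℝ → Ω → E d}
  {H : Type*} [NormedAddCommGroup H] [NormedSpace ℝ H]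

lemma aesm_tuple (h : MartingaleFlow T η ℱ W X) (s t δ : ℝ) : AEStronglyMeasurable
    (fun ω => ((s, X t ω, η[W | ℱ t] ω, η[W | ℱ δ] ω) : ℝ × E d × E d × E d)) η :=
  aestronglyMeasurable_const.prodMk ((h.aesm_pos _).prodMk
    ((h.memLp_vel _).1.prodMk (h.memLp_vel _).1))

variable [IsProbabilityMeasure η]

lemma continuousAt_expectation (h : MartingaleFlow T η ℱ W X) {g : ℝ × E d × E d × E d → ℝ}
    (hg : Continuous g) {C : ℝ} (hC : ∀ z, ‖g z‖ ≤ C) {Y : ℝ → Ω → H} (hY : ∀ t, MemLp (Y t) 2 η)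
    {t δ : ℝ} (ht : t + δ ∈ Ioo (-1) T) (hj : t ∉ jumps η ℱ W) (hj' : t + δ ∉ jumps η ℱ W)
    (hYt : Tendsto (fun s => lpNorm (Y s - Y t) 2 η) (𝓝 t) (𝓝 0)) :
    ContinuousAt (fun t => ∫ ω, g (t + δ, X (t + δ) ω, η[W | ℱ (t + δ)] ω, η[W | ℱ t] ω) • Y t ω ∂η)
      t := by
  have hδ : Tendsto (fun s => s + δ) (𝓝 t) (𝓝 (t + δ)) := (continuous_add_const δ).tendsto t
  refine tendsto_integral_smul (F := ℝ × E d × E d × E d) hg hC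
    (Z := fun s ω => (s + δ, X (s + δ) ω, η[W | ℱ (s + δ)] ω, η[W | ℱ s] ω))
    (fun s => h.aesm_tuple _ _ _) hY (hY t) ?_ hYt
  exact tendstoInMeasure_prodMk (tendstoInMeasure_const hδ)
    (tendstoInMeasure_prodMk ((h.tendstoInMeasure_pos ht).comp hδ)
      (tendstoInMeasure_prodMk ((h.tendstoInMeasure_vel hj').comp hδ) (h.tendstoInMeasure_vel hj)))

lemma norm_expectation_le {g : Ω → ℝ} {C : ℝ} (hC : ∀ ω, ‖g ω‖ ≤ C)
    {Y : Ω → H} (hY : MemLp Y 2 η) : ‖∫ ω, g ω • Y ω ∂η‖ ≤ C * lpNorm Y 2 η := by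
  have hC0 : 0 ≤ C := by
    obtain ⟨ω⟩ := η.nonempty_of_neZero
    exact (norm_nonneg _).trans (hC ω)
  refine (norm_integral_le_integral_norm _).trans
    (le_trans ?_ (mul_le_mul_of_nonneg_left (integral_norm_le_lpNorm_two hY) hC0))
  rw [← integral_const_mul]
  refine integral_mono_of_nonneg (Eventually.of_forall fun _ => norm_nonneg _)
    ((hY.integrable (by norm_num)).norm.const_mul C) (Eventually.of_forall fun ω => ?_)
  simp only [norm_smul]
  exact mul_le_mul_of_nonneg_right (hC _) (norm_nonneg _)

lemma integrableOn_expectation (h : MartingaleFlow T η ℱ W X) {g : ℝ × E d × E d × E d → ℝ}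
    (hg : Continuous g) {C : ℝ} (hC : ∀ z, ‖g z‖ ≤ C) {Y : ℝ → Ω → H} (hY : ∀ t, MemLp (Y t) 2 η)
    {M : ℝ} (hM : ∀ t, lpNorm (Y t) 2 η ≤ M) {D : Set ℝ} (hD : D.Countable)
    (hYt : ∀ t ∉ D, Tendsto (fun s => lpNorm (Y s - Y t) 2 η) (𝓝 t) (𝓝 0)) (δ : ℝ) :
    IntegrableOn (fun t =>
      ∫ ω, g (t + δ, X (t + δ) ω, η[W | ℱ (t + δ)] ω, η[W | ℱ t] ω) • Y t ω ∂η)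
      (Ioo (-1 - δ) (T - δ)) := by
  have hD' : (D ∪ (jumps η ℱ W ∪ (fun t => t + δ) ⁻¹' jumps η ℱ W)).Countable :=
    hD.union (h.countable_jumps.union (h.countable_jumps.preimage (add_left_injective δ)))
  refine Integrable.of_bound
    (aestronglyMeasurable_of_continuousAt hD' fun t ht hn => ?_) (C * M) (Eventually.of_forall fun t => ?_)
  · simp only [mem_union, not_or, mem_preimage] at hn
    exact h.continuousAt_expectation hg hC hY ⟨by linarith [ht.1], by linarith [ht.2]⟩ hn.2.1 hn.2.2
      (hYt t hn.1)
  · exact (norm_expectation_le (fun ω => hC _) (hY t)).trans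
      (mul_le_mul_of_nonneg_left (hM t) ((norm_nonneg _).trans (hC 0)))

lemma integrable_expectation (h : MartingaleFlow T η ℱ W X) {g : ℝ × E d × E d × E d → ℝ}
    (hg : Continuous g) {C : ℝ} (hC : ∀ z, ‖g z‖ ≤ C)
    (hs : ∃ a b, -1 < a ∧ b < T ∧ ∀ t ∉ Icc a b, ∀ y, g (t, y) = 0)
    {Y : ℝ → Ω → H} (hY : ∀ t, MemLp (Y t) 2 η)
    {M : ℝ} (hM : ∀ t, lpNorm (Y t) 2 η ≤ M) {D : Set ℝ} (hD : D.Countable)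
    (hYt : ∀ t ∉ D, Tendsto (fun s => lpNorm (Y s - Y t) 2 η) (𝓝 t) (𝓝 0)) (δ : ℝ) :
    Integrable (fun t =>
      ∫ ω, g (t + δ, X (t + δ) ω, η[W | ℱ (t + δ)] ω, η[W | ℱ t] ω) • Y t ω ∂η) := by
  obtain ⟨a, b, ha, hb, hab⟩ := hs
  refine (integrableOn_iff_integrable_of_support_subset ?_).1
    (h.integrableOn_expectation hg hC hY hM hD hYt δ)
  intro t ht
  by_contra hn
  refine ht ?_
  have : t + δ ∉ Icc a b := fun hc => hn ⟨by linarith [hc.1], by linarith [hc.2]⟩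
  simp [hab _ this]

lemma integrable_test_smul {Φ : Phase d → ℝ} (hΦ : IsFlowTest T Φ) {Z : Ω → Phase d}
    (hZ : AEStronglyMeasurable Z η) {Y : Ω → H} (hY : MemLp Y 2 η) :
    Integrable (fun ω => Φ (Z ω) • Y ω) η := by
  obtain ⟨C, hC⟩ := hΦ.bound
  exact (hY.integrable (by norm_num)).bdd_smul C (hΦ.continuous.comp_aestronglyMeasurable hZ)
    (Eventually.of_forall fun ω => hC _)

/-- The derivative of `h ↦ E[Φ(t+h, X (t+h), V t) Y]` at `h = 0`. -/
lemma tendsto_expectation_slope (h : MartingaleFlow T η ℱ W X) {Φ : Phase d → ℝ}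
    (hΦ : IsFlowTest T Φ) {Y : Ω → H} (hY : MemLp Y 2 η) {t : ℝ} (ht : t ∈ Ioo (-1) T)
    (hj : t ∉ jumps η ℱ W) :
    Tendsto (fun δ : ℝ => δ⁻¹ • ∫ ω, (Φ (t + δ, X (t + δ) ω, η[W | ℱ t] ω) -
        Φ (t, X t ω, η[W | ℱ t] ω)) • Y ω ∂η) (𝓝[>] 0)
      (𝓝 (∫ ω, transport Φ (t, X t ω, η[W | ℱ t] ω) • Y ω ∂η)) := by
  obtain ⟨L, hL0, hL⟩ := hΦ.lipschitz
  set V := η[W | ℱ t] with hV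
  have hVm : MemLp V 2 η := h.memLp_vel t
  have hz : ∀ (s : ℝ) {x : Ω → E d}, AEStronglyMeasurable x η →
      AEStronglyMeasurable (fun ω => ((s, x ω, V ω) : Phase d)) η := fun s x hx =>
    aestronglyMeasurable_const.prodMk (hx.prodMk hVm.1)
  have hxl : ∀ δ : ℝ, AEStronglyMeasurable (fun ω => X t ω + δ • V ω) η := fun δ =>
    (h.aesm_pos t).add (hVm.1.const_smul δ)
  -- With the path replaced by the straight line of velocity `V`, the quotients converge pointwise,
  -- and the Lipschitz bound dominates them.
  have hA : Tendsto (fun δ : ℝ => ∫ ω, (δ⁻¹ * (Φ (t + δ, X t ω + δ • V ω, V ω) -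
      Φ (t, X t ω, V ω))) • Y ω ∂η) (𝓝[>] 0) (𝓝 (∫ ω, transport Φ (t, X t ω, V ω) • Y ω ∂η)) := by
    refine tendsto_integral_filter_of_dominated_convergence
      (fun ω => L * (‖Y ω‖ + ‖V ω‖ * ‖Y ω‖)) (Eventually.of_forall fun δ => ?_) ?_ ?_ ?_
    · exact (((hΦ.continuous.comp_aestronglyMeasurable (hz _ (hxl δ))).sub
        (hΦ.continuous.comp_aestronglyMeasurable (hz _ (h.aesm_pos t)))).const_mul δ⁻¹).smul hY.1
    · filter_upwards [self_mem_nhdsWithin] with δ hδ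
      refine Eventually.of_forall fun ω => ?_
      have hδ' : (0 : ℝ) < δ := hδ
      have h1 := hL t (t + δ) (X t ω) (X t ω + δ • V ω) (V ω)
      rw [add_sub_cancel_left, add_sub_cancel_left, norm_smul δ, Real.norm_of_nonneg hδ'.le,
        abs_of_pos hδ'] at h1
      rw [norm_smul, norm_mul, norm_inv, Real.norm_eq_abs, abs_of_pos hδ']
      calc δ⁻¹ * ‖Φ (t + δ, X t ω + δ • V ω, V ω) - Φ (t, X t ω, V ω)‖ * ‖Y ω‖
          ≤ δ⁻¹ * (L * (δ + δ * ‖V ω‖)) * ‖Y ω‖ := by gcongr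
        _ = L * (‖Y ω‖ + ‖V ω‖ * ‖Y ω‖) := by field_simp
    · exact ((hY.integrable (by norm_num)).norm.add (integrable_norm_mul_norm hVm hY)).const_mul L
    · exact Eventually.of_forall fun ω => (hΦ.tendsto_slope t (X t ω) (V ω)).smul_const _
  -- By `increment`, the deviation from the line divided by `δ` is at most the L² distance of the
  -- velocities at `t` and `t + δ`. Here `t` must not be a jump.
  have hB : Tendsto (fun δ : ℝ => δ⁻¹ • ∫ ω, (Φ (t + δ, X (t + δ) ω, V ω) -
      Φ (t + δ, X t ω + δ • V ω, V ω)) • Y ω ∂η) (𝓝[>] 0) (𝓝 0) := by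
    have hδ : Tendsto (fun δ : ℝ => t + δ) (𝓝[>] 0) (𝓝 t) := by
      have : Continuous fun δ : ℝ => t + δ := by fun_prop
      simpa using (this.tendsto 0).mono_left nhdsWithin_le_nhds
    have hlim : Tendsto (fun δ : ℝ => L * (lpNorm (η[W | ℱ (t + δ)] - V) 2 η * lpNorm Y 2 η))
        (𝓝[>] 0) (𝓝 0) := by
      simpa using (((h.tendsto_vel hj).comp hδ).mul_const (lpNorm Y 2 η)).const_mul L
    refine squeeze_zero_norm' ?_ hlim
    filter_upwards [self_mem_nhdsWithin, hδ (isOpen_Ioo.mem_nhds ht)] with δ hδp hδT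
    have hδ' : (0 : ℝ) < δ := hδp
    have hmem : MemLp (X (t + δ) - X t - δ • V) 2 η :=
      (h.memLp_sub t ht _ hδT).sub (hVm.const_smul δ)
    have hinc := h.increment t ht (t + δ) hδT (by linarith)
    rw [add_sub_cancel_left, lpNorm_sub_comm (η[W | ℱ t])] at hinc
    rw [norm_smul, norm_inv, Real.norm_eq_abs, abs_of_pos hδ']
    have h1 : ‖∫ ω, (Φ (t + δ, X (t + δ) ω, V ω) -
        Φ (t + δ, X t ω + δ • V ω, V ω)) • Y ω ∂η‖ ≤
        L * (lpNorm (X (t + δ) - X t - δ • V) 2 η * lpNorm Y 2 η) := by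
      refine (norm_integral_le_integral_norm _).trans
        (le_trans ?_ (mul_le_mul_of_nonneg_left (integral_norm_mul_norm_le hmem hY) hL0))
      rw [← integral_const_mul]
      refine integral_mono_of_nonneg (Eventually.of_forall fun _ => norm_nonneg _)
        ((integrable_norm_mul_norm hmem hY).const_mul L) (Eventually.of_forall fun ω => ?_)
      have h2 := hL (t + δ) (t + δ) (X t ω + δ • V ω) (X (t + δ) ω) (V ω)
      rw [sub_self, abs_zero, zero_add, ← sub_sub] at h2
      simp only [norm_smul, ← mul_assoc]
      exact mul_le_mul_of_nonneg_right h2 (norm_nonneg _)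
    calc δ⁻¹ * _ ≤ δ⁻¹ * (L * ((δ * lpNorm (η[W | ℱ (t + δ)] - V) 2 η) * lpNorm Y 2 η)) := by
          gcongr
          refine h1.trans ?_
          gcongr
          exact lpNorm_nonneg
      _ = _ := by field_simp
  have hAB := hA.add hB
  rw [add_zero] at hAB
  refine hAB.congr' ?_
  filter_upwards with δ
  have i1 := integrable_test_smul hΦ (hz (t + δ) (h.aesm_pos (t + δ))) hY
  have i2 := integrable_test_smul hΦ (hz (t + δ) (hxl δ)) hY
  have i3 := integrable_test_smul hΦ (hz t (h.aesm_pos t)) hY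
  simp_rw [mul_smul, sub_smul]
  rw [integral_smul, integral_sub i1 i2, integral_sub i1 i3, integral_sub i2 i3, ← smul_add]
  congr 1
  abel

end MartingaleFlow

/-! ### The weak transport equation, with conservation of mass and momentum -/

namespace MartingaleFlow

variable {Ω : Type*} {mΩ : MeasurableSpace Ω} {d : ℕ} {T : ℝ} {η : Measure Ω}
  {ℱ : ℝ → MeasurableSpace Ω} {W : Ω → E d} {X : ℝ → Ω → E d} [IsProbabilityMeasure η]
  {H : Type*} [NormedAddCommGroup H] [NormedSpace ℝ H]

/-- This bound holds at jumps too, and dominates the quotients when the limit is taken under the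
time integral. The 4 is 1 for the shift of time plus 3 from `lpNorm_pos_sub_le`. -/
lemma norm_expectation_slope_le (h : MartingaleFlow T η ℱ W X) {Φ : Phase d → ℝ} {L : ℝ}
    (hL0 : 0 ≤ L) (hL : ∀ t t' x x' v,
      ‖Φ (t', x', v) - Φ (t, x, v)‖ ≤ L * (|t' - t| + ‖x' - x‖))
    {Y : Ω → H} (hY : MemLp Y 2 η) {t δ : ℝ} (hδ : 0 < δ) (ht : t ∈ Ioo (-1) T)
    (htδ : t + δ ∈ Ioo (-1) T) :
    ‖δ⁻¹ • ∫ ω, (Φ (t + δ, X (t + δ) ω, η[W | ℱ t] ω) -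
        Φ (t, X t ω, η[W | ℱ t] ω)) • Y ω ∂η‖ ≤ 4 * L * lpNorm Y 2 η := by
  have hm := h.memLp_sub t ht _ htδ
  have hYi := (hY.integrable (by norm_num)).norm
  have h1 : ‖∫ ω, (Φ (t + δ, X (t + δ) ω, η[W | ℱ t] ω) -
        Φ (t, X t ω, η[W | ℱ t] ω)) • Y ω ∂η‖ ≤
      L * (δ * lpNorm Y 2 η + 3 * δ * lpNorm Y 2 η) := by
    have h2 : L * (δ * ∫ ω, ‖Y ω‖ ∂η + ∫ ω, ‖(X (t + δ) - X t) ω‖ * ‖Y ω‖ ∂η) ≤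
        L * (δ * lpNorm Y 2 η + 3 * δ * lpNorm Y 2 η) := by
      have h3 := h.lpNorm_pos_sub_le ht htδ
      rw [add_sub_cancel_left, abs_of_pos hδ] at h3
      have h4 : ∫ ω, ‖(X (t + δ) - X t) ω‖ * ‖Y ω‖ ∂η ≤ 3 * δ * lpNorm Y 2 η :=
        (integral_norm_mul_norm_le hm hY).trans (mul_le_mul_of_nonneg_right h3 lpNorm_nonneg)
      have h5 := integral_norm_le_lpNorm_two hY
      gcongr
    refine (norm_integral_le_integral_norm _).trans (le_trans ?_ h2)
    rw [← integral_const_mul, ← integral_add (hYi.const_mul δ) (integrable_norm_mul_norm hm hY),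
      ← integral_const_mul]
    refine integral_mono_of_nonneg (Eventually.of_forall fun _ => norm_nonneg _)
      (((hYi.const_mul δ).add (integrable_norm_mul_norm hm hY)).const_mul L)
      (Eventually.of_forall fun ω => ?_)
    have h6 := hL t (t + δ) (X t ω) (X (t + δ) ω) (η[W | ℱ t] ω)
    rw [add_sub_cancel_left, abs_of_pos hδ] at h6
    simp only [norm_smul, Pi.sub_apply, ← add_mul, ← mul_assoc]
    exact mul_le_mul_of_nonneg_right h6 (norm_nonneg _)
  rw [norm_smul, norm_inv, Real.norm_of_nonneg hδ.le]
  calc δ⁻¹ * _ ≤ δ⁻¹ * (L * (δ * lpNorm Y 2 η + 3 * δ * lpNorm Y 2 η)) := by gcongr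
    _ = _ := by field_simp; ring

/-- The weak formulation of the transport along the flow. The right side measures how the
jumps of the velocity act on the test function. -/
theorem tendsto_transport (h : MartingaleFlow T η ℱ W X) {Φ : Phase d → ℝ}
    (hΦ : IsFlowTest T Φ) {Y : ℝ → Ω → H} (hY : ∀ t, MemLp (Y t) 2 η)
    {M : ℝ} (hM : ∀ t, lpNorm (Y t) 2 η ≤ M)
    (hYt : ∀ t ∉ jumps η ℱ W, Tendsto (fun s => lpNorm (Y s - Y t) 2 η) (𝓝 t) (𝓝 0)) :
    Tendsto (fun δ : ℝ => δ⁻¹ • ∫ t, ∫ ω, (Φ (t + δ, X (t + δ) ω, η[W | ℱ t] ω) • Y t ω -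
        Φ (t + δ, X (t + δ) ω, η[W | ℱ (t + δ)] ω) • Y (t + δ) ω) ∂η) (𝓝[>] 0)
      (𝓝 (∫ t in Ioo (-1) T, ∫ ω, transport Φ (t, X t ω, η[W | ℱ t] ω) • Y t ω ∂η)) := by
  obtain ⟨L, hL0, hL⟩ := hΦ.lipschitz
  obtain ⟨C, hC⟩ := hΦ.bound
  obtain ⟨a, b, ha, hb, hab⟩ := hΦ.support
  let A : ℝ → ℝ → H := fun δ t => ∫ ω, Φ (t + δ, X (t + δ) ω, η[W | ℱ t] ω) • Y t ω ∂η
  have hA : ∀ δ, Integrable (A δ) := fun δ =>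
    h.integrable_expectation (g := fun z => Φ (z.1, z.2.1, z.2.2.2))
      (hΦ.continuous.comp (by fun_prop)) (fun z => hC _) ⟨a, b, ha, hb, fun t ht y => hab t ht _ _⟩
      hY hM h.countable_jumps hYt δ
  have hA0 : A 0 = fun t => ∫ ω, Φ (t, X t ω, η[W | ℱ t] ω) • Y t ω ∂η := by
    simp only [A, add_zero]
  have hint : ∀ s t u, Integrable (fun ω => Φ (s, X t ω, η[W | ℱ u] ω) • Y u ω) η := fun s t u =>
    integrable_test_smul hΦ (aestronglyMeasurable_const.prodMk
      ((h.aesm_pos t).prodMk (h.memLp_vel u).1)) (hY u)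
  have key : Tendsto (fun δ : ℝ => ∫ t, δ⁻¹ • ∫ ω, (Φ (t + δ, X (t + δ) ω, η[W | ℱ t] ω) -
        Φ (t, X t ω, η[W | ℱ t] ω)) • Y t ω ∂η) (𝓝[>] 0)
      (𝓝 (∫ t, (Ioo (-1) T).indicator
        (fun t => ∫ ω, transport Φ (t, X t ω, η[W | ℱ t] ω) • Y t ω ∂η) t)) := by
    -- For such `δ`, if `t` or `t + δ` lies in `[a, b]` then both lie in `(-1, T)`, where the flow
    -- is controlled.
    have hsmall : ∀ᶠ δ : ℝ in 𝓝[>] 0, 0 < δ ∧ δ < a + 1 ∧ δ < T - b := by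
      have h1 : ∀ᶠ δ : ℝ in 𝓝[>] 0, δ < a + 1 := nhdsWithin_le_nhds (Iio_mem_nhds (by linarith))
      have h2 : ∀ᶠ δ : ℝ in 𝓝[>] 0, δ < T - b := nhdsWithin_le_nhds (Iio_mem_nhds (by linarith))
      filter_upwards [self_mem_nhdsWithin, h1, h2] with δ h0 h1 h2
      exact ⟨h0, h1, h2⟩
    have hzero : ∀ {t δ : ℝ}, 0 < δ → δ < a + 1 → δ < T - b →
        ¬ (t ∈ Ioo (-1) T ∧ t + δ ∈ Ioo (-1) T) → ∀ x y v, Φ (t + δ, x, v) = 0 ∧ Φ (t, y, v) = 0 := by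
      intro t δ h0 h1 h2 hn x y v
      refine ⟨hab _ (fun hc => hn ?_) _ _, hab _ (fun hc => hn ?_) _ _⟩
      · exact ⟨⟨by linarith [hc.1], by linarith [hc.2]⟩, ⟨by linarith [hc.1], by linarith [hc.2]⟩⟩
      · exact ⟨⟨by linarith [hc.1], by linarith [hc.2]⟩, ⟨by linarith [hc.1], by linarith [hc.2]⟩⟩
    refine tendsto_integral_filter_of_dominated_convergence
      ((Ioo (-1) T).indicator fun _ => 4 * L * M) ?_ ?_ ?_ ?_
    · refine Eventually.of_forall fun δ => ?_
      have : AEStronglyMeasurable (fun t => δ⁻¹ • (A δ t - A 0 t)) :=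
        ((hA δ).1.sub (hA 0).1).const_smul δ⁻¹
      refine this.congr (Eventually.of_forall fun t => ?_)
      simp only [A, add_zero]
      rw [← integral_sub (hint _ _ _) (hint _ _ _)]
      simp only [sub_smul]
    · filter_upwards [hsmall] with δ ⟨h0, h1, h2⟩
      refine Eventually.of_forall fun t => ?_
      have hM0 : 0 ≤ M := lpNorm_nonneg.trans (hM 0)
      by_cases hn : t ∈ Ioo (-1) T ∧ t + δ ∈ Ioo (-1) T
      · rw [indicator_of_mem hn.1]
        exact (h.norm_expectation_slope_le hL0 hL (hY t) h0 hn.1 hn.2).trans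
          (mul_le_mul_of_nonneg_left (hM t) (by positivity))
      · simp only [fun ω => (hzero h0 h1 h2 hn (X (t + δ) ω) (X t ω) (η[W | ℱ t] ω)).1,
          fun ω => (hzero h0 h1 h2 hn (X (t + δ) ω) (X t ω) (η[W | ℱ t] ω)).2, sub_zero, zero_smul,
          integral_zero, smul_zero, norm_zero]
        exact indicator_nonneg (fun _ _ => by positivity) _
    · exact (integrable_indicator_iff measurableSet_Ioo).2 (integrable_const _)
    · filter_upwards [compl_mem_ae_iff.2 (h.countable_jumps.measure_zero volume)] with t ht
      by_cases htI : t ∈ Ioo (-1) T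
      · rw [indicator_of_mem htI]
        exact h.tendsto_expectation_slope hΦ (hY t) htI ht
      · rw [indicator_of_notMem htI]
        refine tendsto_const_nhds.congr' ?_
        filter_upwards [hsmall] with δ ⟨h0, h1, h2⟩
        simp only [fun ω => (hzero h0 h1 h2 (fun hn => htI hn.1) (X (t + δ) ω) (X t ω)
          (η[W | ℱ t] ω)).1, fun ω => (hzero h0 h1 h2 (fun hn => htI hn.1) (X (t + δ) ω) (X t ω)
          (η[W | ℱ t] ω)).2, sub_zero, zero_smul, integral_zero, smul_zero]
  rw [integral_indicator measurableSet_Ioo] at key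
  refine key.congr fun δ => ?_
  rw [integral_smul]
  congr 1
  have e1 : ∀ t, ∫ ω, (Φ (t + δ, X (t + δ) ω, η[W | ℱ t] ω) -
      Φ (t, X t ω, η[W | ℱ t] ω)) • Y t ω ∂η = A δ t - A 0 t := fun t => by
    simp only [A, add_zero]
    rw [← integral_sub (hint _ _ _) (hint _ _ _)]
    simp only [sub_smul]
  have e2 : ∀ t, ∫ ω, (Φ (t + δ, X (t + δ) ω, η[W | ℱ t] ω) • Y t ω -
        Φ (t + δ, X (t + δ) ω, η[W | ℱ (t + δ)] ω) • Y (t + δ) ω) ∂η = A δ t - A 0 (t + δ) :=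
    fun t => by
    simp only [A, add_zero]
    rw [← integral_sub (hint _ _ _) (hint _ _ _)]
  simp_rw [e1, e2]
  -- Since `A 0` and its translate by `δ` have the same integral over the line, the increment in
  -- `(t, x)` at fixed velocity is exchanged for the increment in `v` at fixed `(t, x)`.
  rw [integral_sub (hA δ) (hA 0), integral_sub (hA δ) ((hA 0).comp_add_right δ),
    integral_add_right_eq_self (A 0)]

/-- The weak formulation of the transport, for real-valued test functions. -/
theorem tendsto_kinetic (h : MartingaleFlow T η ℱ W X) {Φ : Phase d → ℝ} (hΦ : IsFlowTest T Φ) :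
    Tendsto (fun δ : ℝ => δ⁻¹ * ∫ t, ∫ ω, (Φ (t + δ, X (t + δ) ω, η[W | ℱ t] ω) -
        Φ (t + δ, X (t + δ) ω, η[W | ℱ (t + δ)] ω)) ∂η) (𝓝[>] 0)
      (𝓝 (∫ t in Ioo (-1) T, ∫ ω, transport Φ (t, X t ω, η[W | ℱ t] ω) ∂η)) := by
  have := h.tendsto_transport hΦ (Y := fun _ _ => (1 : ℝ)) (fun _ => memLp_const 1) (M := 1)
    (fun t => by simp [lpNorm_const' (E := ℝ) (μ := η) (p := 2) (by norm_num) (by norm_num) 1])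
    (fun t _ => by simp)
  simpa using this

/-- Conservation of mass along the flow. -/
theorem integral_transport_eq_zero (h : MartingaleFlow T η ℱ W X) {Φ : Phase d → ℝ}
    (hΦ : IsFlowTest T Φ) (hv : ∀ t x v v', Φ (t, x, v) = Φ (t, x, v')) :
    ∫ t in Ioo (-1) T, ∫ ω, transport Φ (t, X t ω, η[W | ℱ t] ω) ∂η = 0 := by
  refine tendsto_nhds_unique (h.tendsto_kinetic hΦ) ?_
  have : ∀ t δ ω, Φ (t + δ, X (t + δ) ω, η[W | ℱ t] ω) -
      Φ (t + δ, X (t + δ) ω, η[W | ℱ (t + δ)] ω) = 0 := fun t δ ω => sub_eq_zero.2 (hv _ _ _ _)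
  simp only [this, integral_zero, mul_zero]
  exact tendsto_const_nhds

/-- Conservation of momentum along the flow. -/
theorem integral_transport_smul_vel_eq_zero (h : MartingaleFlow T η ℱ W X) {Φ : Phase d → ℝ}
    (hΦ : IsFlowTest T Φ) (hv : ∀ t x v v', Φ (t, x, v) = Φ (t, x, v')) :
    ∫ t in Ioo (-1) T, ∫ ω, transport Φ (t, X t ω, η[W | ℱ t] ω) • η[W | ℱ t] ω ∂η = 0 := by
  refine tendsto_nhds_unique (h.tendsto_transport hΦ h.memLp_vel h.lpNorm_vel_le
    fun t ht => h.tendsto_vel ht) ?_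
  refine tendsto_const_nhds.congr' ?_
  filter_upwards [self_mem_nhdsWithin] with δ hδ
  have hδ' : (0 : ℝ) < δ := hδ
  have hint : ∀ s t u w, Integrable (fun ω => Φ (s, X t ω, η[W | ℱ u] ω) • η[W | ℱ w] ω) η :=
    fun s t u w => integrable_test_smul hΦ (aestronglyMeasurable_const.prodMk
      ((h.aesm_pos t).prodMk (h.memLp_vel u).1)) (h.memLp_vel w)
  have : ∀ t, ∫ ω, (Φ (t + δ, X (t + δ) ω, η[W | ℱ t] ω) • η[W | ℱ t] ω -
        Φ (t + δ, X (t + δ) ω, η[W | ℱ (t + δ)] ω) • η[W | ℱ (t + δ)] ω) ∂η = 0 := by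
    intro t
    have e : ∀ ω, Φ (t + δ, X (t + δ) ω, η[W | ℱ t] ω) =
        Φ (t + δ, X (t + δ) ω, η[W | ℱ (t + δ)] ω) := fun ω => hv _ _ _ _
    simp only [e]
    rw [integral_sub (hint _ _ _ _) (hint _ _ _ _), sub_eq_zero]
    -- The scalar factor is now `ℱ (t + δ)`-measurable, so the earlier velocity may be replaced by
    -- the later one under the expectation.
    exact h.integral_bilin_vel (s := t) (t := t + δ) (by linarith) (ContinuousLinearMap.lsmul ℝ ℝ)
      (Y := fun ω => Φ (t + δ, X (t + δ) ω, η[W | ℱ (t + δ)] ω))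
      (hΦ.continuous.comp_stronglyMeasurable (stronglyMeasurable_const.prodMk
        ((h.meas _).prodMk stronglyMeasurable_condExp))) (hint _ _ _ _)
  simp only [this, integral_zero, smul_zero]

end MartingaleFlow

/-! ### Test functions -/

lemma exists_Icc_of_isCompact {Y : Type*} [TopologicalSpace Y] {T : ℝ} {K : Set (ℝ × Y)}
    (hK : IsCompact K) (hKT : K ⊆ Ioo (-1) T ×ˢ univ) :
    ∃ a b, -1 < a ∧ b < T ∧ ∀ t y, (t, y) ∈ K → t ∈ Icc a b := by
  have hK' : IsCompact (Prod.fst '' K) := hK.image continuous_fst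
  rcases (Prod.fst '' K).eq_empty_or_nonempty with h | h
  · refine ⟨0, T - 1, by norm_num, by linarith, fun t y hty => ?_⟩
    exact absurd (mem_image_of_mem Prod.fst hty) (by simp [h])
  · have hsub : Prod.fst '' K ⊆ Ioo (-1) T := by
      rintro _ ⟨p, hp, rfl⟩
      exact (hKT hp).1
    refine ⟨sInf (Prod.fst '' K), sSup (Prod.fst '' K), (hsub (hK'.sInf_mem h)).1,
      (hsub (hK'.sSup_mem h)).2, fun t y hty => ?_⟩
    have ht : t ∈ Prod.fst '' K := mem_image_of_mem Prod.fst hty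
    exact ⟨csInf_le hK'.bddBelow ht, le_csSup hK'.bddAbove ht⟩

section TestFunction

variable {T : ℝ} {d : ℕ} {n : ℕ∞}

lemma testFunction_support (φ : 𝓓^{n}(phaseOpen T d, ℝ)) :
    ∃ a b, -1 < a ∧ b < T ∧ ∀ t ∉ Icc a b, ∀ y, φ (t, y) = 0 := by
  obtain ⟨a, b, ha, hb, hab⟩ := exists_Icc_of_isCompact (T := T)
    φ.hasCompactSupport (fun p hp => φ.tsupport_subset hp)
  refine ⟨a, b, ha, hb, fun t ht y => ?_⟩
  by_contra hc
  exact ht (hab t y (subset_tsupport _ hc))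

lemma testFunction_bound (φ : 𝓓^{n}(phaseOpen T d, ℝ)) : ∃ C, ∀ z, ‖φ z‖ ≤ C :=
  φ.hasCompactSupport.exists_bound_of_continuous φ.continuous

lemma hasFDerivAt_phase_fst {φ : Phase d → ℝ} (hφ : Differentiable ℝ φ) (v : E d) (p : ℝ × E d) :
    HasFDerivAt (fun p : ℝ × E d => φ (p.1, p.2, v))
      ((fderiv ℝ φ (p.1, p.2, v)).comp ((ContinuousLinearMap.fst ℝ ℝ (E d)).prod
        ((ContinuousLinearMap.snd ℝ ℝ (E d)).prod 0))) p :=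
  (hφ (p.1, p.2, v)).hasFDerivAt.comp p
    (hasFDerivAt_fst.prodMk (hasFDerivAt_snd.prodMk (hasFDerivAt_const v p)))

lemma hasFDerivAt_phase_snd {φ : Phase d → ℝ} (hφ : Differentiable ℝ φ) (z : Phase d) :
    HasFDerivAt (fun v : E d => φ (z.1, z.2.1, v))
      ((fderiv ℝ φ z).comp ((0 : E d →L[ℝ] ℝ).prod
        ((0 : E d →L[ℝ] E d).prod (ContinuousLinearMap.id ℝ (E d))))) z.2.2 :=
  (hφ z).hasFDerivAt.comp z.2.2 ((hasFDerivAt_const z.1 z.2.2).prodMk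
    ((hasFDerivAt_const z.2.1 z.2.2).prodMk (hasFDerivAt_id z.2.2)))

lemma norm_gradV (φ : Phase d → ℝ) (z : Phase d) :
    ‖gradV φ z‖ = ‖fderiv ℝ (fun v : E d => φ (z.1, z.2.1, v)) z.2.2‖ :=
  LinearIsometryEquiv.norm_map _ _

lemma norm_gradV_le {φ : Phase d → ℝ} (hφ : Differentiable ℝ φ) (z : Phase d) :
    ‖gradV φ z‖ ≤ ‖fderiv ℝ φ z‖ := by
  rw [norm_gradV, (hasFDerivAt_phase_snd hφ z).fderiv]
  refine ContinuousLinearMap.opNorm_le_bound _ (norm_nonneg _) fun w => ?_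
  refine ((fderiv ℝ φ z).le_opNorm _).trans_eq ?_
  simp

lemma fderiv_testFunction_bound (hn : 1 ≤ n) (φ : 𝓓^{n}(phaseOpen T d, ℝ)) :
    ∃ C, ∀ z, ‖fderiv ℝ φ z‖ ≤ C :=
  (φ.hasCompactSupport.fderiv ℝ).exists_bound_of_continuous
    (φ.contDiff.continuous_fderiv (by exact_mod_cast (by positivity : (0:ℕ∞) < 1).trans_le hn |>.ne'))

lemma differentiable_testFunction (hn : 1 ≤ n) (φ : 𝓓^{n}(phaseOpen T d, ℝ)) :
    Differentiable ℝ φ :=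
  φ.contDiff.differentiable (by exact_mod_cast (by positivity : (0:ℕ∞) < 1).trans_le hn |>.ne')

lemma isFlowTest_testFunction (hn : 1 ≤ n) (φ : 𝓓^{n}(phaseOpen T d, ℝ)) :
    IsFlowTest T (φ : Phase d → ℝ) := by
  have hd := differentiable_testFunction hn φ
  refine ⟨φ.continuous, fun v p => (hasFDerivAt_phase_fst hd v p).differentiableAt,
    testFunction_bound φ, ?_, ?_⟩
  · obtain ⟨C, hC⟩ := fderiv_testFunction_bound hn φ
    refine ⟨C, fun v p => ?_⟩
    rw [(hasFDerivAt_phase_fst hd v p).fderiv]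
    refine ContinuousLinearMap.opNorm_le_bound _ ((norm_nonneg _).trans (hC 0)) fun w => ?_
    refine (ContinuousLinearMap.le_of_opNorm_le _ (hC _) _).trans_eq ?_
    simp [Prod.norm_def]
  · obtain ⟨a, b, ha, hb, hab⟩ := testFunction_support φ
    exact ⟨a, b, ha, hb, fun t ht x v => hab t ht _⟩

/-- `‖∇_v φ‖_{C⁰}`. -/
def supGradV (φ : Phase d → ℝ) : ℝ := ⨆ z : Phase d, ‖gradV φ z‖

lemma supGradV_nonneg (φ : Phase d → ℝ) : 0 ≤ supGradV φ :=
  Real.iSup_nonneg fun _ => norm_nonneg _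

lemma norm_gradV_le_supGradV (hn : 1 ≤ n) (φ : 𝓓^{n}(phaseOpen T d, ℝ)) (z : Phase d) :
    ‖gradV φ z‖ ≤ supGradV (φ : Phase d → ℝ) := by
  obtain ⟨C, hC⟩ := fderiv_testFunction_bound hn φ
  refine le_ciSup (f := fun z => ‖gradV φ z‖) ⟨C, ?_⟩ z
  rintro _ ⟨z, rfl⟩
  exact (norm_gradV_le (differentiable_testFunction hn φ) z).trans (hC z)

lemma norm_sub_le_supGradV (hn : 1 ≤ n) (φ : 𝓓^{n}(phaseOpen T d, ℝ)) (t : ℝ) (x v v' : E d) :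
    ‖φ (t, x, v') - φ (t, x, v)‖ ≤ supGradV (φ : Phase d → ℝ) * ‖v' - v‖ :=
  convex_univ.norm_image_sub_le_of_norm_fderiv_le (𝕜 := ℝ) (f := fun v : E d => φ (t, x, v))
    (fun v _ => (hasFDerivAt_phase_snd (differentiable_testFunction hn φ)
      (t, x, v)).differentiableAt)
    (fun v _ => (norm_gradV φ (t, x, v)).symm.trans_le (norm_gradV_le_supGradV hn φ _))
    (mem_univ _) (mem_univ _)

end TestFunction

/-! ### Averages over velocity segments -/

/-- The average of `ψ(t,x,·)` over the segment `[b,b']`. -/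
def segmentAverage {d : ℕ} (ψ : Phase d → ℝ) (z : ℝ × E d × E d × E d) : ℝ :=
  ∫ θ in (0 : ℝ)..1, ψ (z.1, z.2.1, z.2.2.1 + θ • (z.2.2.2 - z.2.2.1))

section SegmentAverage

variable {d : ℕ} {ψ ψ' : Phase d → ℝ}

lemma continuous_segmentAverage (hψ : Continuous ψ) : Continuous (segmentAverage ψ) :=
  intervalIntegral.continuous_parametric_intervalIntegral_of_continuous'
    (f := fun (z : ℝ × E d × E d × E d) θ => ψ (z.1, z.2.1, z.2.2.1 + θ • (z.2.2.2 - z.2.2.1)))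
    (hψ.comp (by fun_prop)) 0 1

lemma intervalIntegrable_segment (hψ : Continuous ψ) (z : ℝ × E d × E d × E d) :
    IntervalIntegrable (fun θ : ℝ => ψ (z.1, z.2.1, z.2.2.1 + θ • (z.2.2.2 - z.2.2.1)))
      volume 0 1 :=
  (hψ.comp (by fun_prop)).intervalIntegrable _ _

lemma norm_segmentAverage_le {C : ℝ} (hC : ∀ z, ‖ψ z‖ ≤ C) (z : ℝ × E d × E d × E d) :
    ‖segmentAverage ψ z‖ ≤ C := by
  simpa [segmentAverage] using intervalIntegral.norm_integral_le_of_norm_le_const (a := 0) (b := 1)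
    (f := fun θ : ℝ => ψ (z.1, z.2.1, z.2.2.1 + θ • (z.2.2.2 - z.2.2.1))) fun θ _ => hC _

lemma segmentAverage_eq_zero {t : ℝ} (ht : ∀ y, ψ (t, y) = 0) (y : E d × E d × E d) :
    segmentAverage ψ (t, y) = 0 := by
  simp [segmentAverage, ht]

lemma segmentAverage_add (hψ : Continuous ψ) (hψ' : Continuous ψ') (z : ℝ × E d × E d × E d) :
    segmentAverage (ψ + ψ') z = segmentAverage ψ z + segmentAverage ψ' z :=
  intervalIntegral.integral_add (intervalIntegrable_segment hψ z) (intervalIntegrable_segment hψ' z)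

lemma segmentAverage_smul (c : ℝ) (z : ℝ × E d × E d × E d) :
    segmentAverage (c • ψ) z = c * segmentAverage ψ z :=
  intervalIntegral.integral_const_mul _ _

/-- In the defect, `b` is the later velocity. The factor `‖b' - b‖` gained here, times the increment
itself, is what the kinetic energy controls. -/
lemma norm_segmentAverage_sub_le {T : ℝ} {n : ℕ∞} (hn : 1 ≤ n) (φ : 𝓓^{n}(phaseOpen T d, ℝ))
    (t : ℝ) (x b b' : E d) :
    ‖segmentAverage φ (t, x, b, b') - φ (t, x, b)‖ ≤ supGradV (φ : Phase d → ℝ) * ‖b' - b‖ := by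
  have h1 : segmentAverage φ (t, x, b, b') - φ (t, x, b) =
      ∫ θ in (0 : ℝ)..1, (φ (t, x, b + θ • (b' - b)) - φ (t, x, b)) := by
    rw [intervalIntegral.integral_sub
      (intervalIntegrable_segment φ.continuous (t, x, b, b')) (by simp)]
    simp [segmentAverage]
  rw [h1]
  have h2 := intervalIntegral.norm_integral_le_of_norm_le_const (a := 0) (b := 1)
    (f := fun θ : ℝ => φ (t, x, b + θ • (b' - b)) - φ (t, x, b))
    (C := supGradV (φ : Phase d → ℝ) * ‖b' - b‖) fun θ hθ => ?_
  · simpa using h2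
  · refine (norm_sub_le_supGradV hn φ t x _ _).trans
      (mul_le_mul_of_nonneg_left ?_ (supGradV_nonneg _))
    rw [uIoc_of_le zero_le_one] at hθ
    rw [add_sub_cancel_left, norm_smul, Real.norm_of_nonneg hθ.1.le]
    exact mul_le_of_le_one_left (norm_nonneg _) hθ.2

/-- The fundamental theorem of calculus on a velocity segment. -/
lemma sum_segmentAverage_lineDeriv {T : ℝ} (φ : 𝓓^{2}(phaseOpen T d, ℝ)) (t : ℝ) (x b b' : E d) :
    ∑ i : Fin d, segmentAverage (TestFunction.lineDerivCLM ℝ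
        ((0, 0, EuclideanSpace.single i 1) : Phase d) φ : 𝓓^{1}(phaseOpen T d, ℝ)) (t, x, b, b') *
        (b' - b) i = φ (t, x, b') - φ (t, x, b) := by
  have hd := differentiable_testFunction (by norm_num) φ
  have hc : ∀ i : Fin d, Continuous (TestFunction.lineDerivCLM ℝ
      ((0, 0, EuclideanSpace.single i 1) : Phase d) φ : 𝓓^{1}(phaseOpen T d, ℝ)) :=
    fun i => TestFunction.continuous _
  have h1 : ∀ θ : ℝ, HasDerivAt (fun θ : ℝ => φ (t, x, b + θ • (b' - b)))
      (∑ i : Fin d, (TestFunction.lineDerivCLM ℝ ((0, 0, EuclideanSpace.single i 1) : Phase d) φ :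
        𝓓^{1}(phaseOpen T d, ℝ)) (t, x, b + θ • (b' - b)) * (b' - b) i) θ := by
    intro θ
    have h2 : HasDerivAt (fun θ : ℝ => ((t, x, b + θ • (b' - b)) : Phase d)) (0, 0, b' - b) θ := by
      refine (hasDerivAt_const _ _).prodMk ((hasDerivAt_const _ _).prodMk ?_)
      simpa using ((hasDerivAt_id θ).smul_const (b' - b)).const_add b
    have h3 := (hd (t, x, b + θ • (b' - b))).hasFDerivAt.comp_hasDerivAt θ h2
    refine HasDerivAt.congr_deriv h3 ?_
    -- The segment moves neither `t` nor `x`, so only the coordinate directions of `v` appear.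
    have h4 : ((0, 0, b' - b) : Phase d) =
        ∑ i : Fin d, (b' - b) i • ((0, 0, EuclideanSpace.single i 1) : Phase d) := by
      have h5 : b' - b = ∑ i : Fin d, (b' - b) i • (EuclideanSpace.single i 1 : E d) := by
        have := (EuclideanSpace.basisFun (Fin d) ℝ).sum_repr (b' - b)
        simpa using this.symm
      refine Prod.ext ?_ (Prod.ext ?_ ?_)
      · simp [Prod.fst_sum]
      · simp [Prod.fst_sum, Prod.snd_sum]
      · simpa [Prod.snd_sum] using h5
    rw [h4, map_sum]
    refine Finset.sum_congr rfl fun i _ => ?_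
    rw [map_smul, smul_eq_mul, mul_comm, TestFunction.lineDerivCLM_apply_of_le (by norm_num)]
    congr 1
    exact (hd _).lineDeriv_eq_fderiv.symm
  have hI : ∀ i : Fin d, IntervalIntegrable (fun θ : ℝ =>
      (TestFunction.lineDerivCLM ℝ ((0, 0, EuclideanSpace.single i 1) : Phase d) φ :
        𝓓^{1}(phaseOpen T d, ℝ)) (t, x, b + θ • (b' - b)) * (b' - b) i) volume 0 1 := fun i =>
    (((hc i).comp (by fun_prop)).mul continuous_const).intervalIntegrable _ _
  have h6 := intervalIntegral.integral_eq_sub_of_hasDerivAt (a := 0) (b := 1)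
    (fun θ _ => h1 θ) (IntervalIntegrable.congr (fun θ _ => by simp only [Finset.sum_apply])
      (IntervalIntegrable.sum Finset.univ fun i _ => hI i))
  rw [zero_smul, one_smul, add_zero, add_sub_cancel,
    intervalIntegral.integral_finsetSum fun i _ => hI i] at h6
  rw [← h6]
  refine Finset.sum_congr rfl fun i _ => ?_
  rw [intervalIntegral.integral_mul_const]
  rfl

end SegmentAverage

/-! ### The defect distribution -/

/-- The mean rate of decrease of a bounded nonincreasing function is bounded. -/
lemma integral_antitone_sub_le {f : ℝ → ℝ} (hf : Antitone f) {M : ℝ} (h0 : ∀ t, 0 ≤ f t)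
    (hM : ∀ t, f t ≤ M) {a b δ : ℝ} (hab : a ≤ b) (hδ : 0 < δ) :
    ∫ t in Ioo a b, (f t - f (t + δ)) ≤ δ * M := by
  have hi : ∀ u v, IntervalIntegrable f volume u v := fun u v => hf.intervalIntegrable
  have hs : IntervalIntegrable (fun t => f (t + δ)) volume a b :=
    (hf.comp_monotone fun _ _ h => add_le_add_left h δ : Antitone fun t => f (t + δ)).intervalIntegrable
  -- After a change of variables only the integral of `f` over `(a, a + δ)`, minus that over `(b, b
  -- + δ)`, is left. The second is nonnegative and is dropped.
  rw [← integral_Ioc_eq_integral_Ioo, ← intervalIntegral.integral_of_le hab,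
    intervalIntegral.integral_sub (hi _ _) hs,
    intervalIntegral.integral_comp_add_right f,
    intervalIntegral.integral_interval_sub_interval_comm (hi _ _) (hi _ _) (hi _ _)]
  have h1 : ∫ t in a..a + δ, f t ≤ δ * M := by
    have := intervalIntegral.integral_mono_on (a := a) (b := a + δ) (by linarith) (hi _ _)
      (intervalIntegrable_const (c := M)) fun t _ => hM t
    simpa using this
  have h2 : 0 ≤ ∫ t in b..b + δ, f t :=
    intervalIntegral.integral_nonneg (by linarith) fun t _ => h0 t
  linarith

namespace MartingaleFlow

variable {Ω : Type*} {mΩ : MeasurableSpace Ω} {d : ℕ} {T : ℝ} {η : Measure Ω}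
  {ℱ : ℝ → MeasurableSpace Ω} {W : Ω → E d} {X : ℝ → Ω → E d}

/-- The approximation, on the time scale `δ`, of the defect distribution. -/
def defect (η : Measure Ω) (ℱ : ℝ → MeasurableSpace Ω) (W : Ω → E d) (X : ℝ → Ω → E d)
    (δ : ℝ) (ψ : Phase d → ℝ) : E d :=
  δ⁻¹ • ∫ t, ∫ ω, segmentAverage ψ (t + δ, X (t + δ) ω, η[W | ℱ (t + δ)] ω, η[W | ℱ t] ω) •
    (η[W | ℱ t] ω - η[W | ℱ (t + δ)] ω) ∂η

variable {n : ℕ∞}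

lemma memLp_vel_sub (h : MartingaleFlow T η ℱ W X) (δ t : ℝ) :
    MemLp (η[W | ℱ t] - η[W | ℱ (t + δ)]) 2 η :=
  (h.memLp_vel _).sub (h.memLp_vel _)

lemma defect_smul (c : ℝ) (φ : 𝓓^{n}(phaseOpen T d, ℝ)) (δ : ℝ) :
    defect η ℱ W X δ (c • φ : 𝓓^{n}(phaseOpen T d, ℝ)) = c • defect η ℱ W X δ φ := by
  unfold defect
  rw [smul_comm c, ← integral_smul]
  simp_rw [← integral_smul, smul_smul, FunLike.coe_smul, segmentAverage_smul]

variable [IsProbabilityMeasure η]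

lemma integrable_segmentAverage_smul (h : MartingaleFlow T η ℱ W X) {ψ : Phase d → ℝ}
    (hψ : Continuous ψ) {C : ℝ} (hC : ∀ z, ‖ψ z‖ ≤ C) (δ t : ℝ) :
    Integrable (fun ω => segmentAverage ψ (t + δ, X (t + δ) ω, η[W | ℱ (t + δ)] ω, η[W | ℱ t] ω) •
      (η[W | ℱ t] ω - η[W | ℱ (t + δ)] ω)) η :=
  ((h.memLp_vel_sub δ t).integrable (by norm_num)).bdd_smul C
    ((continuous_segmentAverage hψ).comp_aestronglyMeasurable
      (aestronglyMeasurable_const.prodMk ((h.aesm_pos _).prodMk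
        ((h.memLp_vel _).1.prodMk (h.memLp_vel _).1))))
    (Eventually.of_forall fun _ => norm_segmentAverage_le hC _)

lemma integrable_defect (h : MartingaleFlow T η ℱ W X) (φ : 𝓓^{n}(phaseOpen T d, ℝ)) (δ : ℝ) :
    Integrable (fun t => ∫ ω, segmentAverage φ
      (t + δ, X (t + δ) ω, η[W | ℱ (t + δ)] ω, η[W | ℱ t] ω) •
      (η[W | ℱ t] ω - η[W | ℱ (t + δ)] ω) ∂η) := by
  obtain ⟨C, hC⟩ := testFunction_bound φ
  obtain ⟨a, b, ha, hb, hab⟩ := testFunction_support φ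
  have hD : (jumps η ℱ W ∪ (fun t => t + δ) ⁻¹' jumps η ℱ W).Countable :=
    h.countable_jumps.union (h.countable_jumps.preimage (add_left_injective δ))
  refine h.integrable_expectation (Y := fun t => η[W | ℱ t] - η[W | ℱ (t + δ)])
    (continuous_segmentAverage φ.continuous) (norm_segmentAverage_le hC)
    ⟨a, b, ha, hb, fun t ht y => segmentAverage_eq_zero (hab t ht) y⟩
    (h.memLp_vel_sub δ) (M := 1 + 1) (fun t => ?_) hD (fun t ht => ?_) δ
  · exact (lpNorm_sub_le (h.memLp_vel t) (by norm_num)).trans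
      (add_le_add (h.lpNorm_vel_le t) (h.lpNorm_vel_le _))
  · simp only [mem_union, mem_preimage, not_or] at ht
    have hδ : Tendsto (fun s => s + δ) (𝓝 t) (𝓝 (t + δ)) := (continuous_add_const δ).tendsto t
    have h2 := (h.tendsto_vel ht.1).add ((h.tendsto_vel ht.2).comp hδ)
    rw [add_zero] at h2
    refine squeeze_zero (fun _ => lpNorm_nonneg) (fun s => ?_) h2
    have e : η[W | ℱ s] - η[W | ℱ (s + δ)] - (η[W | ℱ t] - η[W | ℱ (t + δ)]) =
        (η[W | ℱ s] - η[W | ℱ t]) - (η[W | ℱ (s + δ)] - η[W | ℱ (t + δ)]) := by abel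
    rw [e]
    exact lpNorm_sub_le ((h.memLp_vel _).sub (h.memLp_vel _)) (by norm_num)

lemma defect_add (h : MartingaleFlow T η ℱ W X) (φ ψ : 𝓓^{n}(phaseOpen T d, ℝ)) (δ : ℝ) :
    defect η ℱ W X δ (φ + ψ : 𝓓^{n}(phaseOpen T d, ℝ)) =
      defect η ℱ W X δ φ + defect η ℱ W X δ ψ := by
  obtain ⟨C, hC⟩ := testFunction_bound φ
  obtain ⟨C', hC'⟩ := testFunction_bound ψ
  unfold defect
  rw [← smul_add, ← integral_add (h.integrable_defect φ δ) (h.integrable_defect ψ δ)]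
  congr 1
  refine integral_congr_ae (Eventually.of_forall fun t => ?_)
  simp only
  rw [← integral_add (h.integrable_segmentAverage_smul φ.continuous hC δ t)
    (h.integrable_segmentAverage_smul ψ.continuous hC' δ t)]
  refine integral_congr_ae (Eventually.of_forall fun ω => ?_)
  simp only
  rw [← add_smul, FunLike.coe_add, segmentAverage_add φ.continuous ψ.continuous]

/-- The defect is dissipated by the kinetic energy. -/
lemma norm_defect_integrand_le (h : MartingaleFlow T η ℱ W X) (hn : 1 ≤ n)
    (φ : 𝓓^{n}(phaseOpen T d, ℝ)) {δ : ℝ} (hδ : 0 < δ) (t : ℝ) :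
    ‖∫ ω, segmentAverage φ (t + δ, X (t + δ) ω, η[W | ℱ (t + δ)] ω, η[W | ℱ t] ω) •
      (η[W | ℱ t] ω - η[W | ℱ (t + δ)] ω) ∂η‖ ≤
      supGradV (φ : Phase d → ℝ) * (kineticEnergy η ℱ W t - kineticEnergy η ℱ W (t + δ)) := by
  obtain ⟨C, hC⟩ := testFunction_bound φ
  have ht : t ≤ t + δ := by linarith
  have hF := isFlowTest_testFunction hn φ
  have hi : ∀ s, Integrable
      (fun ω => φ (t + δ, X (t + δ) ω, η[W | ℱ (t + δ)] ω) • η[W | ℱ s] ω) η := fun s =>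
    integrable_test_smul hF (aestronglyMeasurable_const.prodMk
      ((h.aesm_pos _).prodMk (h.memLp_vel _).1)) (h.memLp_vel s)
  -- The value of `φ` at the later velocity is `ℱ (t + δ)`-measurable, hence orthogonal to the
  -- martingale increment. Subtracting it makes the integrand quadratic in this increment.
  have h1 : ∫ ω, φ (t + δ, X (t + δ) ω, η[W | ℱ (t + δ)] ω) •
      (η[W | ℱ t] ω - η[W | ℱ (t + δ)] ω) ∂η = 0 := by
    simp_rw [smul_sub]
    rw [integral_sub (hi _) (hi _), sub_eq_zero]
    exact h.integral_bilin_vel ht (ContinuousLinearMap.lsmul ℝ ℝ)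
      (Y := fun ω => φ (t + δ, X (t + δ) ω, η[W | ℱ (t + δ)] ω))
      (φ.continuous.comp_stronglyMeasurable (stronglyMeasurable_const.prodMk
        ((h.meas _).prodMk stronglyMeasurable_condExp))) (hi _)
  have hi2 : Integrable (fun ω => φ (t + δ, X (t + δ) ω, η[W | ℱ (t + δ)] ω) •
      (η[W | ℱ t] ω - η[W | ℱ (t + δ)] ω)) η := by
    simp_rw [smul_sub]
    exact (hi _).sub (hi _)
  rw [← sub_zero (∫ ω, segmentAverage φ _ • _ ∂η), ← h1,
    ← integral_sub (h.integrable_segmentAverage_smul φ.continuous hC δ t) hi2,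
    ← h.integral_norm_sub_sq ht, ← integral_const_mul]
  refine norm_integral_le_of_norm_le (((h.memLp_vel_sub δ t).integrable_norm_pow
    (by norm_num)).const_mul _) (Eventually.of_forall fun ω => ?_)
  rw [← sub_smul, norm_smul, sq, ← mul_assoc]
  exact mul_le_mul_of_nonneg_right (norm_segmentAverage_sub_le hn φ _ _ _ _) (norm_nonneg _)

lemma norm_defect_le (h : MartingaleFlow T η ℱ W X) (hT : 0 < T) (hn : 1 ≤ n)
    (φ : 𝓓^{n}(phaseOpen T d, ℝ)) :
    ∀ᶠ δ : ℝ in 𝓝[>] 0, ‖defect η ℱ W X δ φ‖ ≤ supGradV (φ : Phase d → ℝ) := by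
  obtain ⟨a, b, ha, hb, hab⟩ := testFunction_support φ
  have h1 : ∀ᶠ δ : ℝ in 𝓝[>] 0, δ < a + 1 := nhdsWithin_le_nhds (Iio_mem_nhds (by linarith))
  filter_upwards [self_mem_nhdsWithin, h1] with δ h0 h1
  have hδ : (0 : ℝ) < δ := h0
  -- Because `δ < a + 1`, the condition that `t + δ` be in the support of the test function confines
  -- `t` to `(-1, T)`.
  have hset : ∀ t ∉ Ioo (-1) T, ∫ ω, segmentAverage φ
      (t + δ, X (t + δ) ω, η[W | ℱ (t + δ)] ω, η[W | ℱ t] ω) •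
      (η[W | ℱ t] ω - η[W | ℱ (t + δ)] ω) ∂η = 0 := by
    intro t ht
    have : t + δ ∉ Icc a b := fun hc => ht ⟨by linarith [hc.1], by linarith [hc.2]⟩
    simp only [segmentAverage_eq_zero (hab _ this), zero_smul, integral_zero]
  unfold defect
  rw [← setIntegral_eq_integral_of_forall_compl_eq_zero hset, norm_smul, norm_inv,
    Real.norm_of_nonneg hδ.le]
  have hant := h.kineticEnergy_antitone
  have hint : IntegrableOn (fun t => kineticEnergy η ℱ W t - kineticEnergy η ℱ W (t + δ))
      (Ioo (-1) T) := by
    have hi1 : IntervalIntegrable (kineticEnergy η ℱ W) volume (-1) T := hant.intervalIntegrable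
    have hi2 : IntervalIntegrable (fun t => kineticEnergy η ℱ W (t + δ)) volume (-1) T :=
      (hant.comp_monotone fun _ _ h => add_le_add_left h δ :
        Antitone fun t => kineticEnergy η ℱ W (t + δ)).intervalIntegrable
    exact ((intervalIntegrable_iff_integrableOn_Ioo_of_le (by linarith)).1 (hi1.sub hi2))
  have h2 : ‖∫ t in Ioo (-1) T, ∫ ω, segmentAverage φ
      (t + δ, X (t + δ) ω, η[W | ℱ (t + δ)] ω, η[W | ℱ t] ω) •
      (η[W | ℱ t] ω - η[W | ℱ (t + δ)] ω) ∂η‖ ≤ supGradV (φ : Phase d → ℝ) * (δ * 1) := by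
    refine (norm_integral_le_of_norm_le (hint.const_mul (supGradV (φ : Phase d → ℝ)))
      (Eventually.of_forall fun t => h.norm_defect_integrand_le hn φ hδ t)).trans ?_
    rw [integral_const_mul]
    exact mul_le_mul_of_nonneg_left (integral_antitone_sub_le hant
      (fun t => kineticEnergy_nonneg t) h.kineticEnergy_le_one (by linarith) hδ)
      (supGradV_nonneg _)
  calc δ⁻¹ * _ ≤ δ⁻¹ * (supGradV (φ : Phase d → ℝ) * (δ * 1)) := by gcongr
    _ = _ := by field_simp

/-- The ultrafilter along which the defects converge. -/
def zeroUltrafilter : Ultrafilter ℝ := Ultrafilter.of (𝓝[>] (0 : ℝ))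

/-- The defects are eventually in a closed ball of `ℝ^d`, which is compact. One ultrafilter serves
all test functions at once, so linearity passes to the limit without extracting subsequences. -/
lemma exists_tendsto_defect (h : MartingaleFlow T η ℱ W X) (hT : 0 < T)
    (φ : 𝓓^{1}(phaseOpen T d, ℝ)) :
    ∃ p : E d, ‖p‖ ≤ supGradV (φ : Phase d → ℝ) ∧
      Tendsto (fun δ => defect η ℱ W X δ φ) zeroUltrafilter (𝓝 p) := by
  have hc := isCompact_closedBall (0 : E d) (supGradV (φ : Phase d → ℝ))
  have hle : (zeroUltrafilter : Filter ℝ) ≤ 𝓝[>] (0 : ℝ) := Ultrafilter.of_le _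
  obtain ⟨p, hp, hlim⟩ := hc.ultrafilter_le_nhds (zeroUltrafilter.map fun δ => defect η ℱ W X δ φ) (by
    rw [Ultrafilter.coe_map, le_principal_iff, mem_map]
    refine hle ?_
    filter_upwards [h.norm_defect_le hT le_rfl φ] with δ hδ
    simpa using hδ)
  exact ⟨p, by simpa using hp, hlim⟩

/-- The limit of the defects. -/
def defectLimit (h : MartingaleFlow T η ℱ W X) (hT : 0 < T) (φ : 𝓓^{1}(phaseOpen T d, ℝ)) : E d :=
  (h.exists_tendsto_defect hT φ).choose

lemma norm_defectLimit_le (h : MartingaleFlow T η ℱ W X) (hT : 0 < T)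
    (φ : 𝓓^{1}(phaseOpen T d, ℝ)) : ‖h.defectLimit hT φ‖ ≤ supGradV (φ : Phase d → ℝ) :=
  (h.exists_tendsto_defect hT φ).choose_spec.1

lemma tendsto_defect (h : MartingaleFlow T η ℱ W X) (hT : 0 < T) (φ : 𝓓^{1}(phaseOpen T d, ℝ)) :
    Tendsto (fun δ => defect η ℱ W X δ φ) zeroUltrafilter (𝓝 (h.defectLimit hT φ)) :=
  (h.exists_tendsto_defect hT φ).choose_spec.2

/-- The defect distribution. -/
def defectDistribution (h : MartingaleFlow T η ℱ W X) (hT : 0 < T) : 𝓓'^{1}(phaseOpen T d, E d) :=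
  -- The minus sign cancels the one from the derivative of a distribution: `divV` then acts on `φ`
  -- as the limit of the summed defects of the `∂_{v_i} φ`.
  let L : 𝓓^{1}(phaseOpen T d, ℝ) →ₗ[ℝ] E d :=
    { toFun := fun φ => -(h.defectLimit hT φ)
      map_add' := fun φ ψ => by
        have h1 := (h.tendsto_defect hT φ)
        have h2 := (h.tendsto_defect hT ψ)
        have h3 := (h.tendsto_defect hT (φ + ψ))
        simp only [h.defect_add] at h3
        rw [tendsto_nhds_unique h3 (h1.add h2), neg_add]
      map_smul' := fun c φ => by
        have h1 := (h.tendsto_defect hT φ)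
        have h3 := (h.tendsto_defect hT (c • φ))
        simp only [defect_smul] at h3
        rw [tendsto_nhds_unique h3 (h1.const_smul c), RingHom.id_apply, smul_neg] }
  { toLinearMap := L
    cont := by
      -- Continuity follows from the bound by `∇_v φ`, since the sup norm of the full derivative is
      -- a continuous seminorm on test functions.
      let S : 𝓓^{1}(phaseOpen T d, ℝ) →L[ℝ] BoundedContinuousFunction (Phase d) (Phase d →L[ℝ] ℝ) :=
        (TestFunction.toBoundedContinuousFunctionCLM ℝ).comp
          (TestFunction.fderivCLM ℝ 1 0 :
            𝓓^{1}(phaseOpen T d, ℝ) →L[ℝ] 𝓓^{0}(phaseOpen T d, Phase d →L[ℝ] ℝ))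
      have hS : ∀ φ, ‖L φ‖ ≤ ‖S φ‖ := fun φ => by
        change ‖-(h.defectLimit hT φ)‖ ≤ _
        rw [norm_neg]
        refine (h.norm_defectLimit_le hT φ).trans ?_
        refine Real.iSup_le (fun z => ?_) (norm_nonneg (S φ))
        refine (norm_gradV_le (differentiable_testFunction le_rfl φ) z).trans ?_
        refine le_trans (le_of_eq ?_) ((S φ).norm_coe_le_norm z)
        change _ = ‖(TestFunction.fderivCLM ℝ 1 0 φ : 𝓓^{0}(phaseOpen T d, Phase d →L[ℝ] ℝ)) z‖
        rw [TestFunction.fderivCLM_apply_of_le _ (by norm_num)]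
      refine continuous_of_continuousAt_zero L ?_
      rw [ContinuousAt, map_zero]
      refine squeeze_zero_norm hS ?_
      have hc := (continuous_norm (E := BoundedContinuousFunction (Phase d) (Phase d →L[ℝ] ℝ))).comp
        S.continuous
      exact hc.tendsto' 0 0 (by rw [Function.comp_apply, map_zero]; exact norm_zero (E := BoundedContinuousFunction (Phase d) (Phase d →L[ℝ] ℝ))) }

lemma norm_defectDistribution_le (h : MartingaleFlow T η ℱ W X) (hT : 0 < T)
    (φ : 𝓓^{1}(phaseOpen T d, ℝ)) :
    ‖h.defectDistribution hT φ‖ ≤ ⨆ z : Phase d, ‖gradV φ z‖ := by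
  change ‖-(h.defectLimit hT φ)‖ ≤ _
  rw [norm_neg]
  exact (h.norm_defectLimit_le hT φ)

/-- The kinetic equation. -/
theorem divV_defectDistribution (h : MartingaleFlow T η ℱ W X) (hT : 0 < T)
    (φ : 𝓓^{2}(phaseOpen T d, ℝ)) :
    divV (h.defectDistribution hT) φ =
      ∫ t in Ioo (-1) T, ∫ ω, transport φ (t, X t ω, η[W | ℱ t] ω) ∂η := by
  have hle : (zeroUltrafilter : Filter ℝ) ≤ 𝓝[>] (0 : ℝ) := Ultrafilter.of_le _
  have h1 := (h.tendsto_kinetic (isFlowTest_testFunction (by norm_num) φ)).mono_left hle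
  let ψ : Fin d → 𝓓^{1}(phaseOpen T d, ℝ) := fun i =>
    TestFunction.lineDerivCLM ℝ ((0, 0, EuclideanSpace.single i 1) : Phase d) φ
  have h2 : divV (h.defectDistribution hT) φ =
      ∑ i, (h.defectLimit hT (ψ i)) i := by
    unfold divV
    rw [sum_apply]
    refine Finset.sum_congr rfl fun i _ => ?_
    rw [Distribution.lineDerivCLM_apply, Distribution.mapCLM_apply]
    change -((-(h.defectLimit hT (ψ i)) : E d) i) = _
    simp
  have h3 : Tendsto (fun δ => ∑ i, (defect η ℱ W X δ (ψ i)) i) zeroUltrafilter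
      (𝓝 (∑ i, (h.defectLimit hT (ψ i)) i)) :=
    tendsto_finsetSum _ fun i _ =>
      ((EuclideanSpace.proj i : E d →L[ℝ] ℝ).continuous.tendsto _).comp
        (h.tendsto_defect hT (ψ i))
  rw [h2]
  -- For each `δ` the summed defects equal the quotients of `tendsto_kinetic`, by
  -- `sum_segmentAverage_lineDeriv`; what remains is to interchange sums, coordinates and integrals.
  refine tendsto_nhds_unique h3 (h1.congr fun δ => ?_)
  have hC : ∀ i, ∃ C, ∀ z, ‖ψ i z‖ ≤ C := fun i => testFunction_bound (ψ i)
  have e : ∀ i, (defect η ℱ W X δ (ψ i)) i = δ⁻¹ * ∫ t, ∫ ω, segmentAverage (ψ i)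
      (t + δ, X (t + δ) ω, η[W | ℱ (t + δ)] ω, η[W | ℱ t] ω) *
      (η[W | ℱ t] ω - η[W | ℱ (t + δ)] ω) i ∂η := by
    intro i
    obtain ⟨C, hC⟩ := hC i
    have e1 := (EuclideanSpace.proj i : E d →L[ℝ] ℝ).integral_comp_comm (h.integrable_defect (ψ i) δ)
    change δ⁻¹ * (EuclideanSpace.proj i : E d →L[ℝ] ℝ) (∫ t, _) = _
    rw [← e1]
    congr 1
    refine integral_congr_ae (Eventually.of_forall fun t => ?_)
    exact ((EuclideanSpace.proj i : E d →L[ℝ] ℝ).integral_comp_comm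
      (h.integrable_segmentAverage_smul (ψ i).continuous hC δ t)).symm
  have hi1 : ∀ i t, Integrable (fun ω => segmentAverage (ψ i)
      (t + δ, X (t + δ) ω, η[W | ℱ (t + δ)] ω, η[W | ℱ t] ω) *
      (η[W | ℱ t] ω - η[W | ℱ (t + δ)] ω) i) η := fun i t => by
    obtain ⟨C, hC⟩ := hC i
    exact (EuclideanSpace.proj i : E d →L[ℝ] ℝ).integrable_comp
      (h.integrable_segmentAverage_smul (ψ i).continuous hC δ t)
  have hi2 : ∀ i, Integrable (fun t => ∫ ω, segmentAverage (ψ i)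
      (t + δ, X (t + δ) ω, η[W | ℱ (t + δ)] ω, η[W | ℱ t] ω) *
      (η[W | ℱ t] ω - η[W | ℱ (t + δ)] ω) i ∂η) := fun i => by
    obtain ⟨C, hC⟩ := hC i
    refine ((EuclideanSpace.proj i : E d →L[ℝ] ℝ).integrable_comp
      (h.integrable_defect (ψ i) δ)).congr (Eventually.of_forall fun t => ?_)
    exact ((EuclideanSpace.proj i : E d →L[ℝ] ℝ).integral_comp_comm
      (h.integrable_segmentAverage_smul (ψ i).continuous hC δ t)).symm
  simp_rw [e, ← Finset.mul_sum]
  rw [← integral_finsetSum _ fun i _ => hi2 i]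
  congr 1
  refine integral_congr_ae (Eventually.of_forall fun t => ?_)
  simp only
  rw [← integral_finsetSum _ fun i _ => hi1 i t]
  refine integral_congr_ae (Eventually.of_forall fun ω => ?_)
  exact (sum_segmentAverage_lineDeriv φ _ _ _ _).symm

end MartingaleFlow

/-! ### Convex functions of quadratic growth -/

section Convex

variable {F : Type*} [NormedAddCommGroup F] [InnerProductSpace ℝ F]

/-- Slopes of a convex function increase along a line, so the slope between `b` and `b'` is at most
the one up to a point far beyond `b'`, which the growth bounds. -/
lemma sub_le_of_convexOn_of_growth {f : F → ℝ} (hf : ConvexOn ℝ univ f) {C : ℝ}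
    (hC : ∀ v, |f v| ≤ C * (1 + ‖v‖ ^ 2)) (b b' : F) :
    |f b' - f b| ≤ 7 * C * ((1 + ‖b‖ + ‖b'‖) * ‖b' - b‖) := by
  wlog h : f b ≤ f b' generalizing b b'
  · have := this b' b (not_le.1 h).le
    rw [abs_sub_comm, norm_sub_rev]
    convert this using 3
    ring
  rw [abs_of_nonneg (sub_nonneg.2 h)]
  rcases eq_or_ne b' b with rfl | hne
  · simp
  have hD : 0 < ‖b' - b‖ := norm_pos_iff.2 (sub_ne_zero.2 hne)
  set D := ‖b' - b‖ with hDdef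
  set r := 1 + ‖b‖ + ‖b'‖ with hr
  have hb := norm_nonneg b
  have hb' := norm_nonneg b'
  have hr1 : 1 ≤ r := by linarith
  have hC0 : 0 ≤ C := by
    have := (abs_nonneg _).trans (hC 0)
    simpa using this
  -- The point at distance `r` beyond `b'`. There `f c` is at most `5 C r²` while `f b` is at least
  -- `-2 C r²`, whence the 7.
  set c := b' + (r / D) • (b' - b) with hc
  have hcn : ‖c‖ ≤ 2 * r := by
    refine (norm_add_le _ _).trans ?_
    rw [norm_smul, Real.norm_of_nonneg (by positivity), ← hDdef, div_mul_cancel₀ _ hD.ne']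
    linarith
  have hs : 0 < D + r := by linarith
  have hcomb : b' = (r / (D + r)) • b + (D / (D + r)) • c := by
    have h1 : (D / (D + r)) * (r / D) = r / (D + r) := by field_simp
    have h2 : r / (D + r) + D / (D + r) = 1 := by field_simp; ring
    rw [hc, smul_add, smul_smul, h1, smul_sub]
    have : (r / (D + r)) • b + ((D / (D + r)) • b' + ((r / (D + r)) • b' - (r / (D + r)) • b)) =
      (r / (D + r) + D / (D + r)) • b' := by rw [add_smul]; abel
    rw [this, h2, one_smul]
  have hconv := hf.2 (mem_univ b) (mem_univ c) (show 0 ≤ r / (D + r) by positivity)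
    (show 0 ≤ D / (D + r) by positivity) (by field_simp; ring)
  rw [← hcomb, smul_eq_mul, smul_eq_mul] at hconv
  have hfc : f c ≤ C * (5 * r ^ 2) := by
    refine (le_abs_self _).trans ((hC c).trans (mul_le_mul_of_nonneg_left ?_ hC0))
    have := pow_le_pow_left₀ (norm_nonneg c) hcn 2
    nlinarith
  have hfb : -(C * (2 * r ^ 2)) ≤ f b := by
    refine (neg_le_neg ?_).trans (neg_abs_le _)
    refine (hC b).trans (mul_le_mul_of_nonneg_left ?_ hC0)
    nlinarith
  have h1 : f b' - f b ≤ D / (D + r) * (f c - f b) := by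
    have h2 : r / (D + r) = 1 - D / (D + r) := by field_simp; ring
    rw [h2] at hconv
    linarith
  have h3 : D / (D + r) ≤ D / r := div_le_div_of_nonneg_left hD.le (by linarith) (by linarith)
  calc f b' - f b ≤ D / (D + r) * (f c - f b) := h1
    _ ≤ D / (D + r) * (7 * C * r ^ 2) := by
        refine mul_le_mul_of_nonneg_left (by linarith) (by positivity)
    _ ≤ D / r * (7 * C * r ^ 2) := mul_le_mul_of_nonneg_right h3 (by positivity)
    _ = 7 * C * (r * D) := by field_simp

/-! ### A convex weight, quadratic at infinity -/

/-- The function `s² / (A + s)`. -/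
def weight (A s : ℝ) : ℝ := s ^ 2 / (A + s)

/-- The derivative of `weight A`. -/
def weightDeriv (A s : ℝ) : ℝ := 1 - A ^ 2 / (A + s) ^ 2

/-- The Bregman divergence of `v ↦ weight A (‖v‖²)`. -/
def bregman (A : ℝ) (b b' : F) : ℝ :=
  weight A (‖b'‖ ^ 2) - weight A (‖b‖ ^ 2) - 2 * weightDeriv A (‖b‖ ^ 2) * inner ℝ b (b' - b)

variable {A : ℝ}

lemma weight_nonneg (hA : 0 < A) {s : ℝ} (hs : 0 ≤ s) : 0 ≤ weight A s := by
  unfold weight; positivity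

lemma weight_le (hA : 0 < A) {s : ℝ} (hs : 0 ≤ s) : weight A s ≤ s := by
  unfold weight
  rw [div_le_iff₀ (by positivity)]
  nlinarith

lemma weightDeriv_nonneg (hA : 0 < A) {s : ℝ} (hs : 0 ≤ s) : 0 ≤ weightDeriv A s := by
  unfold weightDeriv
  rw [sub_nonneg, div_le_one (by positivity)]
  exact pow_le_pow_left₀ hA.le (by linarith) 2

lemma weightDeriv_le_one {s : ℝ} : weightDeriv A s ≤ 1 := by
  unfold weightDeriv
  have : 0 ≤ A ^ 2 / (A + s) ^ 2 := by positivity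
  linarith

/-- The first term is the Bregman divergence of `weight A` in `s = ‖v‖²`, where `weight A s = s - A
+ A² / (A + s)`; the second is its derivative times the divergence of `‖v‖²`. Both are visibly
nonnegative, which dispenses with a separate proof of convexity. -/
lemma bregman_eq (hA : 0 < A) (b b' : F) : bregman A b b' =
    A ^ 2 * (‖b'‖ ^ 2 - ‖b‖ ^ 2) ^ 2 / ((A + ‖b‖ ^ 2) ^ 2 * (A + ‖b'‖ ^ 2)) +
      weightDeriv A (‖b‖ ^ 2) * ‖b' - b‖ ^ 2 := by
  have h1 : ‖b'‖ ^ 2 = ‖b‖ ^ 2 + 2 * inner ℝ b (b' - b) + ‖b' - b‖ ^ 2 := by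
    rw [← norm_add_sq_real]; simp
  have h2 : 2 * inner ℝ b (b' - b) = ‖b'‖ ^ 2 - ‖b‖ ^ 2 - ‖b' - b‖ ^ 2 := by linarith
  have h3 : bregman A b b' = weight A (‖b'‖ ^ 2) - weight A (‖b‖ ^ 2) -
      weightDeriv A (‖b‖ ^ 2) * (2 * inner ℝ b (b' - b)) := by unfold bregman; ring
  rw [h3, h2]
  have e0 : A + ‖b‖ ^ 2 ≠ 0 := by positivity
  have e1 : A + ‖b'‖ ^ 2 ≠ 0 := by positivity
  unfold weight weightDeriv
  field_simp
  ring

lemma bregman_nonneg (hA : 0 < A) (b b' : F) : 0 ≤ bregman A b b' := by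
  rw [bregman_eq hA]
  have := weightDeriv_nonneg hA (sq_nonneg ‖b‖)
  positivity

/-- If `‖b‖² ≥ A`, the derivative of the weight is at least `3/4` and the second term of
`bregman_eq` suffices. Otherwise `b'` dominates: `‖b' - b‖² ≤ (9/4) ‖b'‖²`, and the first term is at
least `(9/80) ‖b'‖²`. The ratio of these is 20. -/
lemma norm_sub_sq_le_bregman (hA : 0 < A) {b b' : F} (h : 4 * A ≤ max (‖b‖ ^ 2) (‖b'‖ ^ 2)) :
    ‖b' - b‖ ^ 2 ≤ 20 * bregman A b b' := by
  rw [bregman_eq hA]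
  have hw := weightDeriv_nonneg hA (sq_nonneg ‖b‖)
  have hD := sq_nonneg ‖b' - b‖
  rcases le_total A (‖b‖ ^ 2) with hs | hs
  · have h1 : 3 / 4 ≤ weightDeriv A (‖b‖ ^ 2) := by
      have : A ^ 2 / (A + ‖b‖ ^ 2) ^ 2 ≤ 1 / 4 := by
        rw [div_le_iff₀ (by positivity)]
        nlinarith
      unfold weightDeriv
      linarith
    have h2 : 0 ≤ A ^ 2 * (‖b'‖ ^ 2 - ‖b‖ ^ 2) ^ 2 / ((A + ‖b‖ ^ 2) ^ 2 * (A + ‖b'‖ ^ 2)) := by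
      positivity
    nlinarith
  · have hs' : 4 * A ≤ ‖b'‖ ^ 2 := by
      rcases le_max_iff.1 h with h | h
      · linarith
      · exact h
    have hbb : 2 * ‖b‖ ≤ ‖b'‖ := by
      refine abs_le_of_sq_le_sq' ?_ (norm_nonneg _) |>.2
      nlinarith
    have h1 : ‖b' - b‖ ^ 2 ≤ 9 / 4 * ‖b'‖ ^ 2 := by
      have : ‖b' - b‖ ≤ 3 / 2 * ‖b'‖ := (norm_sub_le _ _).trans (by linarith)
      have := pow_le_pow_left₀ (norm_nonneg _) this 2
      nlinarith
    have h2 : 9 / 80 * ‖b'‖ ^ 2 ≤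
        A ^ 2 * (‖b'‖ ^ 2 - ‖b‖ ^ 2) ^ 2 / ((A + ‖b‖ ^ 2) ^ 2 * (A + ‖b'‖ ^ 2)) := by
      have e0 := sq_nonneg ‖b‖
      generalize ‖b'‖ ^ 2 = s' at *
      generalize ‖b‖ ^ 2 = s at *
      have e1 : (3 / 4 * s') ^ 2 ≤ (s' - s) ^ 2 := pow_le_pow_left₀ (by linarith) (by linarith) 2
      have e2 : (A + s) ^ 2 ≤ 4 * A ^ 2 := by nlinarith
      have e3 : A + s' ≤ 5 / 4 * s' := by linarith
      have e4 : 0 < A + s' := by linarith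
      rw [le_div_iff₀ (by positivity)]
      calc 9 / 80 * s' * ((A + s) ^ 2 * (A + s')) ≤ 9 / 80 * s' * ((4 * A ^ 2) * (5 / 4 * s')) := by
            have : 0 ≤ s' := by linarith
            gcongr
        _ = A ^ 2 * (3 / 4 * s') ^ 2 := by ring
        _ ≤ _ := by gcongr
    nlinarith

end Convex

/-! ### The truncation error -/

section Truncation

variable {d : ℕ}

/-- The part of the increment of `χ f` that is of second order. -/
def truncationError (χ f : E d → ℝ) (b b' : E d) : ℝ :=
  (χ b' - χ b) * (f b' - f b) + f b * (χ b' - χ b - fderiv ℝ χ b (b' - b))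

/-- Each summand is a product of two first order differences, or a Taylor remainder of `χ`. The
point is that `K` depends on `f` only through its growth constant, so that rescaling is possible. -/
lemma truncationError_bound {χ : E d → ℝ} (hχ : ContDiff ℝ 2 χ) (hχc : HasCompactSupport χ)
    {C : ℝ} (hC0 : 0 ≤ C) : ∃ K, 0 ≤ K ∧ ∀ f : E d → ℝ, ConvexOn ℝ univ f →
      (∀ v, |f v| ≤ C * (1 + ‖v‖ ^ 2)) → ∀ b b', |truncationError χ f b b'| ≤ K * ‖b' - b‖ ^ 2 := by
  obtain ⟨M, hM⟩ := hχc.exists_bound_of_continuous hχ.continuous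
  obtain ⟨L, hL⟩ := (hχ.of_le (by norm_num) : ContDiff ℝ 1 χ).lipschitzWith_of_hasCompactSupport hχc
    (by norm_num)
  obtain ⟨L', hL'⟩ := (hχ.fderiv_right (m := 1) (by norm_num)).lipschitzWith_of_hasCompactSupport
    (hχc.fderiv ℝ) (by norm_num)
  obtain ⟨r₀, hr₀⟩ := hχc.isBounded.subset_closedBall 0
  -- The added 1 puts the support of `χ` strictly inside the ball of radius `r`.
  set r := max r₀ 1 + 1 with hrdef
  have hr1 : 1 ≤ r := by linarith [le_max_right r₀ 1]
  have hr : ∀ v, r ≤ ‖v‖ → v ∉ tsupport χ := fun v hv hvs => by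
    have := hr₀ hvs
    rw [mem_closedBall_zero_iff] at this
    linarith [le_max_left r₀ 1]
  have hχ0 : ∀ v, r ≤ ‖v‖ → χ v = 0 := fun v hv => image_eq_zero_of_notMem_tsupport (hr v hv)
  have hM0 : 0 ≤ M := (norm_nonneg _).trans (hM 0)
  have hlip : ∀ b b', |χ b' - χ b| ≤ L * ‖b' - b‖ := fun b b' => by
    simpa [dist_eq_norm] using hL.dist_le_mul b' b
  have hrem : ∀ b b', |χ b' - χ b - fderiv ℝ χ b (b' - b)| ≤ L' * ‖b' - b‖ ^ 2 := fun b b' => by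
    have := (convex_segment b b').norm_image_sub_le_of_norm_fderiv_le' (𝕜 := ℝ) (f := χ)
      (φ := fderiv ℝ χ b) (C := L' * ‖b' - b‖) (fun z _ => hχ.differentiable (by norm_num) z)
      (fun z hz => ?_) (left_mem_segment ℝ b b') (right_mem_segment ℝ b b')
    · rw [sq, ← mul_assoc]; exact this
    · have h1 := hL'.dist_le_mul z b
      rw [dist_eq_norm, dist_eq_norm] at h1
      refine h1.trans (mul_le_mul_of_nonneg_left ?_ L'.2)
      have := norm_sub_le_of_mem_segment hz
      exact this
  refine ⟨7 * C * ((1 + 2 * r) * L + 2 * M) + (C * (1 + 4 * r ^ 2) * L' + 5 * C * M),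
    by positivity, fun f hf hfC b b' => ?_⟩
  set D := ‖b' - b‖ with hD
  have hD0 : 0 ≤ D := norm_nonneg _
  have hbD : ‖b‖ ≤ ‖b'‖ + D := by
    rw [hD, norm_sub_rev]; linarith [norm_sub_norm_le b b']
  have hbD' : ‖b'‖ ≤ ‖b‖ + D := by linarith [norm_sub_norm_le b' b]
  have h1 : |(χ b' - χ b) * (f b' - f b)| ≤ 7 * C * ((1 + 2 * r) * L + 2 * M) * D ^ 2 := by
    by_cases hb : r ≤ ‖b‖ ∧ r ≤ ‖b'‖
    · rw [hχ0 b hb.1, hχ0 b' hb.2]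
      simp only [sub_zero, zero_mul, abs_zero]
      positivity
    · have hmin : 1 + ‖b‖ + ‖b'‖ ≤ (1 + 2 * r) + D := by
        rw [not_and_or, not_le, not_le] at hb
        rcases hb with hb | hb <;> linarith
      have h2M : |χ b' - χ b| ≤ 2 * M := by
        have h1 := abs_le.1 (hM b)
        have h2 := abs_le.1 (hM b')
        rw [abs_le]; constructor <;> linarith
      have hlb := hlip b b'
      rw [abs_mul]
      calc |χ b' - χ b| * |f b' - f b|
          ≤ |χ b' - χ b| * (7 * C * (((1 + 2 * r) + D) * D)) :=
            mul_le_mul_of_nonneg_left ((sub_le_of_convexOn_of_growth hf hfC b b').trans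
              (by gcongr)) (abs_nonneg _)
        _ = 7 * C * ((1 + 2 * r) * (|χ b' - χ b| * D) + |χ b' - χ b| * D ^ 2) := by ring
        _ ≤ 7 * C * ((1 + 2 * r) * (L * D * D) + 2 * M * D ^ 2) := by gcongr
        _ = _ := by ring
  have h2 : |f b * (χ b' - χ b - fderiv ℝ χ b (b' - b))| ≤
      (C * (1 + 4 * r ^ 2) * L' + 5 * C * M) * D ^ 2 := by
    rw [abs_mul]
    -- For bounded `b` the Taylor estimate applies. Far out, `χ` and its derivative vanish at `b`,
    -- and `χ b'` can be nonzero only if `D` is comparable to `‖b‖`.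
    rcases lt_or_ge ‖b‖ (2 * r) with hb | hb
    · calc |f b| * |χ b' - χ b - fderiv ℝ χ b (b' - b)| ≤ C * (1 + 4 * r ^ 2) * (L' * D ^ 2) := by
            refine mul_le_mul ((hfC b).trans ?_) (hrem b b') (abs_nonneg _) (by positivity)
            refine mul_le_mul_of_nonneg_left ?_ hC0
            nlinarith [norm_nonneg b]
        _ ≤ _ := by nlinarith [(by positivity : 0 ≤ 5 * C * M * D ^ 2)]
    · have hd : fderiv ℝ χ b = 0 := image_eq_zero_of_notMem_tsupport fun hc =>
        hr b (by linarith) (tsupport_fderiv_subset ℝ hc)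
      rw [hχ0 b (by linarith), hd, sub_zero, _root_.zero_apply, sub_zero]
      by_cases hb' : r ≤ ‖b'‖
      · rw [hχ0 b' hb', abs_zero, mul_zero]
        positivity
      · have hDr : ‖b‖ ≤ 2 * D := by linarith
        have hD1 : 1 ≤ D := by linarith
        calc |f b| * |χ b'| ≤ C * (5 * D ^ 2) * M := by
              refine mul_le_mul ((hfC b).trans ?_) (hM b') (abs_nonneg _) (by positivity)
              refine mul_le_mul_of_nonneg_left ?_ hC0
              nlinarith [norm_nonneg b]
          _ ≤ _ := by nlinarith [(by positivity : 0 ≤ C * (1 + 4 * r ^ 2) * L' * D ^ 2)]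
  unfold truncationError
  refine (abs_add_le _ _).trans ?_
  linarith

lemma truncationError_eq_zero {χ f : E d → ℝ} {r : ℝ} (hr : ∀ v, ‖v‖ < r → χ v = χ 0) {b b' : E d}
    (hb : ‖b‖ < r) (hb' : ‖b'‖ < r) : truncationError χ f b b' = 0 := by
  have h1 : χ =ᶠ[𝓝 b] fun _ => χ 0 := by
    filter_upwards [(isOpen_lt continuous_norm continuous_const).mem_nhds hb] with v hv
    exact hr v hv
  rw [truncationError, hr b hb, hr b' hb', h1.fderiv_eq]
  simp

/-- The truncation errors are controlled by the Bregman divergences of convex weights. -/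
lemma truncationError_scaled_bound {χ : E d → ℝ} (hχ : ContDiff ℝ 2 χ) (hχc : HasCompactSupport χ)
    {r : ℝ} (hr0 : 0 < r) (hr : ∀ v, ‖v‖ < r → χ v = χ 0) {C : ℝ} (hC0 : 0 ≤ C) :
    ∃ K, 0 ≤ K ∧ ∀ N : ℝ, 1 ≤ N → ∀ f : E d → ℝ, ConvexOn ℝ univ f →
      (∀ v, |f v| ≤ C * (1 + ‖v‖ ^ 2)) → ∀ b b',
      |truncationError (fun v => χ (N⁻¹ • v)) f b b'| ≤ K * bregman ((N * r) ^ 2 / 4) b b' := by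
  obtain ⟨K, hK0, hK⟩ := truncationError_bound hχ hχc hC0
  refine ⟨K * 20, by positivity, fun N hN f hf hfC b b' => ?_⟩
  have hN0 : 0 < N := by linarith
  have hA : 0 < (N * r) ^ 2 / 4 := by positivity
  have hball : ∀ v : E d, ‖v‖ < N * r → χ (N⁻¹ • v) = χ (N⁻¹ • (0 : E d)) := fun v hv => by
    rw [smul_zero]
    refine hr _ ?_
    rw [norm_smul, norm_inv, Real.norm_of_nonneg hN0.le, inv_mul_lt_iff₀ hN0]
    exact hv
  by_cases hb : ‖b‖ < N * r ∧ ‖b'‖ < N * r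
  · rw [truncationError_eq_zero hball hb.1 hb.2, abs_zero]
    have := bregman_nonneg hA b b'
    positivity
  -- The value `A = (N r)² / 4` makes the threshold `4 A` of `norm_sub_sq_le_bregman` the squared
  -- radius of the ball where the scaled cutoff is constant.
  · have hmax : 4 * ((N * r) ^ 2 / 4) ≤ max (‖b‖ ^ 2) (‖b'‖ ^ 2) := by
      rw [mul_div_cancel₀ _ (by norm_num)]
      rw [not_and_or, not_lt, not_lt] at hb
      have hNr : 0 ≤ N * r := by positivity
      exact le_max_iff.2 (hb.imp (fun h => pow_le_pow_left₀ hNr h 2)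
        fun h => pow_le_pow_left₀ hNr h 2)
    have hbr := norm_sub_sq_le_bregman hA hmax
    -- This rescaling keeps the growth constant, as `N ≥ 1`, and reduces the estimate to scale 1;
    -- the powers of `N` cancel because the bound is quadratic.
    set g : E d → ℝ := fun v => (N ^ 2)⁻¹ * f (N • v) with hg
    have hgconv : ConvexOn ℝ univ g := by
      have := (hf.comp_linearMap (LinearMap.lsmul ℝ (E d) N)).smul (c := (N ^ 2)⁻¹) (by positivity)
      simpa using this
    have hgC : ∀ v, |g v| ≤ C * (1 + ‖v‖ ^ 2) := fun v => by
      rw [hg, abs_mul, abs_of_nonneg (by positivity), inv_mul_le_iff₀ (by positivity)]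
      refine (hfC _).trans ?_
      rw [norm_smul, Real.norm_of_nonneg hN0.le, mul_left_comm]
      refine mul_le_mul_of_nonneg_left ?_ hC0
      nlinarith [sq_nonneg ‖v‖]
    have e : truncationError (fun v => χ (N⁻¹ • v)) f b b' =
        N ^ 2 * truncationError χ g (N⁻¹ • b) (N⁻¹ • b') := by
      have hd : fderiv ℝ (fun v => χ (N⁻¹ • v)) b (b' - b) =
          fderiv ℝ χ (N⁻¹ • b) (N⁻¹ • b' - N⁻¹ • b) := by
        rw [fderiv_comp_smul, ← smul_sub, map_smul]
        rfl
      simp only [truncationError, hd, hg, smul_smul, mul_inv_cancel₀ hN0.ne', one_smul]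
      field_simp
    have h1 := hK g hgconv hgC (N⁻¹ • b) (N⁻¹ • b')
    rw [← smul_sub, norm_smul, norm_inv, Real.norm_of_nonneg hN0.le] at h1
    rw [e, abs_mul, abs_of_nonneg (by positivity)]
    calc N ^ 2 * |truncationError χ g (N⁻¹ • b) (N⁻¹ • b')|
        ≤ N ^ 2 * (K * (N⁻¹ * ‖b' - b‖) ^ 2) := by gcongr
      _ = K * ‖b' - b‖ ^ 2 := by field_simp
      _ ≤ K * (20 * bregman ((N * r) ^ 2 / 4) b b') := by gcongr
      _ = _ := by ring

end Truncation

/-! ### Convex test functions -/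

namespace IsConvexTest

variable {T : ℝ} {d : ℕ} {Ψ : Phase d → ℝ}

lemma support (hΨ : IsConvexTest T Ψ) : ∃ K : Set (ℝ × E d), IsCompact K ∧
    K ⊆ Ioo (-1) T ×ˢ univ ∧ ∀ t x v, (t, x) ∉ K → Ψ (t, x, v) = 0 := by
  obtain ⟨C, -, ψ, -, hψ⟩ := hΨ.growth
  exact ⟨tsupport ψ, ψ.hasCompactSupport, ψ.tsupport_subset, hψ⟩

/-- The growth hypothesis is one-sided. Convexity at the midpoint `0` of `v` and `-v` gives the
lower bound, since `Ψ(t, x, 0)` is continuous with compact support. -/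
lemma abs_le_growth (hΨ : IsConvexTest T Ψ) :
    ∃ C, 0 ≤ C ∧ ∀ t x v, |Ψ (t, x, v)| ≤ C * (1 + ‖v‖ ^ 2) := by
  obtain ⟨C, hC, ψ, hψ, hs⟩ := hΨ.growth
  obtain ⟨M, hM⟩ := ψ.hasCompactSupport.exists_bound_of_continuous ψ.continuous
  have hM0 : 0 ≤ M := (norm_nonneg _).trans (hM 0)
  obtain ⟨M', hM'⟩ := (HasCompactSupport.intro (f := fun p : ℝ × E d => Ψ (p.1, p.2, 0))
    ψ.hasCompactSupport fun p hp => hs _ _ _ hp).exists_bound_of_continuous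
      (hΨ.continuous.comp (by fun_prop))
  have hM0' : 0 ≤ M' := (norm_nonneg _).trans (hM' 0)
  have hup : ∀ t x v, Ψ (t, x, v) ≤ C * M * (1 + ‖v‖ ^ 2) := fun t x v => by
    refine (hψ t x v).trans ?_
    have := (le_abs_self _).trans (hM (t, x))
    gcongr
  refine ⟨2 * M' + C * M, by positivity, fun t x v => abs_le.2 ⟨?_, ?_⟩⟩
  · have h1 := (hΨ.convex t x).2 (mem_univ v) (mem_univ (-v)) (by norm_num : (0 : ℝ) ≤ 1 / 2)
      (by norm_num : (0 : ℝ) ≤ 1 / 2) (by norm_num)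
    simp only [smul_neg, add_neg_cancel, smul_eq_mul] at h1
    have h2 := hup t x (-v)
    rw [norm_neg] at h2
    have h3 := (abs_le.1 (hM' (t, x))).1
    simp only at h3
    nlinarith [mul_nonneg hM0' (sq_nonneg ‖v‖)]
  · refine (hup t x v).trans ?_
    gcongr
    linarith

/-- `IsFlowTest` asks for no derivative in `v`, so the transport argument covers convex functions
that are not of class C². -/
lemma isFlowTest_truncate (hΨ : IsConvexTest T Ψ) (χ : 𝓓^{2}((⊤ : Opens (E d)), ℝ)) (n : ℕ) :
    IsFlowTest T (truncate χ n Ψ) := by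
  obtain ⟨K, hK, hKT, hs⟩ := hΨ.support
  obtain ⟨a, b, ha, hb, hab⟩ := exists_Icc_of_isCompact hK hKT
  have hn : ((n : ℝ) + 1)⁻¹ ≠ 0 := by positivity
  set χ' : E d → ℝ := fun v => χ (((n : ℝ) + 1)⁻¹ • v) with hχ'
  have hχc : HasCompactSupport χ' := χ.hasCompactSupport.comp_smul hn
  have hχ : Continuous χ' := χ.continuous.comp (continuous_const_smul _)
  have hcompact : ∀ {G : Type} [NormedAddCommGroup G] (f : Phase d → G), Continuous f →
      (∀ t x v, (t, x) ∉ K → f (t, x, v) = 0) → (∀ t x v, v ∉ tsupport χ' → f (t, x, v) = 0) →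
      ∃ C, ∀ z, ‖f z‖ ≤ C := by
    intro G _ f hf h1 h2
    let e : Phase d ≃ₜ (ℝ × E d) × E d := (Homeomorph.prodAssoc ℝ (E d) (E d)).symm
    refine (HasCompactSupport.intro (e.isCompact_preimage.2 (hK.prod hχc))
      fun z hz => ?_).exists_bound_of_continuous hf
    obtain ⟨t, x, v⟩ := z
    by_cases hz1 : (t, x) ∈ K
    · exact h2 t x v fun hv => hz ⟨hz1, hv⟩
    · exact h1 t x v hz1
  have hderiv : ∀ v p, fderiv ℝ (fun p : ℝ × E d => truncate χ n Ψ (p.1, p.2, v)) p =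
      χ' v • fderiv ℝ (fun p : ℝ × E d => Ψ (p.1, p.2, v)) p := fun v p =>
    fderiv_const_mul (hΨ.differentiable v p) (χ' v)
  refine ⟨?_, fun v => (hΨ.differentiable v).const_mul (χ' v), ?_, ?_, ⟨a, b, ha, hb, ?_⟩⟩
  · exact (hχ.comp continuous_snd.snd).mul hΨ.continuous
  · exact hcompact (fun z => χ' z.2.2 * Ψ z) ((hχ.comp continuous_snd.snd).mul hΨ.continuous)
      (fun t x v h => by simp [hs t x v h])
      (fun t x v h => by simp [image_eq_zero_of_notMem_tsupport h])
  · have hd0 : ∀ t x v, (t, x) ∉ K →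
        fderiv ℝ (fun p : ℝ × E d => Ψ (p.1, p.2, v)) (t, x) = 0 := fun t x v h => by
      have : (fun p : ℝ × E d => Ψ (p.1, p.2, v)) =ᶠ[𝓝 (t, x)] fun _ => 0 := by
        filter_upwards [hK.isClosed.isOpen_compl.mem_nhds h] with p hp
        exact hs _ _ _ hp
      simp [this.fderiv_eq]
    obtain ⟨L, hL⟩ := hcompact (fun z : Phase d => χ' z.2.2 •
        fderiv ℝ (fun p : ℝ × E d => Ψ (p.1, p.2, z.2.2)) (z.1, z.2.1))
      ((hχ.comp continuous_snd.snd).smul hΨ.continuous_fderiv)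
      (fun t x v h => by simp [hd0 t x v h])
      (fun t x v h => by simp [image_eq_zero_of_notMem_tsupport h])
    exact ⟨L, fun v p => by rw [hderiv]; exact hL (p.1, p.2, v)⟩
  · intro t ht x v
    have : (t, x) ∉ K := fun h => ht (hab t x h)
    simp [truncate, hs t x v this]

end IsConvexTest

/-! ### Convex functions and conditional expectations -/

lemma exists_tendsto_of_stronglyMeasurable {Ω F : Type*} {m : MeasurableSpace Ω} [TopologicalSpace F]
    {X : Ω → F} (hX : StronglyMeasurable X) : ∃ Xn : ℕ → Ω → F, (∀ n, StronglyMeasurable (Xn n)) ∧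
      (∀ n, (range (Xn n)).Finite) ∧ ∀ ω, Tendsto (fun n => Xn n ω) atTop (𝓝 (X ω)) :=
  ⟨fun n => hX.approx n, fun n => (hX.approx n).stronglyMeasurable,
    fun n => (hX.approx n).finite_range, hX.tendsto_approx⟩

section CondExp

variable {Ω : Type*} {m mΩ : MeasurableSpace Ω} {d : ℕ} {μ : Measure Ω}
  {Z b : Ω → E d}

lemma integral_bilin_condExp [IsProbabilityMeasure μ] (hm : m ≤ mΩ) {F G H : Type*} [NormedAddCommGroup F] [NormedSpace ℝ F]
    [NormedAddCommGroup G] [NormedSpace ℝ G] [CompleteSpace G] [NormedAddCommGroup H]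
    [NormedSpace ℝ H] [CompleteSpace H] (B : F →L[ℝ] H →L[ℝ] G) {Y : Ω → F} {Z b : Ω → H}
    (hY : StronglyMeasurable[m] Y) (hZ : Integrable Z μ) (hbZ : μ[Z | m] =ᵐ[μ] b)
    (hi : Integrable (fun ω => B (Y ω) (Z ω)) μ) :
    ∫ ω, B (Y ω) (Z ω) ∂μ = ∫ ω, B (Y ω) (b ω) ∂μ := by
  have h1 := condExp_bilin_of_stronglyMeasurable_left B hY hi hZ
  rw [← integral_condExp hm]
  refine integral_congr_ae ?_
  filter_upwards [h1, hbZ] with ω h1 h2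
  rw [h1, h2]

lemma memLp_of_condExp_ae_eq (hZ : MemLp Z 2 μ) (hbZ : μ[Z | m] =ᵐ[μ] b) : MemLp b 2 μ :=
  (memLp_congr_ae hbZ).1 (hZ.condExp (by norm_num))

lemma integrable_weight {A : ℝ} (hA : 0 < A) (hZ : MemLp Z 2 μ) :
    Integrable (fun ω => weight A (‖Z ω‖ ^ 2)) μ := by
  refine (hZ.integrable_norm_pow (by norm_num)).mono' ?_ (Eventually.of_forall fun ω => ?_)
  · have : Measurable (weight A) := by unfold weight; fun_prop
    exact (this.comp_aemeasurable (hZ.1.norm.aemeasurable.pow_const 2)).aestronglyMeasurable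
  · rw [Real.norm_of_nonneg (weight_nonneg hA (by positivity))]
    exact weight_le hA (by positivity)

lemma stronglyMeasurable_weightDeriv_smul {A : ℝ} (hb : StronglyMeasurable[m] b) :
    StronglyMeasurable[m] fun ω => (2 * weightDeriv A (‖b ω‖ ^ 2)) • b ω := by
  have : Measurable (weightDeriv A) := by unfold weightDeriv; fun_prop
  exact ((this.comp (hb.norm.measurable.pow_const 2)).const_mul 2).stronglyMeasurable.smul hb

lemma integrable_inner_of_norm_le {Y Z : Ω → E d} (hY : AEStronglyMeasurable Y μ) {c : ℝ}
    (hb : MemLp b 2 μ) (hYb : ∀ ω, ‖Y ω‖ ≤ c * ‖b ω‖) (hZ : MemLp Z 2 μ) :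
    Integrable (fun ω => inner ℝ (Y ω) (Z ω)) μ := by
  refine ((integrable_norm_mul_norm hb hZ).const_mul c).mono' (hY.inner hZ.1)
    (Eventually.of_forall fun ω => (norm_inner_le_norm _ _).trans ?_)
  rw [← mul_assoc]
  exact mul_le_mul_of_nonneg_right (hYb ω) (norm_nonneg _)

lemma norm_weightDeriv_smul_le {A : ℝ} (hA : 0 < A) (v : E d) :
    ‖(2 * weightDeriv A (‖v‖ ^ 2)) • v‖ ≤ 2 * ‖v‖ := by
  have h0 := weightDeriv_nonneg hA (sq_nonneg ‖v‖)
  have h1 := weightDeriv_le_one (A := A) (s := ‖v‖ ^ 2)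
  rw [norm_smul, Real.norm_of_nonneg (by positivity)]
  nlinarith [norm_nonneg v]

lemma bregman_eq_sub_inner (A : ℝ) (v v' : E d) : bregman A v v' = weight A (‖v'‖ ^ 2) -
    weight A (‖v‖ ^ 2) - (inner ℝ ((2 * weightDeriv A (‖v‖ ^ 2)) • v) v' -
      inner ℝ ((2 * weightDeriv A (‖v‖ ^ 2)) • v) v) := by
  unfold bregman
  rw [← inner_sub_right, real_inner_smul_left]

lemma integrable_bregman (hm : m ≤ mΩ) {A : ℝ} (hA : 0 < A) (hZ : MemLp Z 2 μ)
    (hb : StronglyMeasurable[m] b) (hbZ : μ[Z | m] =ᵐ[μ] b) :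
    Integrable (fun ω => bregman A (b ω) (Z ω)) μ := by
  have hb2 := memLp_of_condExp_ae_eq hZ hbZ
  have hY := ((stronglyMeasurable_weightDeriv_smul (A := A) hb).mono hm).aestronglyMeasurable (μ := μ)
  have hYb : ∀ ω, ‖(2 * weightDeriv A (‖b ω‖ ^ 2)) • b ω‖ ≤ 2 * ‖b ω‖ := fun ω =>
    norm_weightDeriv_smul_le hA _
  simp only [bregman_eq_sub_inner]
  exact ((integrable_weight hA hZ).sub (integrable_weight hA hb2)).sub
    ((integrable_inner_of_norm_le hY hb2 hYb hZ).sub (integrable_inner_of_norm_le hY hb2 hYb hb2))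

variable [IsProbabilityMeasure μ]

/-- The part linear in `Z - b` has an `m`-measurable coefficient, at most `2 ‖b‖` in norm, so it is
integrable and averages to zero. -/
lemma integral_bregman (hm : m ≤ mΩ) {A : ℝ} (hA : 0 < A) (hZ : MemLp Z 2 μ)
    (hb : StronglyMeasurable[m] b) (hbZ : μ[Z | m] =ᵐ[μ] b) :
    ∫ ω, bregman A (b ω) (Z ω) ∂μ =
      ∫ ω, weight A (‖Z ω‖ ^ 2) ∂μ - ∫ ω, weight A (‖b ω‖ ^ 2) ∂μ := by
  have hb2 := memLp_of_condExp_ae_eq hZ hbZ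
  have hYm := stronglyMeasurable_weightDeriv_smul (A := A) hb
  have hY := (hYm.mono hm).aestronglyMeasurable (μ := μ)
  have hYb : ∀ ω, ‖(2 * weightDeriv A (‖b ω‖ ^ 2)) • b ω‖ ≤ 2 * ‖b ω‖ := fun ω =>
    norm_weightDeriv_smul_le hA _
  have hi1 := integrable_inner_of_norm_le hY hb2 hYb hZ
  have hi2 := integrable_inner_of_norm_le hY hb2 hYb hb2
  have h0 : ∫ ω, inner ℝ ((2 * weightDeriv A (‖b ω‖ ^ 2)) • b ω) (Z ω) ∂μ =
      ∫ ω, inner ℝ ((2 * weightDeriv A (‖b ω‖ ^ 2)) • b ω) (b ω) ∂μ :=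
    integral_bilin_condExp hm (innerSL ℝ) hYm (hZ.integrable (by norm_num)) hbZ hi1
  have hw1 := integrable_weight hA hZ
  have hw2 := integrable_weight hA hb2
  simp only [bregman_eq_sub_inner]
  refine (integral_sub (hw1.sub hw2) (hi1.sub hi2)).trans ?_
  rw [integral_sub' hi1 hi2, h0, sub_self, sub_zero]
  exact integral_sub hw1 hw2

/-! #### The parametrized Jensen inequality -/

variable {F : E d × E d → ℝ} {C : ℝ} {X : Ω → E d} {ζ : Ω → ℝ} {M : ℝ}

lemma integrable_growth (hF : Continuous F)
    (hFC : ∀ x v, |F (x, v)| ≤ C * (1 + ‖v‖ ^ 2))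
    (hX : AEStronglyMeasurable X μ) (hZ : MemLp Z 2 μ) : Integrable (fun ω => F (X ω, Z ω)) μ :=
  (((integrable_const 1).add (hZ.integrable_norm_pow (by norm_num))).const_mul C).mono'
    (hF.comp_aestronglyMeasurable (hX.prodMk hZ.1)) (Eventually.of_forall fun ω => hFC _ _)

/-- Conditional Jensen for a fixed `f`; the `m`-measurable weight passes inside the conditional
expectation. -/
lemma integral_mul_convex_sub_nonneg (hm : m ≤ mΩ) {f : E d → ℝ} (hf : ConvexOn ℝ univ f)
    (hfC : ∀ v, |f v| ≤ C * (1 + ‖v‖ ^ 2)) (hZ : MemLp Z 2 μ)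
    (hbZ : μ[Z | m] =ᵐ[μ] b)
    (hζ : StronglyMeasurable[m] ζ) (hζ0 : ∀ ω, 0 ≤ ζ ω) (hζM : ∀ ω, ‖ζ ω‖ ≤ M) :
    0 ≤ ∫ ω, ζ ω * (f (Z ω) - f (b ω)) ∂μ := by
  have hfc : Continuous f := continuousOn_univ.1 (hf.continuousOn isOpen_univ)
  have hb2 := memLp_of_condExp_ae_eq hZ hbZ
  have hiZ : Integrable (fun ω => f (Z ω)) μ :=
    integrable_growth (F := fun p => f p.2) (X := 0) (hfc.comp continuous_snd)
      (fun x v => hfC v) aestronglyMeasurable_zero hZ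
  have hib : Integrable (fun ω => f (b ω)) μ :=
    integrable_growth (F := fun p => f p.2) (X := 0) (hfc.comp continuous_snd)
      (fun x v => hfC v) aestronglyMeasurable_zero hb2
  have hζ' := (hζ.mono hm).aestronglyMeasurable (μ := μ)
  have hζi : ∀ {g : Ω → ℝ}, Integrable g μ → Integrable (fun ω => ζ ω * g ω) μ := fun hg =>
    hg.bdd_mul hζ' (Eventually.of_forall hζM)
  simp only [mul_sub]
  rw [integral_sub (hζi hiZ) (hζi hib), sub_nonneg]
  have h1 : ∫ ω, ζ ω * f (Z ω) ∂μ = ∫ ω, ζ ω * (μ[fun ω => f (Z ω) | m]) ω ∂μ :=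
    integral_bilin_condExp hm (ContinuousLinearMap.mul ℝ ℝ) hζ hiZ ae_eq_rfl (hζi hiZ)
  rw [h1]
  refine integral_mono_ae (hζi hib) (hζi integrable_condExp) ?_
  filter_upwards [hbZ, hf.map_condExp_le_of_finiteDimensional hm (hZ.integrable (by norm_num)) hiZ]
    with ω h2 h3
  refine mul_le_mul_of_nonneg_left ?_ (hζ0 ω)
  rw [← h2]
  exact h3

/-- The conditional Jensen inequality for a convex function that depends on a measurable
parameter. -/
lemma integral_mul_param_convex_sub_nonneg (hm : m ≤ mΩ) (hF : Continuous F)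
    (hconv : ∀ x, ConvexOn ℝ univ fun v => F (x, v))
    (hFC : ∀ x v, |F (x, v)| ≤ C * (1 + ‖v‖ ^ 2)) (hX : StronglyMeasurable[m] X)
    (hZ : MemLp Z 2 μ) (hbZ : μ[Z | m] =ᵐ[μ] b)
    (hζ : StronglyMeasurable[m] ζ) (hζ0 : ∀ ω, 0 ≤ ζ ω) (hζM : ∀ ω, ‖ζ ω‖ ≤ M) :
    0 ≤ ∫ ω, ζ ω * (F (X ω, Z ω) - F (X ω, b ω)) ∂μ := by
  have hb2 := memLp_of_condExp_ae_eq hZ hbZ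
  have hζ' := (hζ.mono hm).aestronglyMeasurable (μ := μ)
  have hint : ∀ {X : Ω → E d} {ζ : Ω → ℝ} {M : ℝ}, AEStronglyMeasurable X μ →
      AEStronglyMeasurable ζ μ → (∀ ω, ‖ζ ω‖ ≤ M) →
      Integrable (fun ω => ζ ω * (F (X ω, Z ω) - F (X ω, b ω))) μ := fun hX hζ hM =>
    ((integrable_growth hF hFC hX hZ).sub (integrable_growth hF hFC hX hb2)).bdd_mul hζ
      (Eventually.of_forall hM)
  -- For finitely many parameter values, the fixed-function inequality is applied on each level set,
  -- whose indicator is absorbed in the weight.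
  have hsimple : ∀ Y : Ω → E d, StronglyMeasurable[m] Y → (range Y).Finite →
      0 ≤ ∫ ω, ζ ω * (F (Y ω, Z ω) - F (Y ω, b ω)) ∂μ := by
    intro Y hYm hYf
    have e : ∀ ω, ζ ω * (F (Y ω, Z ω) - F (Y ω, b ω)) =
        ∑ x ∈ hYf.toFinset, (Y ⁻¹' {x}).indicator ζ ω * (F (x, Z ω) - F (x, b ω)) := by
      intro ω
      rw [Finset.sum_eq_single (Y ω)]
      · rw [indicator_of_mem (by simp)]
      · intro x _ hx
        rw [indicator_of_notMem (by simpa using hx.symm), zero_mul]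
      · intro h
        exact absurd (hYf.mem_toFinset.2 (mem_range_self ω)) h
    have hind : ∀ x, StronglyMeasurable[m] ((Y ⁻¹' {x}).indicator ζ) := fun x =>
      hζ.indicator (hYm.measurable (measurableSet_singleton x))
    have hle : ∀ x ω, ‖(Y ⁻¹' {x}).indicator ζ ω‖ ≤ M := fun x ω =>
      (norm_indicator_le_norm_self _ _).trans (hζM ω)
    simp only [e]
    rw [integral_finsetSum _ fun x _ => hint (X := fun _ => x) aestronglyMeasurable_const
      ((hind x).mono hm).aestronglyMeasurable (hle x)]
    exact Finset.sum_nonneg fun x _ => integral_mul_convex_sub_nonneg hm (hconv x) (hFC x) hZ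
      hbZ (hind x) (fun ω => indicator_nonneg (fun ω _ => hζ0 ω) ω) (hle x)
  -- A general parameter is a pointwise limit of finitely valued ones; quadratic growth uniform in
  -- `x` dominates.
  obtain ⟨Xn, hsm, hfin, hXn⟩ := exists_tendsto_of_stronglyMeasurable hX
  have hlim : Tendsto (fun n => ∫ ω, ζ ω * (F (Xn n ω, Z ω) - F (Xn n ω, b ω)) ∂μ)
      atTop (𝓝 (∫ ω, ζ ω * (F (X ω, Z ω) - F (X ω, b ω)) ∂μ)) := by
    have hd : Integrable (fun ω => M * (C * (1 + ‖Z ω‖ ^ 2) + C * (1 + ‖b ω‖ ^ 2))) μ :=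
      ((((integrable_const 1).add (hZ.integrable_norm_pow (by norm_num))).const_mul C).add
        (((integrable_const 1).add (hb2.integrable_norm_pow (by norm_num))).const_mul C)).const_mul M
    refine tendsto_integral_of_dominated_convergence _ (fun n => (hint ?_ hζ' hζM).1) hd
      (fun n => Eventually.of_forall fun ω => ?_) (Eventually.of_forall fun ω => ?_)
    · exact ((hsm n).mono hm).aestronglyMeasurable
    · rw [norm_mul]
      have hM0 := (norm_nonneg _).trans (hζM ω)
      exact mul_le_mul (hζM ω) ((norm_sub_le _ _).trans (add_le_add (hFC _ _) (hFC _ _)))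
        (norm_nonneg _) hM0
    · have h1 := hXn ω
      have h2 : ∀ z, Tendsto (fun n => F (Xn n ω, z)) atTop (𝓝 (F (X ω, z))) := fun z =>
        (hF.tendsto _).comp (h1.prodMk_nhds tendsto_const_nhds)
      exact ((h2 _).sub (h2 _)).const_mul _
  exact ge_of_tendsto' hlim fun n => hsimple _ (hsm n) (hfin n)

/-! #### Increments of truncated functions -/

/-- The increment of `χ F` is `χ(b)` times that of `F`, plus `F(b) Dχ(b)(Z - b)`, plus
`truncationError`. The middle term has zero mean, and the last is paid for by the Bregman
divergence. -/
lemma norm_integral_truncated_increment_sub_le (hm : m ≤ mΩ) (hF : Continuous F)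
    (hC0 : 0 ≤ C) (hFC : ∀ x v, |F (x, v)| ≤ C * (1 + ‖v‖ ^ 2)) (hX : StronglyMeasurable[m] X)
    (hZ : MemLp Z 2 μ) (hb : StronglyMeasurable[m] b) (hbZ : μ[Z | m] =ᵐ[μ] b)
    {χ : E d → ℝ} (hχ : ContDiff ℝ 2 χ) (hχc : HasCompactSupport χ) {A K : ℝ} (hA : 0 < A)
    (hK : ∀ x b b', |truncationError χ (fun v => F (x, v)) b b'| ≤ K * bregman A b b') :
    |∫ ω, (χ (Z ω) * F (X ω, Z ω) - χ (b ω) * F (X ω, b ω)) ∂μ -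
      ∫ ω, χ (b ω) * (F (X ω, Z ω) - F (X ω, b ω)) ∂μ| ≤
      K * (∫ ω, weight A (‖Z ω‖ ^ 2) ∂μ - ∫ ω, weight A (‖b ω‖ ^ 2) ∂μ) := by
  have hb2 := memLp_of_condExp_ae_eq hZ hbZ
  have hXm := (hX.mono hm).aestronglyMeasurable (μ := μ)
  obtain ⟨M, hM⟩ := hχc.exists_bound_of_continuous hχ.continuous
  have hdc : Continuous (fderiv ℝ χ) := hχ.continuous_fderiv (by norm_num)
  -- The compact support of `Dχ` absorbs the quadratic growth, so the coefficient of the linear term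
  -- is bounded.
  obtain ⟨M', hM'⟩ := ((hχc.fderiv ℝ).smul_left (f := fun v : E d => 1 + ‖v‖ ^ 2)
    ).exists_bound_of_continuous ((by fun_prop : Continuous fun v : E d => 1 + ‖v‖ ^ 2).smul hdc)
  have hY : StronglyMeasurable[m] fun ω => F (X ω, b ω) • fderiv ℝ χ (b ω) :=
    (hF.comp_stronglyMeasurable (hX.prodMk hb)).smul (hdc.comp_stronglyMeasurable hb)
  have hYM : ∀ ω, ‖F (X ω, b ω) • fderiv ℝ χ (b ω)‖ ≤ C * M' := fun ω => by
    have h1 := hM' (b ω)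
    simp only [Pi.smul_apply'] at h1
    rw [norm_smul, Real.norm_of_nonneg (by positivity)] at h1
    rw [norm_smul]
    calc _ ≤ C * (1 + ‖b ω‖ ^ 2) * ‖fderiv ℝ χ (b ω)‖ := by gcongr; exact hFC _ _
      _ = C * ((1 + ‖b ω‖ ^ 2) * ‖fderiv ℝ χ (b ω)‖) := by ring
      _ ≤ _ := by gcongr
  have hYi : ∀ {U : Ω → E d}, MemLp U 2 μ →
      Integrable (fun ω => (F (X ω, b ω) • fderiv ℝ χ (b ω)) (U ω)) μ := fun {U} hU => by
    refine ((hU.integrable (by norm_num)).norm.const_mul (C * M')).mono' ?_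
      (Eventually.of_forall fun ω => ContinuousLinearMap.le_of_opNorm_le _ (hYM ω) _)
    exact ((ContinuousLinearMap.id ℝ (E d →L[ℝ] ℝ)).aestronglyMeasurable_comp₂
      (hY.mono hm).aestronglyMeasurable hU.1)
  have hzero : ∫ ω, (F (X ω, b ω) • fderiv ℝ χ (b ω)) (Z ω - b ω) ∂μ = 0 := by
    simp only [map_sub]
    rw [integral_sub (hYi hZ) (hYi hb2), sub_eq_zero]
    exact integral_bilin_condExp hm (ContinuousLinearMap.id ℝ (E d →L[ℝ] ℝ)) hY
      (hZ.integrable (by norm_num)) hbZ (hYi hZ)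
  have hiZ := integrable_growth hF hFC hXm hZ
  have hib := integrable_growth hF hFC hXm hb2
  have hbdd : ∀ {U : Ω → E d} {g : Ω → ℝ}, MemLp U 2 μ → Integrable g μ →
      Integrable (fun ω => χ (U ω) * g ω) μ := fun hU hg =>
    hg.bdd_mul (hχ.continuous.comp_aestronglyMeasurable hU.1) (Eventually.of_forall fun ω => hM _)
  have hi1 := (hbdd hZ hiZ).sub (hbdd hb2 hib)
  have hi2 := hbdd hb2 (hiZ.sub hib)
  have hi3 := hYi (hZ.sub hb2)
  have e : ∫ ω, (χ (Z ω) * F (X ω, Z ω) - χ (b ω) * F (X ω, b ω)) ∂μ -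
      ∫ ω, χ (b ω) * (F (X ω, Z ω) - F (X ω, b ω)) ∂μ =
      ∫ ω, truncationError χ (fun v => F (X ω, v)) (b ω) (Z ω) ∂μ := by
    rw [← sub_zero (∫ ω, (χ (Z ω) * F (X ω, Z ω) - χ (b ω) * F (X ω, b ω)) ∂μ -
      ∫ ω, χ (b ω) * (F (X ω, Z ω) - F (X ω, b ω)) ∂μ), ← hzero]
    refine (congrArg₂ _ (integral_sub hi1 hi2).symm rfl).trans ((integral_sub (hi1.sub hi2)
      hi3).symm.trans ?_)
    refine integral_congr_ae (Eventually.of_forall fun ω => ?_)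
    simp only [truncationError, Pi.sub_apply, _root_.smul_apply, smul_eq_mul]
    ring
  rw [e, ← integral_bregman hm hA hZ hb hbZ, ← integral_const_mul, ← Real.norm_eq_abs]
  exact norm_integral_le_of_norm_le ((integrable_bregman hm hA hZ hb hbZ).const_mul K)
    (Eventually.of_forall fun ω => hK _ _ _)

end CondExp

/-! ### The action of the defect distribution on convex test functions -/

/-- The sequences are nondecreasing and mutually cofinal up to the errors `e`. The supremum of `a i
n - e i n` for a single `i`, finite or infinite, is the limit of all of them. -/
lemma exists_common_limit {ι : Type*} (a e : ι → ℕ → ℝ) (he : ∀ i, Tendsto (e i) atTop (𝓝 0))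
    (h0 : ∀ i n, -e i n ≤ a i n)
    (h : ∀ i j n, ∀ᶠ m in atTop, a i n ≤ a j m + e i n + e j m) :
    ∃ L : ℝ≥0∞, ∀ i, Tendsto (fun n => (a i n : EReal)) atTop (𝓝 (L : EReal)) := by
  rcases isEmpty_or_nonempty ι with hι | ⟨⟨i⟩⟩
  · exact ⟨0, fun i => isEmptyElim i⟩
  have hlow : ∀ j n c, c < a i n - e i n → ∀ᶠ m in atTop, c < a j m := fun j n c hc => by
    filter_upwards [h i j n, (he j).eventually_lt_const (sub_pos.2 hc)] with m h1 h2
    linarith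
  by_cases hb : BddAbove (range fun n => a i n - e i n)
  · set S := ⨆ n, (a i n - e i n) with hS
    have hle : ∀ n, a i n - e i n ≤ S := fun n => le_ciSup hb n
    have hS0 : 0 ≤ S := by
      have : Tendsto (fun n => -e i n - e i n) atTop (𝓝 0) := by simpa using (he i).neg.sub (he i)
      exact le_of_tendsto' this fun n => by linarith [hle n, h0 i n]
    refine ⟨ENNReal.ofReal S, fun j => ?_⟩
    rw [EReal.coe_ennreal_ofReal, max_eq_left hS0]
    refine (continuous_coe_real_ereal.tendsto S).comp (tendsto_order.2 ⟨fun c hc => ?_,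
      fun c hc => ?_⟩)
    · obtain ⟨n, hn⟩ := exists_lt_of_lt_ciSup hc
      exact hlow j n c hn
    · have hup : ∀ m, a j m ≤ S + e j m := fun m => by
        have : Tendsto (fun p => S + 2 * e i p + e j m) atTop (𝓝 (S + 2 * 0 + e j m)) :=
          (((he i).const_mul 2).const_add S).add_const _
        rw [mul_zero, add_zero] at this
        refine ge_of_tendsto this ?_
        filter_upwards [h j i m] with p hp
        linarith [hle p]
      filter_upwards [(he j).eventually_lt_const (sub_pos.2 hc)] with m hm
      linarith [hup m]
  · refine ⟨⊤, fun j => ?_⟩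
    rw [EReal.coe_ennreal_top, EReal.tendsto_nhds_top_iff_real]
    intro c
    obtain ⟨_, ⟨n, rfl⟩, hn⟩ := not_bddAbove_iff.1 hb c
    exact (hlow j n c hn).mono fun m hm => EReal.coe_lt_coe_iff.2 hm

namespace MartingaleFlow

variable {Ω : Type*} {mΩ : MeasurableSpace Ω} {d : ℕ} {T : ℝ} {η : Measure Ω}
  {ℱ : ℝ → MeasurableSpace Ω} {W : Ω → E d} {X : ℝ → Ω → E d} {Ψ : Phase d → ℝ}

/-- The mean of `weight A (‖V t‖²)`. -/
def weightEnergy (η : Measure Ω) (ℱ : ℝ → MeasurableSpace Ω) (W : Ω → E d) (A t : ℝ) : ℝ :=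
  ∫ ω, weight A (‖η[W | ℱ t] ω‖ ^ 2) ∂η

lemma condExp_vel (h : MartingaleFlow T η ℱ W X) [IsProbabilityMeasure η] {s t : ℝ} (hst : s ≤ t) :
    η[η[W | ℱ s] | ℱ t] =ᵐ[η] η[W | ℱ t] :=
  condExp_condExp_of_le (h.anti hst) (h.le s)

lemma weightEnergy_nonneg {A : ℝ} (hA : 0 < A) (t : ℝ) : 0 ≤ weightEnergy η ℱ W A t :=
  integral_nonneg fun _ => weight_nonneg hA (by positivity)

/-- Square integrability of `W` makes the truncation errors vanish: the weight is at most `‖W‖²` and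
tends to `0` pointwise as its parameter grows. -/
lemma tendsto_integral_weight (h : MartingaleFlow T η ℱ W X) {r : ℝ} (hr : 0 < r) :
    Tendsto (fun n : ℕ => ∫ ω, weight ((((n : ℝ) + 1) * r) ^ 2 / 4) (‖W ω‖ ^ 2) ∂η) atTop (𝓝 0) := by
  have hA : ∀ n : ℕ, 0 < (((n : ℝ) + 1) * r) ^ 2 / 4 := fun n => by positivity
  have h0 : ∫ _ω, (0 : ℝ) ∂η = 0 := integral_zero _ _
  rw [← h0]
  refine tendsto_integral_of_dominated_convergence (fun ω => ‖W ω‖ ^ 2)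
    (fun n => (integrable_weight (hA n) h.memLp).1) (h.memLp.integrable_norm_pow (by norm_num))
    (fun n => Eventually.of_forall fun ω => ?_) (Eventually.of_forall fun ω => ?_)
  · rw [Real.norm_of_nonneg (weight_nonneg (hA n) (by positivity))]
    exact weight_le (hA n) (by positivity)
  · have h1 : Tendsto (fun n : ℕ => ((n : ℝ) + 1) * r) atTop atTop :=
      (tendsto_atTop_add_const_right _ _ tendsto_natCast_atTop_atTop).atTop_mul_const hr
    have h2 : Tendsto (fun n : ℕ => (((n : ℝ) + 1) * r) ^ 2 / 4 + ‖W ω‖ ^ 2) atTop atTop :=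
      tendsto_atTop_add_const_right _ _
        (((tendsto_pow_atTop (by norm_num)).comp h1).atTop_div_const (by norm_num))
    exact tendsto_const_nhds.div_atTop h2

variable [IsProbabilityMeasure η]

lemma weightEnergy_le (h : MartingaleFlow T η ℱ W X) {A : ℝ} (hA : 0 < A) (t : ℝ) :
    weightEnergy η ℱ W A t ≤ ∫ ω, weight A (‖W ω‖ ^ 2) ∂η := by
  have := integral_bregman (h.le t) hA h.memLp stronglyMeasurable_condExp ae_eq_rfl
  rw [weightEnergy, ← sub_nonneg, ← this]
  exact integral_nonneg fun _ => bregman_nonneg hA _ _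

/-- The decrease is the mean of a Bregman divergence. Hence truncation errors, once integrated in
time, telescope like the kinetic energy. -/
lemma weightEnergy_antitone (h : MartingaleFlow T η ℱ W X) {A : ℝ} (hA : 0 < A) :
    Antitone (weightEnergy η ℱ W A) := fun s t hst => by
  have := integral_bregman (h.le t) hA (h.memLp_vel s) stronglyMeasurable_condExp (h.condExp_vel hst)
  rw [weightEnergy, weightEnergy, ← sub_nonneg, ← this]
  exact integral_nonneg fun _ => bregman_nonneg hA _ _

/-- The mean increment of `Φ` due to the change of velocity between `t + δ` and `t`. -/
def velocityIncrement (η : Measure Ω) (ℱ : ℝ → MeasurableSpace Ω) (W : Ω → E d) (X : ℝ → Ω → E d)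
    (Φ : Phase d → ℝ) (δ t : ℝ) : ℝ :=
  ∫ ω, (Φ (t + δ, X (t + δ) ω, η[W | ℱ t] ω) - Φ (t + δ, X (t + δ) ω, η[W | ℱ (t + δ)] ω)) ∂η

/-- Up to truncation errors, the two increments differ by the Jensen gap of `Ψ` weighted by `ξ' - ξ
≥ 0` at the later velocity, which has a sign. -/
lemma increment_sub_le (h : MartingaleFlow T η ℱ W X) (hΨ : IsConvexTest T Ψ) {ξ ξ' : E d → ℝ}
    (hξ : ContDiff ℝ 2 ξ) (hξc : HasCompactSupport ξ) (hξ' : ContDiff ℝ 2 ξ')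
    (hξc' : HasCompactSupport ξ') (hle : ∀ v, ξ v ≤ ξ' v) {A A' K K' : ℝ} (hA : 0 < A) (hA' : 0 < A')
    (hK : ∀ t x b b', |truncationError ξ (fun v => Ψ (t, x, v)) b b'| ≤ K * bregman A b b')
    (hK' : ∀ t x b b', |truncationError ξ' (fun v => Ψ (t, x, v)) b b'| ≤ K' * bregman A' b b')
    {δ : ℝ} (hδ : 0 ≤ δ) (t : ℝ) :
    velocityIncrement η ℱ W X (fun z => ξ z.2.2 * Ψ z) δ t -
      velocityIncrement η ℱ W X (fun z => ξ' z.2.2 * Ψ z) δ t ≤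
      K * (weightEnergy η ℱ W A t - weightEnergy η ℱ W A (t + δ)) +
      K' * (weightEnergy η ℱ W A' t - weightEnergy η ℱ W A' (t + δ)) := by
  obtain ⟨C, hC0, hC⟩ := hΨ.abs_le_growth
  have ht : t ≤ t + δ := by linarith
  have hF : Continuous fun p : E d × E d => Ψ (t + δ, p.1, p.2) := hΨ.continuous.comp (by fun_prop)
  have hZ := h.memLp_vel t
  have hbZ := h.condExp_vel ht
  have hb2 := h.memLp_vel (t + δ)
  have hb : StronglyMeasurable[ℱ (t + δ)] (η[W | ℱ (t + δ)]) := stronglyMeasurable_condExp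
  have h1 := norm_integral_truncated_increment_sub_le (h.le (t + δ)) hF hC0 (fun x v => hC _ x v)
    (h.meas (t + δ)) hZ hb hbZ hξ hξc hA (fun x b b' => hK _ x b b')
  have h2 := norm_integral_truncated_increment_sub_le (h.le (t + δ)) hF hC0 (fun x v => hC _ x v)
    (h.meas (t + δ)) hZ hb hbZ hξ' hξc' hA' (fun x b b' => hK' _ x b b')
  obtain ⟨M, hM⟩ := hξc.exists_bound_of_continuous hξ.continuous
  obtain ⟨M', hM'⟩ := hξc'.exists_bound_of_continuous hξ'.continuous
  have h3 := integral_mul_param_convex_sub_nonneg (h.le (t + δ)) hF (fun x => hΨ.convex _ x)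
    (fun x v => hC _ x v) (h.meas (t + δ)) hZ hbZ
    (ζ := fun ω => ξ' (η[W | ℱ (t + δ)] ω) - ξ (η[W | ℱ (t + δ)] ω))
    ((hξ'.continuous.comp_stronglyMeasurable hb).sub (hξ.continuous.comp_stronglyMeasurable hb))
    (fun ω => sub_nonneg.2 (hle _)) (M := M' + M)
    (fun ω => (norm_sub_le _ _).trans (add_le_add (hM' _) (hM _)))
  have hD := (integrable_growth hF (fun x v => hC _ x v) (h.aesm_pos (t + δ)) hZ).sub
    (integrable_growth hF (fun x v => hC _ x v) (h.aesm_pos (t + δ)) hb2)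
  have hi := hD.bdd_mul (hξ.continuous.comp_aestronglyMeasurable hb2.1)
    (Eventually.of_forall fun ω => hM _)
  have hi' := hD.bdd_mul (hξ'.continuous.comp_aestronglyMeasurable hb2.1)
    (Eventually.of_forall fun ω => hM' _)
  simp only [sub_mul] at h3
  simp only [Pi.sub_apply] at hi hi'
  rw [integral_sub hi' hi] at h3
  have h1' := (abs_le.1 h1).2
  have h2' := (abs_le.1 h2).1
  unfold velocityIncrement weightEnergy
  linarith

lemma integrable_increment (h : MartingaleFlow T η ℱ W X) {Φ : Phase d → ℝ} (hΦ : IsFlowTest T Φ)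
    (δ : ℝ) : Integrable (velocityIncrement η ℱ W X Φ δ) := by
  obtain ⟨C, hC⟩ := hΦ.bound
  obtain ⟨a, b, ha, hb, hab⟩ := hΦ.support
  have := h.integrable_expectation (Y := fun _ _ => (1 : ℝ))
    (g := fun z => Φ (z.1, z.2.1, z.2.2.2) - Φ (z.1, z.2.1, z.2.2.1))
    ((hΦ.continuous.comp (by fun_prop)).sub (hΦ.continuous.comp (by fun_prop))) (C := C + C)
    (fun z => (norm_sub_le _ _).trans (add_le_add (hC _) (hC _)))
    ⟨a, b, ha, hb, fun t ht y => by simp [hab t ht]⟩ (fun _ => memLp_const 1) (M := 1)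
    (fun t => by simp [lpNorm_const' (E := ℝ) (μ := η) (p := 2) (by norm_num) (by norm_num) 1])
    countable_empty (fun t _ => by simp) δ
  unfold velocityIncrement
  simpa using this

/-- The actions of two truncations of a convex test function are comparable. -/
lemma integral_transport_truncation_le (h : MartingaleFlow T η ℱ W X) (hT : 0 < T)
    (hΨ : IsConvexTest T Ψ) {ξ ξ' : E d → ℝ}
    (hξ : ContDiff ℝ 2 ξ) (hξc : HasCompactSupport ξ) (hξ' : ContDiff ℝ 2 ξ')
    (hξc' : HasCompactSupport ξ') (hle : ∀ v, ξ v ≤ ξ' v)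
    (hf : IsFlowTest T fun z => ξ z.2.2 * Ψ z) (hf' : IsFlowTest T fun z => ξ' z.2.2 * Ψ z)
    {A A' K K' : ℝ} (hA : 0 < A) (hA' : 0 < A') (hK0 : 0 ≤ K) (hK0' : 0 ≤ K')
    (hK : ∀ t x b b', |truncationError ξ (fun v => Ψ (t, x, v)) b b'| ≤ K * bregman A b b')
    (hK' : ∀ t x b b', |truncationError ξ' (fun v => Ψ (t, x, v)) b b'| ≤ K' * bregman A' b b') :
    ∫ t in Ioo (-1) T, ∫ ω, transport (fun z => ξ z.2.2 * Ψ z) (t, X t ω, η[W | ℱ t] ω) ∂η ≤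
      (∫ t in Ioo (-1) T, ∫ ω, transport (fun z => ξ' z.2.2 * Ψ z) (t, X t ω, η[W | ℱ t] ω) ∂η) +
      K * ∫ ω, weight A (‖W ω‖ ^ 2) ∂η + K' * ∫ ω, weight A' (‖W ω‖ ^ 2) ∂η := by
  have hl := (h.tendsto_kinetic hf).sub (h.tendsto_kinetic hf')
  rw [add_assoc, ← sub_le_iff_le_add']
  refine le_of_tendsto hl ?_
  obtain ⟨a, b, ha, hb, hab⟩ := hf.support
  obtain ⟨a', b', ha', hb', hab'⟩ := hf'.support
  have e1 : ∀ᶠ δ : ℝ in 𝓝[>] 0, δ < a + 1 := nhdsWithin_le_nhds (Iio_mem_nhds (by linarith))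
  have e2 : ∀ᶠ δ : ℝ in 𝓝[>] 0, δ < a' + 1 := nhdsWithin_le_nhds (Iio_mem_nhds (by linarith))
  filter_upwards [self_mem_nhdsWithin, e1, e2] with δ h0 e1 e2
  have hδ : (0 : ℝ) < δ := h0
  have hset : ∀ t ∉ Ioo (-1) T, velocityIncrement η ℱ W X (fun z => ξ z.2.2 * Ψ z) δ t -
      velocityIncrement η ℱ W X (fun z => ξ' z.2.2 * Ψ z) δ t = 0 := by
    intro t ht
    have i1 : t + δ ∉ Icc a b := fun hc => ht ⟨by linarith [hc.1], by linarith [hc.2]⟩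
    have i2 : t + δ ∉ Icc a' b' := fun hc => ht ⟨by linarith [hc.1], by linarith [hc.2]⟩
    have j1 := hab _ i1
    have j2 := hab' _ i2
    simp only at j1 j2
    simp [velocityIncrement, j1, j2]
  have hint : ∀ {A : ℝ}, 0 < A → IntegrableOn
      (fun t => weightEnergy η ℱ W A t - weightEnergy η ℱ W A (t + δ)) (Ioo (-1) T) := by
    intro A hA
    have hant := h.weightEnergy_antitone hA
    have hi1 : IntervalIntegrable (weightEnergy η ℱ W A) volume (-1) T := hant.intervalIntegrable
    have hi2 : IntervalIntegrable (fun t => weightEnergy η ℱ W A (t + δ)) volume (-1) T :=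
      (hant.comp_monotone fun _ _ h => add_le_add_left h δ :
        Antitone fun t => weightEnergy η ℱ W A (t + δ)).intervalIntegrable
    exact ((intervalIntegrable_iff_integrableOn_Ioo_of_le (by linarith)).1 (hi1.sub hi2))
  have hle2 : ∀ {A : ℝ}, 0 < A →
      ∫ t in Ioo (-1) T, (weightEnergy η ℱ W A t - weightEnergy η ℱ W A (t + δ)) ≤
        δ * ∫ ω, weight A (‖W ω‖ ^ 2) ∂η := fun hA =>
    integral_antitone_sub_le (h.weightEnergy_antitone hA) (fun t => weightEnergy_nonneg hA t)
      (h.weightEnergy_le hA) (by linarith) hδ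
  have hi := h.integrable_increment hf δ
  have hi' := h.integrable_increment hf' δ
  have key : ∫ t, (velocityIncrement η ℱ W X (fun z => ξ z.2.2 * Ψ z) δ t -
      velocityIncrement η ℱ W X (fun z => ξ' z.2.2 * Ψ z) δ t) ≤
      δ * (K * ∫ ω, weight A (‖W ω‖ ^ 2) ∂η + K' * ∫ ω, weight A' (‖W ω‖ ^ 2) ∂η) := by
    rw [← setIntegral_eq_integral_of_forall_compl_eq_zero hset]
    refine (integral_mono (hi.sub hi').integrableOn (((hint hA).const_mul K).add
      ((hint hA').const_mul K')) fun t => h.increment_sub_le hΨ hξ hξc hξ' hξc' hle hA hA' hK hK'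
        hδ.le t).trans ?_
    refine (integral_add ((hint hA).const_mul K) ((hint hA').const_mul K')).trans_le ?_
    rw [integral_const_mul, integral_const_mul]
    nlinarith [mul_le_mul_of_nonneg_left (hle2 hA) hK0, mul_le_mul_of_nonneg_left (hle2 hA') hK0']
  rw [integral_sub hi hi'] at key
  change δ⁻¹ * (∫ t, velocityIncrement η ℱ W X (fun z => ξ z.2.2 * Ψ z) δ t) -
    δ⁻¹ * (∫ t, velocityIncrement η ℱ W X (fun z => ξ' z.2.2 * Ψ z) δ t) ≤ _
  rw [← mul_sub, inv_mul_le_iff₀ hδ]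
  exact key

theorem exists_tendsto_truncate (h : MartingaleFlow T η ℱ W X) (hT : 0 < T)
    (hΨ : IsConvexTest T Ψ) : ∃ L : ℝ≥0∞, ∀ χ : 𝓓^{2}((⊤ : Opens (E d)), ℝ), IsCutoff χ →
      Tendsto (fun n : ℕ => ((∫ t in Ioo (-1) T,
        ∫ ω, transport (truncate χ n Ψ) (t, X t ω, η[W | ℱ t] ω) ∂η : ℝ) : EReal)) atTop
        (𝓝 (L : EReal)) := by
  obtain ⟨C, hC0, hC⟩ := hΨ.abs_le_growth
  have hr : ∀ χ : {χ : 𝓓^{2}((⊤ : Opens (E d)), ℝ) // IsCutoff χ},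
      ∃ r : ℝ, 0 < r ∧ ∀ v, ‖v‖ < r → χ.1 v = 1 := fun χ => by
    obtain ⟨r, hr0, hr⟩ := Metric.eventually_nhds_iff.1 χ.2.eq_one
    exact ⟨r, hr0, fun v hv => hr (by simpa using hv)⟩
  choose r hr0 hr using hr
  have hK : ∀ χ : {χ : 𝓓^{2}((⊤ : Opens (E d)), ℝ) // IsCutoff χ}, ∃ K, 0 ≤ K ∧ ∀ n : ℕ, ∀ t x b b',
      |truncationError (fun v => χ.1 (((n : ℝ) + 1)⁻¹ • v)) (fun v => Ψ (t, x, v)) b b'| ≤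
        K * bregman ((((n : ℝ) + 1) * r χ) ^ 2 / 4) b b' := fun χ => by
    obtain ⟨K, hK0, hK⟩ := truncationError_scaled_bound χ.1.contDiff χ.1.hasCompactSupport (hr0 χ)
      (fun v hv => by rw [hr χ v hv, hr χ 0 (by simpa using hr0 χ)]) hC0
    exact ⟨K, hK0, fun n t x b b' => hK _ (by simp) _ (hΨ.convex t x) (hC t x) b b'⟩
  choose K hK0 hK using hK
  have hA : ∀ χ, ∀ n : ℕ, 0 < (((n : ℝ) + 1) * r χ) ^ 2 / 4 := fun χ n => by
    have := hr0 χ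
    positivity
  have hsm : ∀ χ : 𝓓^{2}((⊤ : Opens (E d)), ℝ), ∀ n : ℕ,
      ContDiff ℝ 2 fun v => χ (((n : ℝ) + 1)⁻¹ • v) := fun χ n => by
    have hχ : ContDiff ℝ 2 χ := χ.contDiff
    exact hχ.comp (contDiff_id.const_smul _)
  have hcs : ∀ χ : 𝓓^{2}((⊤ : Opens (E d)), ℝ), ∀ n : ℕ,
      HasCompactSupport fun v => χ (((n : ℝ) + 1)⁻¹ • v) := fun χ n =>
    χ.hasCompactSupport.comp_smul (by positivity)
  have key := exists_common_limit
    (fun (χ : {χ : 𝓓^{2}((⊤ : Opens (E d)), ℝ) // IsCutoff χ}) n => ∫ t in Ioo (-1) T,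
        ∫ ω, transport (truncate χ.1 n Ψ) (t, X t ω, η[W | ℱ t] ω) ∂η)
    (fun χ n => K χ * ∫ ω, weight ((((n : ℝ) + 1) * r χ) ^ 2 / 4) (‖W ω‖ ^ 2) ∂η)
    (fun χ => by simpa using (h.tendsto_integral_weight (hr0 χ)).const_mul (K χ))
  suffices hs : _ ∧ _ from (key hs.1 hs.2).imp fun L hL χ hχ => hL ⟨χ, hχ⟩
  refine ⟨fun χ n => ?_, fun χ χ' n => ?_⟩
  -- Near nonnegativity is the comparison with the zero cutoff, whose truncation error vanishes.
  · have h0 : IsFlowTest T fun z : Phase d => (0 : ℝ) * Ψ z := by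
      simp only [zero_mul]
      exact ⟨continuous_const, fun v => differentiable_const _, ⟨0, fun z => by simp⟩,
        ⟨0, fun v p => by simp⟩, ⟨0, 0, by norm_num, hT, fun t _ x v => rfl⟩⟩
    have := h.integral_transport_truncation_le hT hΨ (ξ := fun _ => 0) contDiff_const
      HasCompactSupport.zero (hsm χ.1 n) (hcs χ.1 n) (fun v => χ.2.nonneg _) h0
      (hΨ.isFlowTest_truncate χ.1 n) one_pos (hA χ n) le_rfl (hK0 χ)
      (fun t x b b' => by simp [truncationError]) (hK χ n)
    have e : ∀ z, transport (fun _ : Phase d => (0 : ℝ)) z = 0 := fun z => by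
      simp [transport]
    simp only [zero_mul, e, integral_zero, add_zero] at this
    change 0 ≤ (∫ t in Ioo (-1) T,
        ∫ ω, transport (truncate χ.1 n Ψ) (t, X t ω, η[W | ℱ t] ω) ∂η) + _ at this
    linarith
  -- For large `m` the second cutoff equals 1 on the whole support of the first, so no monotonicity
  -- of cutoffs along rays is needed.
  · have hle : ∀ᶠ m : ℕ in atTop, ∀ v, χ.1 (((n : ℝ) + 1)⁻¹ • v) ≤ χ'.1 (((m : ℝ) + 1)⁻¹ • v) := by
      obtain ⟨R, hR⟩ := (hcs χ.1 n).isBounded.subset_closedBall 0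
      have hlim : Tendsto (fun m : ℕ => ((m : ℝ) + 1) * r χ') atTop atTop :=
        (tendsto_atTop_add_const_right _ _ tendsto_natCast_atTop_atTop).atTop_mul_const (hr0 χ')
      filter_upwards [hlim.eventually_gt_atTop R] with m hm v
      by_cases hv : v ∈ tsupport fun v => χ.1 (((n : ℝ) + 1)⁻¹ • v)
      · have h1 : ‖v‖ ≤ R := by simpa using hR hv
        rw [hr χ' (((m : ℝ) + 1)⁻¹ • v)]
        · exact χ.2.le_one _
        · have hm0 : (0 : ℝ) < (m : ℝ) + 1 := by positivity
          rw [norm_smul, norm_inv, Real.norm_of_nonneg hm0.le, inv_mul_lt_iff₀ hm0]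
          linarith
      · have := image_eq_zero_of_notMem_tsupport hv
        rw [this]
        exact χ'.2.nonneg _
    filter_upwards [hle] with m hm
    exact h.integral_transport_truncation_le hT hΨ (hsm χ.1 n) (hcs χ.1 n) (hsm χ'.1 m)
      (hcs χ'.1 m) hm (hΨ.isFlowTest_truncate χ.1 n) (hΨ.isFlowTest_truncate χ'.1 m)
      (hA χ n) (hA χ' m) (hK0 χ) (hK0 χ') (hK χ n) (hK χ' m)

end MartingaleFlow

/-! ### Primitives of square integrable functions -/

section Primitive

variable {T : ℝ} {d : ℕ}

instance instMeasurableSpaceL2 : MeasurableSpace (L2 T d) := borel _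

instance instBorelSpaceL2 : BorelSpace (L2 T d) := ⟨rfl⟩

instance instSecondCountableTopologyL2 : SecondCountableTopology (L2 T d) := by
  have h2 : Fact ((2 : ℝ≥0∞) ≠ ⊤) := ⟨by norm_num⟩
  exact Lp.SecondCountableTopology

/-- The extension of `g` by zero. -/
def extendZero (g : L2 T d) : ℝ → E d := (Ioo (-1) T).indicator g

lemma integrable_extendZero (g : L2 T d) : Integrable (extendZero g) :=
  (integrable_indicator_iff measurableSet_Ioo).2 ((Lp.memLp g).integrable one_le_two)

/-- The primitive of `g` that vanishes at `0`. -/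
def primitive (g : L2 T d) (t : ℝ) : E d := ∫ s in (0 : ℝ)..t, extendZero g s

lemma continuous_primitive (g : L2 T d) : Continuous (primitive g) :=
  intervalIntegral.continuous_primitive (fun _ _ => (integrable_extendZero g).intervalIntegrable) 0

lemma primitive_zero (g : L2 T d) : primitive g 0 = 0 := intervalIntegral.integral_same

lemma primitive_sub_primitive (g : L2 T d) (s t : ℝ) :
    primitive g t - primitive g s = ∫ r in s..t, extendZero g r :=
  intervalIntegral.integral_interval_sub_left (integrable_extendZero g).intervalIntegrable
    (integrable_extendZero g).intervalIntegrable

lemma uIcc_subset_Ioo (hT : 0 < T) {t : ℝ} (ht : t ∈ Ioo (-1) T) : uIcc 0 t ⊆ Ioo (-1) T :=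
  ordConnected_Ioo.uIcc_subset ⟨by norm_num, hT⟩ ht

lemma primitive_eq (hT : 0 < T) (g : L2 T d) {t : ℝ} (ht : t ∈ Ioo (-1) T) :
    primitive g t = ∫ s in (0 : ℝ)..t, g s :=
  intervalIntegral.integral_congr fun _ hs => indicator_of_mem (uIcc_subset_Ioo hT ht hs) _

lemma lpNorm_coe {Ω F : Type*} {mΩ : MeasurableSpace Ω} {ν : Measure Ω} [NormedAddCommGroup F]
    {p : ℝ≥0∞} (u : Lp F p ν) : lpNorm u p ν = ‖u‖ := by
  rw [Lp.norm_def, toReal_eLpNorm (Lp.aestronglyMeasurable u)]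

/-- The norm of the embedding of `L²` into `L¹`. -/
def embConst {Ω : Type*} {mΩ : MeasurableSpace Ω} (ν : Measure Ω) : NNReal :=
  ⟨lpNorm (fun _ => (1 : ℝ)) 2 ν, lpNorm_nonneg⟩

lemma norm_setIntegral_le {Ω F : Type*} {mΩ : MeasurableSpace Ω} {ν : Measure Ω} [IsFiniteMeasure ν]
    [NormedAddCommGroup F] [NormedSpace ℝ F] (u : Lp F 2 ν) :
    ∫ x, ‖u x‖ ∂ν ≤ embConst ν * ‖u‖ := by
  have := integral_norm_mul_norm_le (Lp.memLp u) (memLp_const (1 : ℝ) (μ := ν))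
  rw [lpNorm_coe, mul_comm ‖u‖] at this
  simp only [norm_one, mul_one] at this
  exact this

lemma norm_primitive_le (g : L2 T d) (t : ℝ) :
    ‖primitive g t‖ ≤ embConst (volume.restrict (Ioo (-1) T)) * ‖g‖ := by
  refine (intervalIntegral.norm_integral_le_integral_norm_uIoc).trans ?_
  refine (setIntegral_le_integral (integrable_extendZero g).norm
    (Eventually.of_forall fun _ => norm_nonneg _)).trans ?_
  refine le_trans (le_of_eq ?_) (norm_setIntegral_le g)
  rw [← integral_indicator measurableSet_Ioo]
  simp only [extendZero, norm_indicator_eq_indicator_norm]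

lemma extendZero_ae_eq {g : L2 T d} {f : ℝ → E d} (h : g =ᵐ[volume.restrict (Ioo (-1) T)] f) :
    extendZero g =ᵐ[volume] (Ioo (-1) T).indicator f :=
  (ae_eq_restrict_iff_indicator_ae_eq measurableSet_Ioo).1 h

lemma primitive_sub (g g' : L2 T d) (t : ℝ) :
    primitive (g - g') t = primitive g t - primitive g' t := by
  unfold primitive
  rw [← intervalIntegral.integral_sub (integrable_extendZero g).intervalIntegrable
    (integrable_extendZero g').intervalIntegrable]
  refine intervalIntegral.integral_congr_ae ?_
  filter_upwards [extendZero_ae_eq (Lp.coeFn_sub g g')] with s hs _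
  rw [hs, indicator_sub']
  rfl

lemma continuous_uncurry_primitive : Continuous fun p : L2 T d × ℝ => primitive p.1 p.2 := by
  refine continuous_prod_of_continuous_lipschitzWith _
    (embConst (volume.restrict (Ioo (-1) T))) continuous_primitive fun t => ?_
  refine LipschitzWith.of_dist_le_mul fun g g' => ?_
  rw [dist_eq_norm, dist_eq_norm, ← primitive_sub]
  exact norm_primitive_le _ _

lemma memLp_const_add_primitive (p : E d × L2 T d) :
    MemLp (fun t => p.1 + primitive p.2 t) 2 (volume.restrict (Ioo (-1) T)) := by
  refine (memLp_top_of_bound (continuous_const.add (continuous_primitive _)).aestronglyMeasurable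
    (‖p.1‖ + embConst (volume.restrict (Ioo (-1) T)) * ‖p.2‖)
    (Eventually.of_forall fun t => ?_)).mono_exponent le_top
  exact (norm_add_le _ _).trans (add_le_add_right (norm_primitive_le _ _) _)

/-- The curve with `γ(0) = c` and `γ' = g`. -/
def curveOf (p : E d × L2 T d) : L2 T d := (memLp_const_add_primitive p).toLp

lemma curveOf_ae_eq (p : E d × L2 T d) :
    curveOf p =ᵐ[volume.restrict (Ioo (-1) T)] fun t => p.1 + primitive p.2 t :=
  (memLp_const_add_primitive p).coeFn_toLp

lemma isPrimitive_iff (hT : 0 < T) {γ : L2 T d} {c : E d} {g : L2 T d} :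
    IsPrimitive γ c g ↔ curveOf (c, g) = γ := by
  have h1 : (fun t => c + primitive g t) =ᵐ[volume.restrict (Ioo (-1) T)]
      fun t => c + ∫ s in (0 : ℝ)..t, g s := by
    filter_upwards [ae_restrict_mem measurableSet_Ioo] with t ht
    rw [primitive_eq hT g ht]
  constructor
  · intro h
    exact Lp.ext ((curveOf_ae_eq (c, g)).trans (h1.trans (EventuallyEq.symm h)))
  · rintro rfl
    exact (curveOf_ae_eq (c, g)).trans h1

lemma ae_hasDerivAt_primitive (g : L2 T d) : ∀ᵐ t, HasDerivAt (primitive g) (extendZero g t) t := by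
  filter_upwards [LocallyIntegrable.ae_hasDerivAt_integral
    (integrable_extendZero g).locallyIntegrable] with t ht
  exact ht 0

/-- Continuous representatives that agree almost everywhere agree on the interval: the value at `0`
recovers `c`, and Lebesgue differentiation recovers `g`. -/
lemma curveOf_injective (hT : 0 < T) : Function.Injective (curveOf : E d × L2 T d → L2 T d) := by
  rintro ⟨c, g⟩ ⟨c', g'⟩ h
  have h1 : EqOn (fun t => c + primitive g t) (fun t => c' + primitive g' t) (Ioo (-1) T) :=
    Measure.eqOn_open_of_ae_eq ((curveOf_ae_eq (c, g)).symm.trans (h ▸ curveOf_ae_eq (c', g')))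
      isOpen_Ioo (continuous_const.add (continuous_primitive g)).continuousOn
      (continuous_const.add (continuous_primitive g')).continuousOn
  have hc : c = c' := by
    have := h1 (x := 0) ⟨by norm_num, hT⟩
    simpa [primitive_zero] using this
  subst hc
  congr 1
  refine Lp.ext ?_
  filter_upwards [ae_restrict_of_ae (ae_hasDerivAt_primitive g),
    ae_restrict_of_ae (ae_hasDerivAt_primitive g'), ae_restrict_mem measurableSet_Ioo]
    with t h2 h3 ht
  have h4 : primitive g =ᶠ[𝓝 t] primitive g' := by
    filter_upwards [isOpen_Ioo.mem_nhds ht] with s hs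
    exact add_left_cancel (h1 hs)
  have := h2.unique (h3.congr_of_eventuallyEq h4)
  simpa [extendZero, ht] using this

lemma continuous_curveOf : Continuous (curveOf : E d × L2 T d → L2 T d) := by
  set K := embConst (volume.restrict (Ioo (-1) T)) with hK
  set M : NNReal := measureUnivNNReal (volume.restrict (Ioo (-1) T)) ^ (2 : ℝ≥0∞).toReal⁻¹ with hM
  refine (LipschitzWith.of_dist_le_mul (K := M * (1 + K)) fun p q => ?_).continuous
  rw [dist_eq_norm, dist_eq_norm]
  have h1 : ‖curveOf p - curveOf q‖ ≤ M * (‖p.1 - q.1‖ + K * ‖p.2 - q.2‖) := by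
    refine Lp.norm_le_of_ae_bound (by positivity) ?_
    filter_upwards [Lp.coeFn_sub (curveOf p) (curveOf q), curveOf_ae_eq p, curveOf_ae_eq q]
      with t h1 h2 h3
    rw [h1, Pi.sub_apply, h2, h3, add_sub_add_comm, ← primitive_sub]
    exact (norm_add_le _ _).trans (add_le_add_right (norm_primitive_le _ _) _)
  refine h1.trans ?_
  have h2 : ‖p.1 - q.1‖ ≤ ‖p - q‖ := norm_fst_le (p - q)
  have h3 : ‖p.2 - q.2‖ ≤ ‖p - q‖ := norm_snd_le (p - q)
  push_cast
  rw [mul_assoc]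
  gcongr
  nlinarith [K.2]

/-- A continuous injection between Polish spaces has Borel image and Borel inverse (Lusin–Souslin).
This yields measurability of the energy and of the derivative as functions of the curve. -/
lemma measurableEmbedding_curveOf (hT : 0 < T) :
    MeasurableEmbedding (curveOf : E d × L2 T d → L2 T d) :=
  have : PolishSpace (L2 T d) := inferInstance
  continuous_curveOf.measurableEmbedding (curveOf_injective hT)

/-- The initial position and the derivative of a curve in `W^{1,2}`. -/
def curveData (γ : L2 T d) : E d × L2 T d := Function.extend curveOf id 0 γ

lemma curveData_eq (hT : 0 < T) {γ : L2 T d} {c : E d} {g : L2 T d} (h : IsPrimitive γ c g) :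
    curveData γ = (c, g) := by
  rw [isPrimitive_iff hT] at h
  rw [← h, curveData, (curveOf_injective hT).extend_apply, id]

lemma measurable_curveData (hT : 0 < T) : Measurable (curveData : L2 T d → E d × L2 T d) :=
  (measurableEmbedding_curveOf hT).measurable_extend measurable_id measurable_const

lemma measurable_coe_curve : Measurable (fun γ : Curve T d => γ.1) :=
  have : Continuous fun γ : Curve T d => γ.1 :=
    (continuous_subtype_val : Continuous fun γ : {γ : L2 T d // ∃ A, AffineBefore γ A} => γ.1)
  this.measurable

lemma energy_eq (hT : 0 < T) {γ : Curve T d} {c : E d} {g : L2 T d} (h : IsPrimitive γ.1 c g) :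
    energy γ = ‖g‖ₑ ^ 2 := by
  refine le_antisymm (iInf₂_le_of_le c g (iInf_le _ h)) (le_iInf₂ fun c' g' => le_iInf fun h' => ?_)
  have := (curveData_eq hT h).symm.trans (curveData_eq hT h')
  rw [(Prod.mk.inj this).2]

lemma energy_eq_extend (hT : 0 < T) (γ : Curve T d) :
    energy γ = Function.extend curveOf (fun p : E d × L2 T d => ‖p.2‖ₑ ^ 2) ⊤ γ.1 := by
  by_cases h : ∃ p, curveOf p = γ.1
  · obtain ⟨⟨c, g⟩, h⟩ := h
    rw [energy_eq hT ((isPrimitive_iff hT).2 h), ← h, (curveOf_injective hT).extend_apply]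
  · rw [Function.extend_apply' _ _ _ h, energy]
    simp only [Pi.top_apply, iInf_eq_top]
    exact fun c g hcg => absurd ⟨(c, g), (isPrimitive_iff hT).1 hcg⟩ h

lemma measurable_energy (hT : 0 < T) : Measurable (energy : Curve T d → ℝ≥0∞) := by
  have h1 : Measurable (Function.extend curveOf (fun p : E d × L2 T d => ‖p.2‖ₑ ^ 2) ⊤) :=
    (measurableEmbedding_curveOf hT).measurable_extend
      (measurable_snd.enorm.pow_const 2) measurable_const
  have h2 := h1.comp (measurable_coe_curve (T := T) (d := d))
  exact (funext (energy_eq_extend hT) : energy = _) ▸ h2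

lemma exists_isPrimitive_of_energy_ne_top {γ : Curve T d} (h : energy γ ≠ ⊤) :
    ∃ c g, IsPrimitive γ.1 c g := by
  by_contra hc
  push Not at hc
  exact h (by simp [energy, hc])

lemma pos_eq (hT : 0 < T) {γ : Curve T d} {c : E d} {g : L2 T d} (h : IsPrimitive γ.1 c g)
    {t : ℝ} (ht : t ∈ Ioo (-1) T) : pos γ t = c + primitive g t := by
  have hex : ∃ p : E d × L2 T d, IsPrimitive γ.1 p.1 p.2 := ⟨(c, g), h⟩
  have := (curveData_eq hT hex.choose_spec).symm.trans (curveData_eq hT h)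
  rw [pos, dif_pos hex, primitive_eq hT g ht, (Prod.ext_iff.1 this).1, (Prod.ext_iff.1 this).2]

lemma pos_sub_pos (hT : 0 < T) {γ : Curve T d} {c : E d} {g : L2 T d} (h : IsPrimitive γ.1 c g)
    {s t : ℝ} (hs : s ∈ Ioo (-1) T) (ht : t ∈ Ioo (-1) T) :
    pos γ t - pos γ s = ∫ r in s..t, extendZero g r := by
  rw [pos_eq hT h ht, pos_eq hT h hs, add_sub_add_left_eq_sub, primitive_sub_primitive]

lemma vel_eq (hT : 0 < T) {γ : Curve T d} {c : E d} {g : L2 T d} (h : IsPrimitive γ.1 c g)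
    {t : ℝ} (ht : t ∈ Ioo (-1) T) : vel γ t = deriv (primitive g) t := by
  have : pos γ =ᶠ[𝓝 t] fun t => c + primitive g t := by
    filter_upwards [isOpen_Ioo.mem_nhds ht] with s hs
    exact pos_eq hT h hs
  rw [vel, this.deriv_eq, deriv_const_add]

lemma vel_ae_eq (hT : 0 < T) {γ : Curve T d} {c : E d} {g : L2 T d} (h : IsPrimitive γ.1 c g) :
    ∀ᵐ t ∂(volume.restrict (Ioo (-1) T)), vel γ t = extendZero g t := by
  filter_upwards [ae_restrict_of_ae (ae_hasDerivAt_primitive g), ae_restrict_mem measurableSet_Ioo]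
    with t h1 ht
  rw [vel_eq hT h ht, h1.deriv]

/-- A jointly measurable version of the velocity. -/
lemma measurable_deriv_primitive (hT : 0 < T) :
    Measurable fun p : Curve T d × ℝ => deriv (primitive (curveData p.1.1).2) p.2 := by
  have h1 : Measurable fun p : L2 T d × ℝ => deriv (primitive p.1) p.2 :=
    measurable_deriv_with_param (f := fun g : L2 T d => primitive g) continuous_uncurry_primitive
  exact h1.comp ((((measurable_curveData hT).comp measurable_coe_curve).snd.comp
    measurable_fst).prodMk measurable_snd)

end Primitive

/-! ### Energy estimates -/

lemma sq_lintegral_le {α : Type*} {mα : MeasurableSpace α} {ν : Measure α} {f : α → ℝ≥0∞}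
    (hf : AEMeasurable f ν) : (∫⁻ x, f x ∂ν) ^ 2 ≤ ν univ * ∫⁻ x, f x ^ 2 ∂ν := by
  have h := ENNReal.lintegral_mul_le_Lp_mul_Lq ν Real.HolderConjugate.two_two hf
    (aemeasurable_const (b := (1 : ℝ≥0∞)))
  simp only [Pi.mul_apply, mul_one, lintegral_const, ENNReal.rpow_two] at h
  refine (pow_le_pow_left₀ zero_le h 2).trans_eq ?_
  rw [mul_pow, ← ENNReal.rpow_natCast, ← ENNReal.rpow_natCast, ← ENNReal.rpow_mul,
    ← ENNReal.rpow_mul, mul_comm]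
  norm_num

section Energy

variable {T : ℝ} {d : ℕ}

lemma lintegral_extendZero_sq (g : L2 T d) :
    ∫⁻ r in Ioo (-1) T, ‖extendZero g r‖ₑ ^ 2 = ‖g‖ₑ ^ 2 := by
  have h := eLpNorm_nnreal_pow_eq_lintegral (f := g) (μ := volume.restrict (Ioo (-1) T)) (p := 2)
    (by norm_num)
  simp only [NNReal.coe_ofNat, ENNReal.rpow_two, ENNReal.coe_ofNat] at h
  rw [Lp.enorm_def, h]
  refine setLIntegral_congr_fun measurableSet_Ioo fun r hr => ?_
  simp only [extendZero, indicator_of_mem hr]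

/-- Cauchy–Schwarz in time for the integral of the derivative minus `v`. -/
lemma enorm_pos_sub_pos_sub_sq_le (hT : 0 < T) {γ : Curve T d} {c : E d} {g : L2 T d}
    (h : IsPrimitive γ.1 c g) {s t : ℝ} (hs : s ∈ Ioo (-1) T) (ht : t ∈ Ioo (-1) T) (hst : s ≤ t)
    (v : E d) : ‖pos γ t - pos γ s - (t - s) • v‖ₑ ^ 2 ≤
      ENNReal.ofReal (t - s) * ∫⁻ r in Ioc s t, ‖extendZero g r - v‖ₑ ^ 2 := by
  have hi := (integrable_extendZero g).intervalIntegrable (a := s) (b := t)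
  have e : pos γ t - pos γ s - (t - s) • v = ∫ r in Ioc s t, (extendZero g r - v) := by
    rw [pos_sub_pos hT h hs ht, ← intervalIntegral.integral_of_le hst,
      intervalIntegral.integral_sub hi intervalIntegrable_const, intervalIntegral.integral_const]
  have hm : AEMeasurable (fun r => ‖extendZero g r - v‖ₑ) (volume.restrict (Ioc s t)) :=
    ((integrable_extendZero g).1.sub aestronglyMeasurable_const).restrict.enorm
  rw [e]
  refine (pow_le_pow_left₀ zero_le (enorm_integral_le_lintegral_enorm _) 2).trans
    ((sq_lintegral_le hm).trans_eq ?_)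
  rw [Measure.restrict_apply_univ, Real.volume_Ioc]

lemma pos_sub_pos_eq_smul_W0 (hT : 0 < T) {γ : Curve T d} {c : E d} {g : L2 T d}
    (h : IsPrimitive γ.1 c g) {s t : ℝ} (hs : s ∈ Ioo (-1) 0) (ht : t ∈ Ioo (-1) 0) :
    pos γ t - pos γ s = (t - s) • W0 γ := by
  have hsub : Ioo (-1 : ℝ) 0 ⊆ Ioo (-1) T := Ioo_subset_Ioo_right hT.le
  set A := γ.2.choose with hA
  have hAγ : AffineBefore γ.1 A := γ.2.choose_spec
  rw [AffineBefore, Measure.restrict_restrict_of_subset hsub] at hAγ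
  have h1 : EqOn (fun t => c + primitive g t) A (Ioo (-1) 0) := by
    refine Measure.eqOn_open_of_ae_eq (μ := volume) ?_ isOpen_Ioo
      (continuous_const.add (continuous_primitive g)).continuousOn
      (AffineMap.continuous_of_finiteDimensional A).continuousOn
    have h2 := curveOf_ae_eq (c, g)
    rw [(isPrimitive_iff hT).1 h] at h2
    have h3 := ae_restrict_of_ae_restrict_of_subset hsub h2
    filter_upwards [h3, hAγ] with t h3 h4
    exact h3.symm.trans h4
  have hlin : ∀ t, A t = A 0 + t • A.linear 1 := fun t => by
    have := A.map_vadd 0 t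
    simp only [vadd_eq_add, add_zero] at this
    rw [this, ← A.linear.map_smul, smul_eq_mul, mul_one, add_comm]
  have hW : W0 γ = A.linear 1 := by
    rw [W0, ← hA, hlin (-1)]
    simp
  rw [pos_eq hT h (hsub ht), pos_eq hT h (hsub hs)]
  refine (congrArg₂ _ (h1 ht) (h1 hs)).trans ?_
  rw [hlin t, hlin s, hW, add_sub_add_left_eq_sub, sub_smul]

lemma vel_eq_W0 (hT : 0 < T) {γ : Curve T d} {c : E d} {g : L2 T d} (h : IsPrimitive γ.1 c g)
    {t : ℝ} (ht : t ∈ Ioo (-1) 0) : vel γ t = W0 γ := by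
  have h1 : pos γ =ᶠ[𝓝 t] fun s => pos γ t + (s - t) • W0 γ := by
    filter_upwards [isOpen_Ioo.mem_nhds ht] with s hs
    rw [← pos_sub_pos_eq_smul_W0 hT h ht hs, add_sub_cancel]
  rw [vel, h1.deriv_eq]
  have : HasDerivAt (fun s : ℝ => pos γ t + (s - t) • W0 γ) ((1 : ℝ) • W0 γ) t :=
    (((hasDerivAt_id t).sub_const t).smul_const _).const_add _
  rw [this.deriv, one_smul]

/-- The derivative is the constant `W0 γ` on `(-1, 0)`, an interval of length 1, which therefore
carries exactly `‖W0 γ‖²` of the energy. -/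
lemma enorm_W0_sq_le (hT : 0 < T) {γ : Curve T d} {c : E d} {g : L2 T d} (h : IsPrimitive γ.1 c g) :
    ‖W0 γ‖ₑ ^ 2 ≤ energy γ := by
  have hsub : Ioo (-1 : ℝ) 0 ⊆ Ioo (-1) T := Ioo_subset_Ioo_right hT.le
  rw [energy_eq hT h, ← lintegral_extendZero_sq]
  refine le_trans (le_of_eq ?_) (lintegral_mono_set hsub)
  have : ∫⁻ r in Ioo (-1) 0, ‖extendZero g r‖ₑ ^ 2 = ∫⁻ _ in Ioo (-1 : ℝ) 0, ‖W0 γ‖ₑ ^ 2 := by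
    refine lintegral_congr_ae ?_
    filter_upwards [ae_restrict_of_ae_restrict_of_subset hsub (vel_ae_eq hT h),
      ae_restrict_mem measurableSet_Ioo] with r h1 hr
    rw [← h1, vel_eq_W0 hT h hr]
  rw [this, setLIntegral_const, Real.volume_Ioo]
  simp

end Energy

/-! ### The future of a curve -/

section Future

variable {T : ℝ} {d : ℕ}

lemma continuous_restrictMap (t : ℝ) : Continuous (restrictMap (T := T) (d := d) t) := by
  have : Continuous fun γ : Curve T d => γ.1 :=
    (continuous_subtype_val : Continuous fun γ : {γ : L2 T d // ∃ A, AffineBefore γ A} => γ.1)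
  exact (LpToLpRestrictCLM ℝ (E d) ℝ _ 2 (Ioo t T)).continuous.comp this

lemma futureSigma_le (t : ℝ) : futureSigma T d t ≤ instMeasurableSpaceCurve T d :=
  (continuous_restrictMap t).borel_measurable.comap_le

lemma restrictMap_ae_eq (t : ℝ) (γ : Curve T d) :
    restrictMap t γ =ᵐ[(volume.restrict (Ioo (-1) T)).restrict (Ioo t T)] γ.1 :=
  LpToLpRestrictCLM_coeFn ℝ (Ioo t T) γ.1

lemma continuous_toLp_of_le {Ω F : Type*} {mΩ : MeasurableSpace Ω} [NormedAddCommGroup F]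
    {ν ν' : Measure Ω} (h : ν' ≤ ν) :
    Continuous fun u : Lp F 2 ν => ((Lp.memLp u).mono_measure h).toLp := by
  refine (LipschitzWith.of_dist_le_mul (K := 1) fun u v => ?_).continuous
  rw [dist_eq_norm, dist_eq_norm, ← MemLp.toLp_sub, Lp.norm_toLp, NNReal.coe_one, one_mul,
    Lp.norm_def, eLpNorm_congr_ae (Lp.coeFn_sub u v)]
  exact ENNReal.toReal_mono ((Lp.memLp u).sub (Lp.memLp v)).eLpNorm_ne_top
    (eLpNorm_mono_measure _ h)

/-- Restriction to the shorter interval factors continuously through restriction to the longer one.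
-/
lemma futureSigma_antitone : Antitone (futureSigma T d) := by
  intro s t hst
  have hle : (volume.restrict (Ioo (-1) T)).restrict (Ioo t T) ≤
      (volume.restrict (Ioo (-1) T)).restrict (Ioo s T) :=
    Measure.restrict_mono (Ioo_subset_Ioo_left hst) le_rfl
  have e : restrictMap (T := T) (d := d) t =
      (fun u => ((Lp.memLp u).mono_measure hle).toLp) ∘ restrictMap s := by
    ext1 γ
    refine Lp.ext ?_
    filter_upwards [restrictMap_ae_eq t γ, ae_mono hle (restrictMap_ae_eq s γ),
      MemLp.coeFn_toLp ((Lp.memLp (restrictMap s γ)).mono_measure hle)] with r h1 h2 h3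
    exact h1.trans (h2.symm.trans h3.symm)
  rw [futureSigma, e, ← MeasurableSpace.comap_comp]
  exact MeasurableSpace.comap_mono (continuous_toLp_of_le hle).borel_measurable.comap_le

/-- The average of `u` over `(t, t + 1/(n+1))`. -/
def average (t : ℝ) (n : ℕ) (u : Lp (E d) 2 ((volume.restrict (Ioo (-1) T)).restrict (Ioo t T))) :
    E d :=
  ((n : ℝ) + 1) • ∫ s in Ioo t (t + ((n : ℝ) + 1)⁻¹), u s
    ∂((volume.restrict (Ioo (-1) T)).restrict (Ioo t T))

lemma continuous_average (t : ℝ) (n : ℕ) : Continuous (average (T := T) (d := d) t n) := by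
  set ν := (volume.restrict (Ioo (-1) T)).restrict (Ioo t T) with hν
  suffices h : Continuous fun u : Lp (E d) 2 ν => ∫ s in Ioo t (t + ((n : ℝ) + 1)⁻¹), u s ∂ν from
    h.const_smul ((n : ℝ) + 1)
  refine (LipschitzWith.of_dist_le_mul (K := embConst ν) fun u v => ?_).continuous
  have hi : ∀ u : Lp (E d) 2 ν, Integrable u ν := fun u => (Lp.memLp u).integrable one_le_two
  rw [dist_eq_norm, dist_eq_norm, ← integral_sub (hi u).integrableOn (hi v).integrableOn]
  refine (norm_integral_le_integral_norm _).trans ?_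
  refine (setIntegral_le_integral ((hi u).sub (hi v)).norm
    (Eventually.of_forall fun _ => norm_nonneg _)).trans ?_
  refine le_trans (le_of_eq (integral_congr_ae ?_)) (norm_setIntegral_le (u - v))
  filter_upwards [Lp.coeFn_sub u v] with s hs
  rw [hs]

/-- A version of the position that is determined by the future of the curve. -/
def futurePos (T : ℝ) {d : ℕ} (t : ℝ) (γ : Curve T d) : E d :=
  limUnder atTop fun n : ℕ => average t n (restrictMap t γ)

lemma stronglyMeasurable_limUnder_comp {Ω Z F : Type*} [TopologicalSpace Z]
    [NormedAddCommGroup F] [CompleteSpace F] [SecondCountableTopology F] {Φ : Ω → Z}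
    {f : ℕ → Z → F} (hf : ∀ n, Continuous (f n)) :
    StronglyMeasurable[(borel Z).comap Φ] fun ω => limUnder atTop fun n => f n (Φ ω) := by
  borelize Z F
  have h : StronglyMeasurable fun z => limUnder atTop fun n => f n z :=
    StronglyMeasurable.limUnder fun n => (hf n).measurable.stronglyMeasurable
  exact h.comp_measurable (comap_measurable Φ)

lemma stronglyMeasurable_futurePos (t : ℝ) :
    StronglyMeasurable[futureSigma T d t] (futurePos T (d := d) t) :=
  stronglyMeasurable_limUnder_comp (continuous_average t)

/-- Averages over shrinking intervals to the right of `t` converge to the value at `t` of the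
continuous representative. -/
lemma futurePos_eq (hT : 0 < T) {γ : Curve T d} {c : E d} {g : L2 T d} (h : IsPrimitive γ.1 c g)
    {t : ℝ} (ht : t ∈ Ioo (-1) T) : futurePos T t γ = pos γ t := by
  have hc : Continuous fun s => c + primitive g s := continuous_const.add (continuous_primitive g)
  have hd : HasDerivAt (fun u => ∫ s in t..u, (c + primitive g s)) (c + primitive g t) t :=
    hc.integral_hasStrictDerivAt t t |>.hasDerivAt
  have hlim : Tendsto (fun n : ℕ => ((n : ℝ) + 1)⁻¹) atTop (𝓝[>] 0) := by
    refine tendsto_nhdsWithin_iff.2 ⟨?_, Eventually.of_forall fun n => ?_⟩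
    · simpa using tendsto_one_div_add_atTop_nhds_zero_nat (𝕜 := ℝ)
    · exact inv_pos.2 (by positivity : (0 : ℝ) < (n : ℝ) + 1)
  have h1 := hd.tendsto_slope_zero_right.comp hlim
  rw [pos_eq hT h ht]
  refine Tendsto.limUnder_eq (h1.congr' ?_)
  have hT' : ∀ᶠ n : ℕ in atTop, ((n : ℝ) + 1)⁻¹ < T - t :=
    (hlim.mono_right nhdsWithin_le_nhds).eventually_lt_const (by linarith [ht.2])
  filter_upwards [hT'] with n hn
  have hn0 : (0 : ℝ) < ((n : ℝ) + 1)⁻¹ := by positivity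
  simp only [Function.comp_apply, intervalIntegral.integral_same, sub_zero, inv_inv, average]
  congr 1
  have hsub : Ioo t (t + ((n : ℝ) + 1)⁻¹) ⊆ Ioo t T := Ioo_subset_Ioo_right (by linarith)
  have hsub' : Ioo t (t + ((n : ℝ) + 1)⁻¹) ⊆ Ioo (-1) T :=
    Ioo_subset_Ioo ht.1.le (by linarith)
  have h2 := curveOf_ae_eq (c, g)
  rw [(isPrimitive_iff hT).1 h] at h2
  have h3 := (restrictMap_ae_eq t γ).trans (ae_restrict_of_ae h2)
  have hm : ((volume.restrict (Ioo (-1) T)).restrict (Ioo t T)).restrict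
      (Ioo t (t + ((n : ℝ) + 1)⁻¹)) = volume.restrict (Ioo t (t + ((n : ℝ) + 1)⁻¹)) := by
    rw [Measure.restrict_restrict_of_subset hsub, Measure.restrict_restrict_of_subset hsub']
  rw [intervalIntegral.integral_of_le (by linarith), integral_Ioc_eq_integral_Ioo, ← hm]
  exact (integral_congr_ae (ae_restrict_of_ae h3)).symm

end Future

/-! ### The flow of a dissipative solution -/

lemma lpNorm_le_of_lintegral_sq_le {Ω F : Type*} {mΩ : MeasurableSpace Ω} {ν : Measure Ω}
    [NormedAddCommGroup F] {f : Ω → F} (hf : AEStronglyMeasurable f ν) {c : ℝ} (hc : 0 ≤ c)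
    (h : ∫⁻ ω, ‖f ω‖ₑ ^ 2 ∂ν ≤ ENNReal.ofReal (c ^ 2)) : MemLp f 2 ν ∧ lpNorm f 2 ν ≤ c := by
  have h1 := eLpNorm_nnreal_pow_eq_lintegral (f := f) (μ := ν) (p := 2) (by norm_num)
  simp only [NNReal.coe_ofNat, ENNReal.rpow_two, ENNReal.coe_ofNat] at h1
  rw [← h1, ENNReal.ofReal_pow hc] at h
  have h2 : eLpNorm f 2 ν ≤ ENNReal.ofReal c := (ENNReal.pow_le_pow_left_iff (by norm_num)).1 h
  refine ⟨⟨hf, h2.trans_lt ENNReal.ofReal_lt_top⟩, ?_⟩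
  rw [← toReal_eLpNorm hf]
  exact ENNReal.toReal_le_of_le_ofReal hc h2

lemma lintegral_enorm_sq_eq {Ω F : Type*} {mΩ : MeasurableSpace Ω} {ν : Measure Ω}
    [NormedAddCommGroup F] {f : Ω → F} (hf : MemLp f 2 ν) :
    ∫⁻ ω, ‖f ω‖ₑ ^ 2 ∂ν = ENNReal.ofReal (lpNorm f 2 ν ^ 2) := by
  have h1 := eLpNorm_nnreal_pow_eq_lintegral (f := f) (μ := ν) (p := 2) (by norm_num)
  simp only [NNReal.coe_ofNat, ENNReal.rpow_two, ENNReal.coe_ofNat] at h1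
  rw [← h1, ENNReal.ofReal_pow lpNorm_nonneg, ← toReal_eLpNorm hf.1,
    ENNReal.ofReal_toReal hf.eLpNorm_ne_top]

namespace IsDissipative

variable {T : ℝ} {d : ℕ} {η : Measure (Curve T d)} [IsProbabilityMeasure η]

lemma ae_isPrimitive (hT : 0 < T) (hη : IsDissipative η) :
    ∀ᵐ γ ∂η, ∃ c g, IsPrimitive γ.1 c g := by
  filter_upwards [ae_lt_top (measurable_energy hT)
    (hη.memM.energy_le.trans_lt ENNReal.one_lt_top).ne] with γ hγ
  exact exists_isPrimitive_of_energy_ne_top hγ.ne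

lemma futurePos_ae_eq (hT : 0 < T) (hη : IsDissipative η) {t : ℝ} (ht : t ∈ Ioo (-1) T) :
    futurePos T t =ᵐ[η] fun γ => pos γ t := by
  filter_upwards [hη.ae_isPrimitive hT] with γ ⟨c, g, h⟩
  exact futurePos_eq hT h ht

lemma W0_ae_eq (hT : 0 < T) (hη : IsDissipative η) {s t : ℝ} (hs : s ∈ Ioo (-1) 0)
    (ht : t ∈ Ioo (-1) 0) (hst : s < t) :
    (fun γ => (t - s)⁻¹ • (futurePos T t γ - futurePos T s γ)) =ᵐ[η] W0 := by
  have hsub : Ioo (-1 : ℝ) 0 ⊆ Ioo (-1) T := Ioo_subset_Ioo_right hT.le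
  filter_upwards [hη.ae_isPrimitive hT] with γ ⟨c, g, h⟩
  rw [futurePos_eq hT h (hsub hs), futurePos_eq hT h (hsub ht), pos_sub_pos_eq_smul_W0 hT h hs ht,
    smul_smul, inv_mul_cancel₀ (sub_pos.2 hst).ne', one_smul]

/-- Two positions at times in `(r, 0)` determine the slope of the affine part, and both are read off
the future of `r`. -/
lemma aestronglyMeasurable_W0_of_lt (hT : 0 < T) (hη : IsDissipative η) {r : ℝ}
    (hr : r ∈ Ico (-1) 0) : AEStronglyMeasurable[futureSigma T d r] W0 η := by
  obtain ⟨s, hs, hs0⟩ := exists_between hr.2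
  obtain ⟨t, ht, ht0⟩ := exists_between hs0
  have h1 : ∀ u, r < u → StronglyMeasurable[futureSigma T d r] (futurePos T (d := d) u) :=
    fun u hu => (stronglyMeasurable_futurePos u).mono (futureSigma_antitone hu.le)
  have hs1 : s ∈ Ioo (-1 : ℝ) 0 := ⟨hr.1.trans_lt hs, hs0⟩
  have h2 := hη.W0_ae_eq hT hs1 ⟨hs1.1.trans ht, ht0⟩ ht
  have h3 : StronglyMeasurable[futureSigma T d r]
      fun γ => (t - s)⁻¹ • (futurePos T (d := d) t γ - futurePos T s γ) :=
    ((h1 t (hs.trans ht)).sub (h1 s hs)).const_smul (t - s)⁻¹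
  exact ⟨_, h3, h2.symm⟩

lemma W0_bound (hT : 0 < T) (hη : IsDissipative η) :
    MemLp (W0 : Curve T d → E d) 2 η ∧ lpNorm (W0 : Curve T d → E d) 2 η ≤ 1 := by
  refine lpNorm_le_of_lintegral_sq_le ((hη.aestronglyMeasurable_W0_of_lt hT
    (r := -1) ⟨le_rfl, by norm_num⟩).mono (futureSigma_le _)) zero_le_one ?_
  rw [one_pow, ENNReal.ofReal_one]
  refine (lintegral_mono_ae ?_).trans hη.memM.energy_le
  filter_upwards [hη.ae_isPrimitive hT] with γ ⟨c, g, h⟩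
  exact enorm_W0_sq_le hT h

lemma V_ae_eq (hT : 0 < T) (hη : IsDissipative η) (t : ℝ) :
    V η t =ᵐ[η] η[W0 | futureSigma T d t] :=
  (condExp_ae_eq_integral_condExpKernel (futureSigma_le t)
    ((hη.W0_bound hT).1.integrable (by norm_num))).symm

/-- On `(0, T)` this is the definition of a dissipative solution; on `(-1, 0)` the conditional
expectation is `W0`, the slope of the curve; the time `0` is null. -/
lemma vel_ae_eq_condExp (hT : 0 < T) (hη : IsDissipative η) :
    ∀ᵐ t ∂(volume.restrict (Ioo (-1) T)), ∀ᵐ γ ∂η, vel γ t = (η[W0 | futureSigma T d t]) γ := by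
  have h0 : Ioo (-1) T ⊆ Ioo (-1) 0 ∪ (Ioo 0 T ∪ {0}) := fun t ht => by
    rcases lt_trichotomy t 0 with h | h | h
    · exact Or.inl ⟨ht.1, h⟩
    · exact Or.inr (Or.inr h)
    · exact Or.inr (Or.inl ⟨h, ht.2⟩)
  refine ae_restrict_of_ae_restrict_of_subset h0 ?_
  rw [ae_restrict_union_iff, ae_restrict_union_iff]
  refine ⟨?_, ?_, ?_⟩
  · filter_upwards [ae_restrict_mem measurableSet_Ioo] with t ht
    filter_upwards [hη.ae_isPrimitive hT, condExp_of_aestronglyMeasurable' (futureSigma_le t)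
      (hη.aestronglyMeasurable_W0_of_lt hT (Ioo_subset_Ico_self ht))
      ((hη.W0_bound hT).1.integrable (by norm_num))] with γ ⟨c, g, h⟩ h2
    rw [h2, vel_eq_W0 hT h ht]
  · filter_upwards [hη.vel_eq] with t ht
    filter_upwards [ht, hη.V_ae_eq hT t] with γ h1 h2
    rw [h1, h2]
  · rw [Measure.restrict_eq_zero.2 (by simp)]
    simp

/-- Cauchy–Schwarz on each curve, then Tonelli. The swap uses a jointly measurable version of the
derivative, since `vel` is the martingale only for almost every time and then almost every curve. -/
lemma lintegral_vel_sub_sq (hT : 0 < T) (hη : IsDissipative η) {s t : ℝ} (hs : s ∈ Ioo (-1) T)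
    (ht : t ∈ Ioo (-1) T) (hst : s ≤ t) {U : Curve T d → E d} (hU : AEStronglyMeasurable U η) :
    ∫⁻ γ, ‖futurePos T t γ - futurePos T s γ - (t - s) • U γ‖ₑ ^ 2 ∂η ≤
      ENNReal.ofReal (t - s) * ∫⁻ r in Ioc s t, ∫⁻ γ, ‖(η[W0 | futureSigma T d r]) γ - U γ‖ₑ ^ 2 ∂η := by
  have hsub : Ioc s t ⊆ Ioo (-1) T := fun r hr => ⟨hs.1.trans hr.1, hr.2.trans_lt ht.2⟩
  set v : Curve T d × ℝ → E d := fun p => deriv (primitive (curveData p.1.1).2) p.2 with hv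
  have hvm : Measurable v := measurable_deriv_primitive hT
  have h1 : ∀ᵐ γ ∂η, ‖futurePos T t γ - futurePos T s γ - (t - s) • U γ‖ₑ ^ 2 ≤
      ENNReal.ofReal (t - s) * ∫⁻ r in Ioc s t, ‖v (γ, r) - U γ‖ₑ ^ 2 := by
    filter_upwards [hη.ae_isPrimitive hT] with γ ⟨c, g, h⟩
    rw [futurePos_eq hT h hs, futurePos_eq hT h ht]
    refine (enorm_pos_sub_pos_sub_sq_le hT h hs ht hst _).trans_eq ?_
    congr 1
    refine lintegral_congr_ae (ae_restrict_of_ae ?_)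
    filter_upwards [ae_hasDerivAt_primitive g] with r hr
    simp only [hv, curveData_eq hT h, hr.deriv]
  have hm : AEMeasurable (fun p : Curve T d × ℝ => ‖v p - U p.1‖ₑ ^ 2)
      (η.prod (volume.restrict (Ioc s t))) :=
    (hvm.aestronglyMeasurable.sub hU.comp_fst).enorm.pow_const 2
  refine (lintegral_mono_ae h1).trans_eq ?_
  rw [lintegral_const_mul' _ _ ENNReal.ofReal_ne_top, lintegral_lintegral_swap hm]
  congr 1
  refine lintegral_congr_ae ?_
  filter_upwards [ae_restrict_of_ae_restrict_of_subset hsub (hη.vel_ae_eq_condExp hT),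
    ae_restrict_mem measurableSet_Ioc] with r hr hrs
  refine lintegral_congr_ae ?_
  filter_upwards [hr, hη.ae_isPrimitive hT] with γ h2 ⟨c, g, h⟩
  rw [← h2, PressurelessEuler.vel_eq hT h (hsub hrs)]
  simp only [hv, curveData_eq hT h]

/-- A dissipative solution, seen as a flow whose velocity is a backward martingale. -/
theorem martingaleFlow (hT : 0 < T) (hη : IsDissipative η) :
    MartingaleFlow T η (futureSigma T d) W0 (futurePos T (d := d)) := by
  have hW := hη.W0_bound hT
  -- only the filtration matters here
  have h0 : MartingaleFlow (-1) η (futureSigma T d) W0 (fun _ _ => (0 : E d)) :=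
    ⟨futureSigma_le, futureSigma_antitone, hW.1, hW.2, fun _ => stronglyMeasurable_const,
      fun s hs => absurd hs (by simp), fun s hs => absurd hs (by simp)⟩
  have hpos : ∀ t, AEStronglyMeasurable (futurePos T (d := d) t) η := fun t =>
    ((stronglyMeasurable_futurePos t).mono (futureSigma_le t)).aestronglyMeasurable
  have key : ∀ s ∈ Ioo (-1) T, ∀ t ∈ Ioo (-1) T, s ≤ t →
      MemLp (futurePos T t - futurePos T s - (t - s) • η[W0 | futureSigma T d s]) 2 η ∧
      lpNorm (futurePos T t - futurePos T s - (t - s) • η[W0 | futureSigma T d s]) 2 η ≤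
        (t - s) * lpNorm (η[W0 | futureSigma T d s] - η[W0 | futureSigma T d t]) 2 η := by
    intro s hs t ht hst
    have hts : 0 ≤ t - s := sub_nonneg.2 hst
    have hVs := h0.memLp_vel s
    refine lpNorm_le_of_lintegral_sq_le (((hpos t).sub (hpos s)).sub (hVs.1.const_smul _))
      (mul_nonneg hts lpNorm_nonneg) ?_
    refine (hη.lintegral_vel_sub_sq hT hs ht hst hVs.1).trans ?_
    -- By Pythagoras the squared distance to the velocity at `s` is an energy loss, which increases
    -- with time and is largest at `t`.
    have h1 : ∀ r ∈ Ioc s t, ∫⁻ γ, ‖(η[W0 | futureSigma T d r]) γ -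
        (η[W0 | futureSigma T d s]) γ‖ₑ ^ 2 ∂η ≤
        ENNReal.ofReal (lpNorm (η[W0 | futureSigma T d s] - η[W0 | futureSigma T d t]) 2 η ^ 2) := by
      intro r hr
      refine (lintegral_enorm_sq_eq ((h0.memLp_vel r).sub hVs)).trans_le ?_
      refine ENNReal.ofReal_le_ofReal ?_
      rw [lpNorm_sub_comm, h0.lpNorm_vel_sub_sq hr.1.le, h0.lpNorm_vel_sub_sq hst]
      exact sub_le_sub_left (h0.kineticEnergy_antitone hr.2) _
    calc _ ≤ ENNReal.ofReal (t - s) * ∫⁻ _ in Ioc s t, ENNReal.ofReal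
          (lpNorm (η[W0 | futureSigma T d s] - η[W0 | futureSigma T d t]) 2 η ^ 2) :=
          mul_le_mul_right (setLIntegral_mono measurable_const h1) _
      _ = _ := by
          rw [setLIntegral_const, Real.volume_Ioc, ← ENNReal.ofReal_mul (by positivity),
            ← ENNReal.ofReal_mul hts]
          congr 1
          ring
  have hsub : ∀ s ∈ Ioo (-1) T, ∀ t ∈ Ioo (-1) T, s ≤ t →
      MemLp (futurePos T t - futurePos T s : Curve T d → E d) 2 η := by
    intro s hs t ht hst
    have := (key s hs t ht hst).1.add ((h0.memLp_vel s).const_smul (t - s))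
    rwa [sub_add_cancel] at this
  refine ⟨futureSigma_le, futureSigma_antitone, hW.1, hW.2, stronglyMeasurable_futurePos,
    fun s hs t ht => ?_, fun s hs t ht hst => (key s hs t ht hst).2⟩
  rcases le_total s t with hst | hst
  · exact hsub s hs t ht hst
  · rw [← neg_sub]
    exact (hsub t ht s hs hst).neg

end IsDissipative

/-! ### The kinetic measure and its moments -/

/-- No continuity of the derivative is assumed; measurability comes from the limit of continuous
difference quotients. -/
lemma IsFlowTest.measurable_transport {T : ℝ} {d : ℕ} {Φ : Phase d → ℝ} (hΦ : IsFlowTest T Φ) :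
    Measurable (transport Φ) := by
  have hlim : Tendsto (fun n : ℕ => ((n : ℝ) + 1)⁻¹) atTop (𝓝[>] 0) :=
    tendsto_nhdsWithin_iff.2 ⟨by simpa using tendsto_one_div_add_atTop_nhds_zero_nat (𝕜 := ℝ),
      Eventually.of_forall fun n => by rw [mem_Ioi]; positivity⟩
  refine measurable_of_tendsto_metrizable (f := fun (n : ℕ) (z : Phase d) =>
    (((n : ℝ) + 1)⁻¹)⁻¹ * (Φ (z.1 + ((n : ℝ) + 1)⁻¹, z.2.1 + ((n : ℝ) + 1)⁻¹ • z.2.2, z.2.2) -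
      Φ (z.1, z.2.1, z.2.2))) (fun n => ?_) (tendsto_pi_nhds.2 fun z => ?_)
  · have := hΦ.continuous
    exact Continuous.measurable (by fun_prop)
  · exact (hΦ.tendsto_slope z.1 z.2.1 z.2.2).comp hlim

/-- A test function of `(t, x)`, as a function of `(t, x, v)`. -/
lemma isFlowTest_spaceTime {T : ℝ} {d : ℕ} (φ : 𝓓^{1}(spaceTimeOpen T d, ℝ)) :
    IsFlowTest T (fun z : Phase d => φ (z.1, z.2.1)) := by
  have hc : ContDiff ℝ 1 φ := φ.contDiff
  have hs : HasCompactSupport φ := φ.hasCompactSupport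
  have hfs : HasCompactSupport (fderiv ℝ φ) := hs.fderiv ℝ
  obtain ⟨C, hC⟩ := hs.exists_bound_of_continuous hc.continuous
  obtain ⟨L, hL⟩ := hfs.exists_bound_of_continuous (hc.continuous_fderiv (by norm_num))
  obtain ⟨a, b, ha, hb, hab⟩ := exists_Icc_of_isCompact (T := T) hs
    fun p hp => φ.tsupport_subset hp
  exact ⟨hc.continuous.comp (by fun_prop), fun _ => hc.differentiable (by norm_num),
    ⟨C, fun z => hC _⟩, ⟨L, fun _ p => hL p⟩, a, b, ha, hb, fun t ht x _ =>
      image_eq_zero_of_notMem_tsupport fun h => ht (hab _ _ h)⟩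

lemma transport_spaceTime {d : ℕ} {φ : ℝ × E d → ℝ} (hφ : Differentiable ℝ φ) (z : Phase d) :
    transport (fun z : Phase d => φ (z.1, z.2.1)) z =
      deriv (fun s => φ (s, z.2.1)) z.1 +
        inner ℝ z.2.2 (gradient (fun y => φ (z.1, y)) z.2.1) := by
  obtain ⟨t, x, v⟩ := z
  have h := (hφ (t, x)).hasFDerivAt
  have h1 : HasDerivAt (fun s => φ (s, x)) (fderiv ℝ φ (t, x) (1, 0)) t :=
    h.comp_hasDerivAt t ((hasDerivAt_id t).prodMk (hasDerivAt_const t x))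
  have h2 : HasFDerivAt (fun y => φ (t, y))
      ((fderiv ℝ φ (t, x)).comp (ContinuousLinearMap.inr ℝ ℝ (E d))) x :=
    h.comp x ((hasFDerivAt_const t x).prodMk (hasFDerivAt_id x))
  have h3 : fderiv ℝ φ (t, x) (1, v) =
      fderiv ℝ φ (t, x) (1, 0) + fderiv ℝ φ (t, x) (0, v) := by
    rw [← map_add, Prod.mk_add_mk, add_zero, zero_add]
  have h4 : inner ℝ v (gradient (fun y => φ (t, y)) x) = fderiv ℝ φ (t, x) (0, v) := by
    rw [gradient, real_inner_comm, InnerProductSpace.toDual_symm_apply, h2.fderiv]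
    rfl
  exact h3.trans (by rw [h1.deriv, h4])

/-! ### Disintegration of a phase space measure over positions -/

section Disintegration

variable {d : ℕ} {μ : Measure (E d × E d)} [IsFiniteMeasure μ]

/-- The integrand is affine in the velocity, so on each fibre only the mean velocity is seen. -/
lemma integral_fst_add_inner (hv : Integrable (fun z : E d × E d => z.2) μ) {a : E d → ℝ}
    {ξ : E d → E d} (hf : Integrable (fun z : E d × E d => a z.1 + inner ℝ z.2 (ξ z.1)) μ) :
    ∫ x, (a x + inner ℝ (∫ v, v ∂(μ.condKernel x)) (ξ x)) ∂μ.fst =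
      ∫ z, (a z.1 + inner ℝ z.2 (ξ z.1)) ∂μ := by
  rw [← Measure.integral_condKernel hf]
  refine integral_congr_ae ?_
  filter_upwards [hv.condKernel_ae] with x hx
  rw [integral_add (integrable_const _) (hx.inner_const _), integral_const, probReal_univ,
    one_smul, real_inner_comm, ← integral_inner hx]
  simp only [real_inner_comm (ξ x)]

/-- The integrand has only terms linear and quadratic in the velocity, so the fibre contributes its
mean and its second moment `v ⊗ v`. -/
lemma integral_fst_smul_add (hv : Integrable (fun z : E d × E d => z.2) μ)
    (hv2 : Integrable (fun z : E d × E d => ‖z.2‖ ^ 2) μ) {a : E d → ℝ} {ξ : E d → E d}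
    (hf : Integrable (fun z : E d × E d => (a z.1 + inner ℝ z.2 (ξ z.1)) • z.2) μ) :
    ∫ x, (a x • (∫ v, v ∂(μ.condKernel x)) +
        (∫ v, (innerSL ℝ v).smulRight v ∂(μ.condKernel x)) (ξ x)) ∂μ.fst =
      ∫ z, (a z.1 + inner ℝ z.2 (ξ z.1)) • z.2 ∂μ := by
  rw [← Measure.integral_condKernel hf]
  refine integral_congr_ae ?_
  filter_upwards [hv.condKernel_ae, hv2.condKernel_ae] with x hx hx2
  have hw : Integrable (fun v : E d => (innerSL ℝ v).smulRight v) (μ.condKernel x) := by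
    refine hx2.mono' (Continuous.aestronglyMeasurable ?_) (Eventually.of_forall fun v => ?_)
    · exact (isBoundedBilinearMap_smulRight (𝕜 := ℝ) (E := E d) (F := E d)).continuous.comp
        ((innerSL ℝ).continuous.prodMk continuous_id)
    · rw [ContinuousLinearMap.norm_smulRight_apply, innerSL_apply_norm, sq]
  have h1 : Integrable (fun v : E d => (inner ℝ v (ξ x)) • v) (μ.condKernel x) :=
    hw.apply_continuousLinearMap (ξ x)
  rw [ContinuousLinearMap.integral_apply hw, ← integral_smul]
  refine (integral_add (hx.smul (a x)) h1).symm.trans (integral_congr_ae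
    (Eventually.of_forall fun v => ?_))
  exact (add_smul (a x) (inner ℝ v (ξ x)) v).symm

end Disintegration

/-! ### Kinetic measure and Eulerian equations of a dissipative solution -/

namespace IsDissipative

variable {T : ℝ} {d : ℕ} {η : Measure (Curve T d)} [IsProbabilityMeasure η]

/-- This passes to the versions of position and velocity used in `MartingaleFlow`, so every kinetic
integral becomes an expectation along the flow. -/
lemma kinetic_eq (hT : 0 < T) (hη : IsDissipative η) {t : ℝ} (ht : t ∈ Ioo (-1) T) :
    kinetic η t = η.map (fun γ => (futurePos T t γ, η[W0 | futureSigma T d t] γ)) := by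
  refine Measure.map_congr ?_
  filter_upwards [hη.futurePos_ae_eq hT ht, hη.V_ae_eq hT t] with γ h1 h2
  rw [h1, h2]

lemma aemeasurable_phase (hT : 0 < T) (hη : IsDissipative η) (t : ℝ) :
    AEMeasurable (fun γ : Curve T d => (futurePos T t γ, η[W0 | futureSigma T d t] γ)) η :=
  ((hη.martingaleFlow hT).aesm_pos t).aemeasurable.prodMk
    ((hη.martingaleFlow hT).memLp_vel t).1.aemeasurable

lemma isProbabilityMeasure_kinetic (hT : 0 < T) (hη : IsDissipative η) {t : ℝ}
    (ht : t ∈ Ioo (-1) T) : IsProbabilityMeasure (kinetic η t) := by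
  rw [hη.kinetic_eq hT ht]
  exact Measure.isProbabilityMeasure_map (hη.aemeasurable_phase hT t)

lemma integral_kinetic {F : Type*} [NormedAddCommGroup F] [NormedSpace ℝ F]
    (hT : 0 < T) (hη : IsDissipative η) {t : ℝ} (ht : t ∈ Ioo (-1) T) {f : E d × E d → F}
    (hf : StronglyMeasurable f) :
    ∫ z, f z ∂(kinetic η t) =
      ∫ γ, f (futurePos T t γ, η[W0 | futureSigma T d t] γ) ∂η := by
  rw [hη.kinetic_eq hT ht]
  exact integral_map (hη.aemeasurable_phase hT t) hf.aestronglyMeasurable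

lemma memLp_kinetic_vel (hT : 0 < T) (hη : IsDissipative η) {t : ℝ} (ht : t ∈ Ioo (-1) T) :
    MemLp (fun z : E d × E d => z.2) 2 (kinetic η t) := by
  rw [hη.kinetic_eq hT ht, memLp_map_measure_iff continuous_snd.aestronglyMeasurable
    (hη.aemeasurable_phase hT t)]
  exact (hη.martingaleFlow hT).memLp_vel t

lemma kineticAction_eq (hT : 0 < T) (hη : IsDissipative η) {Φ : Phase d → ℝ}
    (hΦ : IsFlowTest T Φ) : kineticAction η Φ = ∫ t in Ioo (-1) T,
      ∫ γ, transport Φ (t, futurePos T t γ, η[W0 | futureSigma T d t] γ) ∂η :=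
  setIntegral_congr_fun measurableSet_Ioo fun _ ht => hη.integral_kinetic hT ht
    (hΦ.measurable_transport.comp measurable_prodMk_left).stronglyMeasurable

lemma integrableOn_integral_kinetic (hT : 0 < T) (hη : IsDissipative η)
    (F : BoundedContinuousFunction (Phase d) ℝ) :
    IntegrableOn (fun t => ∫ z, F (t, z) ∂(kinetic η t)) (Ioo (-1) T) := by
  have h := (hη.martingaleFlow hT).integrableOn_expectation
    (g := fun z => F (z.1, z.2.1, z.2.2.1)) (by fun_prop) (fun z => F.norm_coe_le_norm _)
    (Y := fun _ _ => (1 : ℝ)) (fun _ => memLp_const 1) (M := 1)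
    (fun t => by simp [lpNorm_const' (E := ℝ) (μ := η) (p := 2) (by norm_num) (by norm_num) 1])
    countable_empty (fun t _ => by simp) 0
  simp only [add_zero, sub_zero, smul_eq_mul, mul_one] at h
  refine h.congr_fun (fun t ht => ?_) measurableSet_Ioo
  exact (hη.integral_kinetic hT ht
    (F.continuous.comp (Continuous.prodMk_right t)).stronglyMeasurable).symm

/-- The continuity equation. -/
lemma integral_density_eq_zero (hT : 0 < T) (hη : IsDissipative η)
    (φ : 𝓓^{1}(spaceTimeOpen T d, ℝ)) :
    ∫ t in Ioo (-1) T, ∫ x, (deriv (fun s => φ (s, x)) t +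
      inner ℝ (meanVelocity η t x) (gradient (fun y => φ (t, y)) x)) ∂(density η t) = 0 := by
  have hΦ := isFlowTest_spaceTime φ
  have hφ : Differentiable ℝ φ := φ.contDiff.differentiable (by norm_num)
  rw [← (hη.martingaleFlow hT).integral_transport_eq_zero hΦ fun _ _ _ _ => rfl,
    ← hη.kineticAction_eq hT hΦ]
  refine setIntegral_congr_fun measurableSet_Ioo fun t ht => ?_
  have hv := hη.memLp_kinetic_vel hT ht
  obtain ⟨L, hL⟩ := hΦ.norm_transport_le
  have hi : Integrable (fun z => transport (fun z : Phase d => φ (z.1, z.2.1)) (t, z))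
      (kinetic η t) :=
    (((integrable_const 1).add (hv.integrable (by norm_num)).norm).const_mul L).mono'
      (hΦ.measurable_transport.comp measurable_prodMk_left).aestronglyMeasurable
      (Eventually.of_forall fun z => hL (t, z))
  simp only [transport_spaceTime hφ] at hi ⊢
  exact integral_fst_add_inner (hv.integrable (by norm_num)) hi

/-- The momentum equation. -/
lemma integral_momentum_eq_zero (hT : 0 < T) (hη : IsDissipative η)
    (φ : 𝓓^{1}(spaceTimeOpen T d, ℝ)) :
    ∫ t in Ioo (-1) T, ∫ x, (deriv (fun s => φ (s, x)) t • meanVelocity η t x +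
      momentumFlux η t x (gradient (fun y => φ (t, y)) x)) ∂(density η t) = 0 := by
  have hΦ := isFlowTest_spaceTime φ
  have hφ : Differentiable ℝ φ := φ.contDiff.differentiable (by norm_num)
  rw [← (hη.martingaleFlow hT).integral_transport_smul_vel_eq_zero hΦ fun _ _ _ _ => rfl]
  refine setIntegral_congr_fun measurableSet_Ioo fun t ht => ?_
  have hv := hη.memLp_kinetic_vel hT ht
  obtain ⟨L, hL⟩ := hΦ.norm_transport_le
  have hm : Measurable fun z => transport (fun z : Phase d => φ (z.1, z.2.1)) (t, z) :=
    hΦ.measurable_transport.comp measurable_prodMk_left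
  have hv2 : Integrable (fun z : E d × E d => ‖z.2‖ ^ 2) (kinetic η t) :=
    (memLp_two_iff_integrable_sq_norm hv.1).1 hv
  have hi : Integrable (fun z => transport (fun z : Phase d => φ (z.1, z.2.1)) (t, z) • z.2)
      (kinetic η t) := by
    refine ((((hv.integrable (by norm_num)).norm).add hv2).const_mul L).mono'
      (hm.smul measurable_snd).aestronglyMeasurable (Eventually.of_forall fun z => ?_)
    rw [norm_smul]
    refine (mul_le_mul_of_nonneg_right (hL (t, z)) (norm_nonneg _)).trans_eq ?_
    simp only [Pi.add_apply]
    ring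
  have hk := hη.integral_kinetic hT ht (hm.smul measurable_snd).stronglyMeasurable
  refine Eq.trans ?_ hk
  simp only [transport_spaceTime hφ] at hi ⊢
  exact integral_fst_smul_add (hv.integrable (by norm_num)) hv2 hi

end IsDissipative

end PressurelessEuler

end

theorem mainTheorem6 (d : ℕ) (T : ℝ) (hT : 0 < T) (η : Measure (Curve T d))
    [IsProbabilityMeasure η] (hη : IsDissipative η) :
    -- `ϖ_t` is a probability measure, and depends measurably on `t`
    (∀ t ∈ Ioo (-1) T, IsProbabilityMeasure (kinetic η t)) ∧
    (∀ F : BoundedContinuousFunction (Phase d) ℝ,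
      IntegrableOn (fun t => ∫ z, F (t, z) ∂(kinetic η t)) (Ioo (-1) T)) ∧
    (∃ π : 𝓓'^{1}(phaseOpen T d, E d),
      -- `∂_t ϖ + v · ∇_x ϖ + div_v π = 0` in the sense of distributions
      (∀ φ : 𝓓^{2}(phaseOpen T d, ℝ), - kineticAction η φ + divV π φ = 0) ∧
      -- `|⟨φ, π⟩| ≤ ‖∇_v φ‖_{C⁰}`
      (∀ φ : 𝓓^{1}(phaseOpen T d, ℝ), ‖π φ‖ ≤ ⨆ z : Phase d, ‖gradV φ z‖) ∧
      -- `⟨Ψ, div_v π⟩ ≥ 0`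
      (∀ (Ψ : Phase d → ℝ) (hΨ : IsConvexTest T Ψ), ∃ L : ℝ≥0∞,
        ∀ χ : 𝓓^{2}((⊤ : Opens (E d)), ℝ), IsCutoff χ →
          (∀ h2 : ContDiff ℝ 2 Ψ,
            Tendsto (fun n : ℕ => ((divV π (truncTest χ n hΨ h2) : ℝ) : EReal)) atTop
              (𝓝 (L : EReal))) ∧
          Tendsto (fun n : ℕ => ((kineticAction η (truncate χ n Ψ) : ℝ) : EReal)) atTop
            (𝓝 (L : EReal)))) ∧
    -- `∂_t ρ + div_x (ρ u) = 0`
    (∀ φ : 𝓓^{1}(spaceTimeOpen T d, ℝ),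
      ∫ t in Ioo (-1) T, ∫ x, (deriv (fun s => φ (s, x)) t +
        inner ℝ (meanVelocity η t x) (gradient (fun y => φ (t, y)) x)) ∂(density η t) = 0) ∧
    -- `∂_t (ρ u) + div_x (ρ w) = 0`
    (∀ φ : 𝓓^{1}(spaceTimeOpen T d, ℝ),
      ∫ t in Ioo (-1) T, ∫ x, (deriv (fun s => φ (s, x)) t • meanVelocity η t x +
        momentumFlux η t x (gradient (fun y => φ (t, y)) x)) ∂(density η t) = 0) := by
  have h := hη.martingaleFlow hT
  have hdiv : ∀ φ : 𝓓^{2}(phaseOpen T d, ℝ),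
      divV (h.defectDistribution hT) φ = kineticAction η φ := fun φ => by
    rw [h.divV_defectDistribution hT, hη.kineticAction_eq hT (isFlowTest_testFunction
      (by norm_num) φ)]
  refine ⟨fun t ht => hη.isProbabilityMeasure_kinetic hT ht, hη.integrableOn_integral_kinetic hT,
    ⟨h.defectDistribution hT, fun φ => ?_, h.norm_defectDistribution_le hT, fun Ψ hΨ => ?_⟩,
    hη.integral_density_eq_zero hT, hη.integral_momentum_eq_zero hT⟩
  · rw [hdiv, neg_add_cancel]
  · obtain ⟨L, hL⟩ := h.exists_tendsto_truncate hT hΨ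
    refine ⟨L, fun χ hχ => ?_⟩
    have hk : Tendsto (fun n : ℕ => ((kineticAction η (truncate χ n Ψ) : ℝ) : EReal)) atTop
        (𝓝 (L : EReal)) := by
      simpa only [hη.kineticAction_eq hT (hΨ.isFlowTest_truncate χ _)] using hL χ hχ
    -- For `Ψ` of class C² the truncation is a test function, and by the kinetic equation `divV` of
    -- the defect distribution acts on it as `kineticAction`. The two readings of the pairing
    -- coincide term by term.
    refine ⟨fun h2 => ?_, hk⟩
    simp only [hdiv]
    exact hk
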